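/- **Matrix data.** Let $e_{a,b}$ be the $n\times n$ matrix units. Consider one of the following affine types, with size $n$, Coxeter number $h$, constants $\kappa,\nu$, set $E_{>0}$ of positive exponents, and Weyl generators $E_i$ $(0\le i\le\ell)$, $F_i$ $(1\le i\le\ell)$. * $A_\ell$ ($\ell\ge1$): $n=h=\ell+1$, $\kappa=\nu=1$, $E_{>0}=\mathbb Z_{>0}\setminus h\mathbb Z$; $E_0=e_{1,n}$, $E_i=e_{i+1,i}$, $F_i=e_{i,i+1}$ $(1\le i\le\ell)$. * $B_\ell$ ($\ell\ge3$): $n=2\ell+1$, $h=2\ell$, $\kappa=\frac12$, $\nu=\sqrt2$, $E_{>0}$ the positive odd integers; $E_0=\frac12(e_{1,2\ell}+e_{2,2\ell+1})$, $E_i=e_{i+1,i}+e_{2\ell+2-i,2\ell+1-i}$ $(1\le i\le\ell)$, $F_i=e_{i,i+1}+e_{2\ell+1-i,2\ell+2-i}$ $(1\le i<\ell)$, $F_\ell=2(e_{\ell,\ell+1}+e_{\ell+1,\ell+2})$. * $C_\ell$ ($\ell\ge2$): $n=h=2\ell$, $\kappa=\nu=1$, $E_{>0}$ the positive odd integers;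 $E_0=e_{1,n}$, $E_i=e_{i+1,i}+e_{2\ell+1-i,2\ell-i}$, $F_i=e_{i,i+1}+e_{2\ell-i,2\ell+1-i}$ $(1\le i<\ell)$, $E_\ell=e_{\ell+1,\ell}$, $F_\ell=e_{\ell,\ell+1}$. * $D_\ell$ ($\ell\ge4$, $\ell$ odd): $n=2\ell$, $h=2\ell-2$, $\kappa=\frac12$, $\nu=\sqrt2$, $E_{>0}$ the positive integers that are odd or congruent to $\ell-1$ modulo $h$; $E_0=\frac12(e_{1,2\ell-1}+e_{2,2\ell})$, $E_i,F_i$ for $1\le i<\ell$ as for $C_\ell$, $E_\ell=\frac12(e_{\ell+1,\ell-1}+e_{\ell+2,\ell})$, $F_\ell=2(e_{\ell-1,\ell+1}+e_{\ell,\ell+2})$. * $G_2$ ($\ell=2$): $n=7$, $h=6$, $\kappa=\frac12$, $\nu=\sqrt2$, $E_{>0}=\{j>0: j\equiv\pm1 \bmod 6\}$; $E_0=\frac12(e_{1,6}+e_{2,7})$, $E_1=e_{2,1}+e_{4,3}+e_{5,4}+e_{7,6}$, $F_1=e_{1,2}+2e_{3,4}+2e_{4,5}+e_{6,7}$, $E_2=e_{3,2}+e_{6,5}$,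 $F_2=e_{2,3}+e_{5,6}$. Let $\mathring{\mathfrak g}$ be the Lie algebra generated by $E_i,F_i$, $1\le i\le\ell$, with invariant form $(X|Y)_0=\kappa\,\mathrm{Tr}(XY)$, and let $\mathfrak g$ be the affine algebra (a central extension of the loop algebra of $\mathring{\mathfrak g}$ by $\mathbb C c$), with $[Xz^j,Yz^k]=[X,Y]z^{j+k}+\delta_{j,-k}\,j\,(X|Y)_0\,c$. Put $\Lambda=zE_0+E_1+\dots+E_\ell$ and $\Lambda_j=\nu\Lambda^j$ for $j\in E_{>0}$, except that in type $D_\ell$, for $j=k(\ell-1)$ with $k$ odd, $\Lambda_j=\sqrt{2\ell-2}\,\Gamma^k$ with $$\Gamma=-\mu\Big(e_{\ell,1}-\tfrac12e_{\ell+1,1}-\tfrac z2e_{\ell,2\ell}+\tfrac z4e_{\ell+1,2\ell}+(-1)^\ell\big(e_{2\ell,\ell+1}-\tfrac12e_{2\ell,\ell}-\tfrac z2e_{1,\ell+1}+\tfrac z4e_{1,\ell}\big)\Big),\qquad \mu=\sqrt{-1}.$$ Put $z=\zeta^h$, $\omega=e^{2\pi\mathbf i/h}$ and $\xi_k=\omega^k\zeta$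 for $0\le k<h$. The matrix $P(\zeta)$ is $\frac1h$ times the matrix with the following columns. Types $A,C$: $(1,\xi_k^{-1},\dots,\xi_k^{-(n-1)})^T$, $0\le k<h$. Types $B$, $G_2$: $(\frac12,\xi_k^{-1},\dots,\xi_k^{-h})^T$, $0\le k<h$, followed by $(\frac h2,0,\dots,0,-h\zeta^{-h})^T$. Type $D$: $(\frac12,\xi_k^{-1},\dots,\xi_k^{-(\ell-1)},\frac12\xi_k^{-(\ell-1)},\xi_k^{-\ell},\dots,\xi_k^{-(2\ell-2)})^T$, $0\le k<h$, followed by $(\ell-1)(\frac12,0,\dots,0,\mp\frac1\mu\zeta^{-(\ell-1)},\pm\frac1{2\mu}\zeta^{-(\ell-1)},0,\dots,0,-\zeta^{-(2\ell-2)})^T$ (the upper signs first; the two middle entries are in rows $\ell,\ell+1$). Then $D_j:=P(\zeta)^{-1}\Lambda_jP(\zeta)\zeta^{-j}$ is a constant diagonal matrix; let $D=\sum_{j\in E_{>0},\,j<h}D_j$. **Solutions and tau functions.** Everything is formal: the dependence on the times $\mathbf t=(t_j)_{j\in E_{>0}}$ is by formal power series in $\mathbf t$, with coefficients that are formal Laurent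 series in $z^{-1}$ (or $\zeta^{-1}$). Let $\Theta(\mathbf t;z)=\exp Y$, where $Y=\sum_{k\ge1}Y_k(\mathbf t)z^{-k}$ and all coefficients of the $Y_k$ lie in $\mathring{\mathfrak g}$, be a solution of the Drinfeld–Sokolov hierarchy $$\frac{\partial\Theta}{\partial t_j}=(\Theta\Lambda_j\Theta^{-1})_{<0}\,\Theta,\qquad j\in E_{>0},$$ where $(\cdot)_{<0}$ keeps the strictly negative powers of $z$. Let $\tau$ be a tau function of $\Theta$: a formal power series in $\mathbf t$ with nonzero constant term such that $\partial_{t_j}\log\tau=-(\Theta\Lambda_j\Theta^{-1})_c$ for all $j\in E_{>0}$, where $(\Theta\Lambda_j\Theta^{-1})_c$ is the coefficient of $c$ in $e^{\mathrm{ad}_Y}\Lambda_j$ computed in $\mathfrak g$. Put $$w(\mathbf t;z)=\exp\Big(\sum_{j\in E_{>0}}t_j\Lambda_j\Big)\Theta^{-1},\qquad \Psi(\zeta)=P(\zeta)^{-1}w(\mathbf t;\zeta^h),\qquad K(\zeta)=\Psi(\zeta)^{-1}D\,\Psi(\zeta),$$ $$F_m(\zeta_1,\dots,\zeta_m)=\sum_{j_1,\dots,j_m\in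 E_{>0}}\frac1{\zeta_1^{j_1}\cdots\zeta_m^{j_m}}\frac{\partial^m\log\tau}{\partial t_{j_1}\cdots\partial t_{j_m}},$$ $$M_1(\zeta_1)\star\dots\star M_m(\zeta_m)=\frac{\zeta_1^h\cdots\zeta_m^h\,M_1(\zeta_1)\cdots M_m(\zeta_m)}{(\zeta_2^h-\zeta_1^h)\cdots(\zeta_m^h-\zeta_{m-1}^h)(\zeta_1^h-\zeta_m^h)}.$$ **Theorem.** For every such $\Theta$ and $\tau$: (i) $\displaystyle F_1(\zeta)=\frac\kappa h\mathrm{Tr}\big(\zeta\,\partial_\zeta\Psi(\zeta)\cdot\Psi(\zeta)^{-1}D\big)-\sum_{j\in E_{>0}}j\,t_j\,\zeta^j$; (ii) for every $m\ge2$, $$F_m(\zeta_1,\dots,\zeta_m)=-\frac1m\sum_{\rho\in S_m}\kappa\,\mathrm{Tr}\big(K(\zeta_{\rho(1)})\star\dots\star K(\zeta_{\rho(m)})\big)-\delta_{m,2}\sum_{\substack{j\in E_{>0}\\ j<h}}\frac{j\,(\zeta_1^{j}\zeta_2^{2h-j}+\zeta_1^{2h-j}\zeta_2^{j})}{(\zeta_1^h-\zeta_2^h)^2}.$$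 The identities in (ii) hold coefficientwise in $\mathbf t$, in the field of formal Laurent (Hahn) series in $\zeta_1^{-1},\dots,\zeta_m^{-1}$ with lexicographically ordered exponents, which contains the rational functions of the $\zeta_i$. -/

import Mathlib

noncomputable section

namespace DrinfeldSokolov

attribute [local instance] LieRing.ofAssociativeRing

/-! ### Formal Laurent series in one and in several loop variables -/

/-- `Loop` is `ℂ((x⁻¹))`, the field of formal Laurent series in `x⁻¹`, where `x` is a loop variable
(`z` or `ζ`). The coefficient of `x ^ (-k)` is the Hahn series coefficient at `k`. -/
abbrev Loop : Type := LaurentSeries ℂ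

/-- The monomial `c x ^ k`. -/
def mono (k : ℤ) (c : ℂ) : Loop := HahnSeries.single (-k) c

/-- The Euler operator `x d/dx`. -/
def euler (f : Loop) : Loop where
  coeff k := -(k : ℂ) * f.coeff k
  isPWO_support' := f.isPWO_support.mono (by
    intro k hk
    simp only [Function.mem_support, ne_eq, HahnSeries.mem_support] at hk ⊢
    exact fun h => hk (by rw [h, mul_zero]))

/-- The part of `f` consisting of the strictly negative powers of `x`. -/
def negPart (f : Loop) : Loop where
  coeff k := if 0 < k then f.coeff k else 0
  isPWO_support' := f.isPWO_support.mono (by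
    intro k hk
    simp only [Function.mem_support, ne_eq, HahnSeries.mem_support] at hk ⊢
    intro h
    exact hk (by rw [h, ite_self]))

/-- The substitution `x = y ^ h`. -/
def substPow (h : ℕ) (hh : 0 < h) : Loop →+* Loop :=
  HahnSeries.embDomainRingHom (AddMonoidHom.mulLeft (h : ℤ))
    (fun a b hab => by
      have h0 : (h : ℤ) ≠ 0 := by exact_mod_cast hh.ne'
      exact mul_left_cancel₀ h0 hab)
    (fun a b => by
      have h0 : (0 : ℤ) < h := by exact_mod_cast hh
      simpa using mul_le_mul_iff_right₀ h0)

/-- The field of formal Laurent (Hahn) series in `ζ₁⁻¹, …, ζₘ⁻¹`, the exponents `Fin m → ℤ` being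
ordered lexicographically. The coefficient of `ζ₁ ^ (-v₁) ⋯ ζₘ ^ (-vₘ)` is the one at `v`.
Rational functions of the `ζᵢ` are elements of this field. -/
abbrev MultiLoop (m : ℕ) : Type := HahnSeries (Lex (Fin m → ℤ)) ℂ

/-- The exponent vector that is `a` in place `i` and `0` elsewhere. -/
def placeExp {m : ℕ} (i : Fin m) : ℤ →+ Lex (Fin m → ℤ) where
  toFun a := toLex (Pi.single i a)
  map_zero' := by rw [Pi.single_zero]; rfl
  map_add' a b := by rw [Pi.single_add]; rfl

theorem placeExp_strictMono {m : ℕ} (i : Fin m) : StrictMono (placeExp i) := by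
  intro a b hab
  refine ⟨i, fun j hj => ?_, ?_⟩
  · simp [placeExp, Pi.single_eq_of_ne (ne_of_lt hj)]
  · simpa [placeExp] using hab

/-- The embedding `f(x) ↦ f(ζᵢ)`. -/
def inVar {m : ℕ} (i : Fin m) : Loop →+* MultiLoop m :=
  HahnSeries.embDomainRingHom (placeExp i) (placeExp_strictMono i).injective
    (fun _ _ => (placeExp_strictMono i).le_iff_le)

/-- The variable `ζᵢ`. -/
def zeta {m : ℕ} (i : Fin m) : MultiLoop m := inVar i (mono 1 1)

theorem isPWO_nonneg (m : ℕ) : {v : Lex (Fin m → ℤ) | ∀ i, 0 ≤ ofLex v i}.IsPWO := by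
  have h1 : (Set.univ : Set (Fin m → ℕ)).IsPWO := Set.isPWO_of_wellQuasiOrderedLE _
  have hm : Monotone (fun w : Fin m → ℕ => toLex (fun i => (w i : ℤ))) := by
    intro a b hab
    exact Pi.toLex_monotone (fun i => by exact_mod_cast hab i)
  refine (h1.image_of_monotone hm).mono ?_
  intro v hv
  refine ⟨fun i => (ofLex v i).toNat, Set.mem_univ _, ?_⟩
  apply ofLex.injective
  funext i
  exact Int.toNat_of_nonneg (hv i)

/-! ### The matrix realizations -/

/-- The affine types `A_ℓ` (`ℓ ≥ 1`), `B_ℓ` (`ℓ ≥ 3`), `C_ℓ` (`ℓ ≥ 2`), `D_ℓ` (`ℓ ≥ 4` odd)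
and `G₂`. -/
inductive AffType : Type
  | A (l : ℕ) (hl : 1 ≤ l)
  | B (l : ℕ) (hl : 3 ≤ l)
  | C (l : ℕ) (hl : 2 ≤ l)
  | D (l : ℕ) (hl : 4 ≤ l) (hodd : Odd l)
  | G

namespace AffType

/-- The rank `ℓ` of the finite-dimensional simple Lie algebra. -/
def rank : AffType → ℕ
  | A l _ => l
  | B l _ => l
  | C l _ => l
  | D l _ _ => l
  | G => 2

/-- The size `n` of the matrices. -/
def size : AffType → ℕ
  | A l _ => l + 1
  | B l _ => 2 * l + 1
  | C l _ => 2 * l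
  | D l _ _ => 2 * l
  | G => 7

/-- The Coxeter number `h`. -/
def cox : AffType → ℕ
  | A l _ => l + 1
  | B l _ => 2 * l
  | C l _ => 2 * l
  | D l _ _ => 2 * l - 2
  | G => 6

theorem cox_pos (X : AffType) : 0 < X.cox := by
  cases X <;> simp only [cox] <;> omega

/-- The constant `κ` such that `(M | N)₀ = κ Tr (M N)` is the standard invariant form. -/
def kappa : AffType → ℂ
  | A _ _ => 1
  | B _ _ => 1 / 2
  | C _ _ => 1
  | D _ _ _ => 1 / 2
  | G => 1 / 2

/-- The normalization constant `ν` in `Λ₁ = ν Λ`. -/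
def nu : AffType → ℂ
  | A _ _ => 1
  | B _ _ => (Real.sqrt 2 : ℝ)
  | C _ _ => 1
  | D _ _ _ => (Real.sqrt 2 : ℝ)
  | G => (Real.sqrt 2 : ℝ)

/-- The set `E_{>0}` of positive exponents of the affine algebra. -/
def exponents : AffType → Set ℕ
  | A l _ => {j | ¬ (l + 1) ∣ j}
  | B _ _ => {j | Odd j}
  | C _ _ => {j | Odd j}
  | D l _ _ => {j | Odd j ∨ j % (2 * l - 2) = l - 1}
  | G => {j | j % 6 = 1 ∨ j % 6 = 5}

/-- Complex `n × n` matrices. -/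
abbrev CMat (X : AffType) : Type := Matrix (Fin X.size) (Fin X.size) ℂ

/-- The matrix unit `e_{a,b}`, with rows and columns numbered from `1` to `n`. -/
def unit (X : AffType) (a b : ℕ) : X.CMat :=
  Matrix.of fun p q => if (p : ℕ) + 1 = a ∧ (q : ℕ) + 1 = b then 1 else 0

/-- The Weyl generators `E_i`, `0 ≤ i ≤ ℓ` (`E_0` is a lowest root vector). -/
def weylE (X : AffType) (i : ℕ) : X.CMat :=
  match X with
  | A l hl =>
    let e := (A l hl).unit
    if i = 0 then e 1 (l + 1) else e (i + 1) i
  | B l hl =>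
    let e := (B l hl).unit
    if i = 0 then (1 / 2 : ℂ) • (e 1 (2 * l) + e 2 (2 * l + 1))
    else e (i + 1) i + e (2 * l + 2 - i) (2 * l + 1 - i)
  | C l hl =>
    let e := (C l hl).unit
    if i = 0 then e 1 (2 * l)
    else if i = l then e (l + 1) l
    else e (i + 1) i + e (2 * l + 1 - i) (2 * l - i)
  | D l hl ho =>
    let e := (D l hl ho).unit
    if i = 0 then (1 / 2 : ℂ) • (e 1 (2 * l - 1) + e 2 (2 * l))
    else if i = l then (1 / 2 : ℂ) • (e (l + 1) (l - 1) + e (l + 2) l)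
    else e (i + 1) i + e (2 * l + 1 - i) (2 * l - i)
  | G =>
    let e := G.unit
    if i = 0 then (1 / 2 : ℂ) • (e 1 6 + e 2 7)
    else if i = 1 then e 2 1 + e 4 3 + e 5 4 + e 7 6
    else e 3 2 + e 6 5

/-- The Weyl generators `F_i`, `1 ≤ i ≤ ℓ`. -/
def weylF (X : AffType) (i : ℕ) : X.CMat :=
  match X with
  | A l hl =>
    let e := (A l hl).unit
    e i (i + 1)
  | B l hl =>
    let e := (B l hl).unit
    if i = l then (2 : ℂ) • (e l (l + 1) + e (l + 1) (l + 2))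
    else e i (i + 1) + e (2 * l + 1 - i) (2 * l + 2 - i)
  | C l hl =>
    let e := (C l hl).unit
    if i = l then e l (l + 1)
    else e i (i + 1) + e (2 * l - i) (2 * l + 1 - i)
  | D l hl ho =>
    let e := (D l hl ho).unit
    if i = l then (2 : ℂ) • (e (l - 1) (l + 1) + e l (l + 2))
    else e i (i + 1) + e (2 * l - i) (2 * l + 1 - i)
  | G =>
    let e := G.unit
    if i = 1 then e 1 2 + (2 : ℂ) • (e 3 4 + e 4 5) + e 6 7
    else e 2 3 + e 5 6

/-- The simple Lie algebra, realized by `n × n` matrices: it is generated by the `E_i`, `F_i` with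
`1 ≤ i ≤ ℓ`. -/
def finiteAlg (X : AffType) : LieSubalgebra ℂ X.CMat :=
  LieSubalgebra.lieSpan ℂ X.CMat
    {M | ∃ i, 1 ≤ i ∧ i ≤ X.rank ∧ (M = X.weylE i ∨ M = X.weylF i)}

/-! ### The principal Heisenberg subalgebra and its diagonalization -/

/-- `n × n` matrices of formal Laurent series in the inverse loop variable. -/
abbrev LMat (X : AffType) : Type := Matrix (Fin X.size) (Fin X.size) Loop

/-- The constant matrix `M`, times `x ^ k`. -/
def monoMat (X : AffType) (k : ℤ) (M : X.CMat) : X.LMat := M.map (mono k)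

/-- `Λ = ∑ e_i`, where `e_0 = z E_0` and `e_i = E_i` for `1 ≤ i ≤ ℓ`. -/
def Lam (X : AffType) : X.LMat :=
  ∑ i ∈ Finset.range (X.rank + 1), X.monoMat (if i = 0 then 1 else 0) (X.weylE i)

/-- The matrix `Γ` of type `D_ℓ`; here `ℓ` is odd, so that `μ = √-1` and `(-1) ^ ℓ = -1`. -/
def Gam (l : ℕ) (hl : 4 ≤ l) (ho : Odd l) : (D l hl ho).LMat :=
  let e := (D l hl ho).unit
  let mu : ℂ := Complex.I
  (D l hl ho).monoMat 0 (-mu • (e l 1 - (1 / 2 : ℂ) • e (l + 1) 1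
      + (-1 : ℂ) ^ l • (e (2 * l) (l + 1) - (1 / 2 : ℂ) • e (2 * l) l)))
    + (D l hl ho).monoMat 1 (-mu • (-(1 / 2 : ℂ) • e l (2 * l) + (1 / 4 : ℂ) • e (l + 1) (2 * l)
      + (-1 : ℂ) ^ l • (-(1 / 2 : ℂ) • e 1 (l + 1) + (1 / 4 : ℂ) • e 1 l)))

/-- The generator `Λ_j` (as a function of `z`) of the principal Heisenberg subalgebra, for a
positive exponent `j`. In type `D_ℓ` an even exponent is `j = k (ℓ - 1)` with `k` odd. -/
def LamJ (X : AffType) (j : ℕ) : X.LMat :=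
  match X with
  | D l hl ho =>
    if Odd j then (D l hl ho).nu • (D l hl ho).Lam ^ j
    else ((Real.sqrt (2 * (l : ℝ) - 2) : ℝ) : ℂ) • Gam l hl ho ^ (j / (l - 1))
  | X => X.nu • X.Lam ^ j

/-- `ω = exp (2 π i / h)`. -/
def omega (X : AffType) : ℂ := Complex.exp (2 * Real.pi * Complex.I / (X.cox : ℂ))

/-- The diagonalizing matrix `P(ζ)`. Row and column indices `a`, `k` start from `0` here. -/
def P (X : AffType) : X.LMat :=
  match X with
  | A l hl => Matrix.of fun a k =>
      mono (-(a : ℤ)) ((1 / ((l : ℂ) + 1)) * ((A l hl).omega ^ ((k : ℕ) * (a : ℕ)))⁻¹)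
  | B l hl => Matrix.of fun a k =>
      mono (-(a : ℤ)) ((1 / (2 * (l : ℂ))) *
        (if (k : ℕ) < 2 * l then
          (if (a : ℕ) = 0 then 1 / 2 else ((B l hl).omega ^ ((k : ℕ) * (a : ℕ)))⁻¹)
        else if (a : ℕ) = 0 then (l : ℂ)
        else if (a : ℕ) = 2 * l then -(2 * (l : ℂ))
        else 0))
  | C l hl => Matrix.of fun a k =>
      mono (-(a : ℤ)) ((1 / (2 * (l : ℂ))) * ((C l hl).omega ^ ((k : ℕ) * (a : ℕ)))⁻¹)
  | D l hl ho => Matrix.of fun a k =>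
      let mu : ℂ := Complex.I
      let r : ℕ := if (a : ℕ) < l then a else (a : ℕ) - 1
      let s : ℂ := if (k : ℕ) = 2 * l - 2 then -1 else 1
      mono (-(r : ℤ)) ((1 / (2 * (l : ℂ) - 2)) *
        (if (k : ℕ) < 2 * l - 2 then
          (if (a : ℕ) = 0 ∨ (a : ℕ) = l then 1 / 2 else 1)
            * ((D l hl ho).omega ^ ((k : ℕ) * r))⁻¹
        else ((l : ℂ) - 1) *
          (if (a : ℕ) = 0 then 1 / 2
          else if (a : ℕ) = l - 1 then s / mu
          else if (a : ℕ) = l then -s / (2 * mu)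
          else if (a : ℕ) = 2 * l - 1 then -1
          else 0)))
  | G => Matrix.of fun a k =>
      mono (-(a : ℤ)) ((1 / 6) *
        (if (k : ℕ) < 6 then
          (if (a : ℕ) = 0 then 1 / 2 else (G.omega ^ ((k : ℕ) * (a : ℕ)))⁻¹)
        else if (a : ℕ) = 0 then 3
        else if (a : ℕ) = 6 then -6
        else 0))

/-- `D_j = P(ζ)⁻¹ Λ_j P(ζ) ζ ^ (-j)`, where `Λ_j` is taken at `z = ζ ^ h`. -/
def Dj (X : AffType) (j : ℕ) : X.LMat :=
  mono (-(j : ℤ)) 1 • (X.P⁻¹ * (X.LamJ j).map (substPow X.cox X.cox_pos) * X.P)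

open scoped Classical in
/-- The exponents `j` with `0 < j < h`. -/
def smallExp (X : AffType) : Finset ℕ :=
  (Finset.range X.cox).filter fun j => j ∈ X.exponents

/-- `D = ∑ D_j`, the sum being over the exponents `0 < j < h`. -/
def bigD (X : AffType) : X.LMat := ∑ j ∈ X.smallExp, X.Dj j

/-! ### Formal power series in the times `t_j` -/

/-- The index set of the times `t_j`, `j ∈ E_{>0}`. -/
abbrev Idx (X : AffType) : Type := {j : ℕ // j ∈ X.exponents}

/-- Formal power series in the times with complex coefficients. -/
abbrev TSer (X : AffType) : Type := MvPowerSeries X.Idx ℂ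

/-- Formal power series in the times, whose coefficients are Laurent series in the inverse loop
variable. -/
abbrev TLoop (X : AffType) : Type := MvPowerSeries X.Idx Loop

/-- `n × n` matrices over `X.TLoop`. -/
abbrev TMat (X : AffType) : Type := Matrix (Fin X.size) (Fin X.size) X.TLoop

/-- `n × n` matrices of formal power series in the times, whose coefficients are power series in
the inverse loop variable `x⁻¹`. -/
abbrev TMatNeg (X : AffType) : Type :=
  Matrix (Fin X.size) (Fin X.size) (MvPowerSeries X.Idx (PowerSeries ℂ))

/-- A power series in `x⁻¹` seen as a Laurent series in `x⁻¹`, for matrices. -/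
def TMatNeg.toTMat {X : AffType} (M : X.TMatNeg) : X.TMat :=
  M.map (MvPowerSeries.map (HahnSeries.ofPowerSeries ℤ ℂ))

/-- A time-independent matrix. -/
def const (X : AffType) (M : X.LMat) : X.TMat := M.map MvPowerSeries.C

/-- `∑ c_j t_j`, the sum being over all `j ∈ E_{>0}`. -/
def linear (X : AffType) (c : X.Idx → Loop) : X.TLoop :=
  fun d => ∑ j ∈ d.support, if d = Finsupp.single j 1 then c j else 0

/-- The exponential `∑ Mⁿ / n!` of a matrix `M` without constant term in the times: the terms with
`n` greater than the total degree of `d` do not contribute to the coefficient of `t ^ d`. -/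
def expTime (X : AffType) (M : X.TMat) : X.TMat :=
  Matrix.of fun a b => fun d =>
    ∑ n ∈ Finset.range (d.degree + 1),
      ((n.factorial : ℂ)⁻¹) • MvPowerSeries.coeff d ((M ^ n) a b)

/-- `g(t; z) = exp (∑ t_j Λ_j)`, the sum being over all `j ∈ E_{>0}`. -/
def g (X : AffType) : X.TMat :=
  X.expTime (Matrix.of fun a b => X.linear fun j => X.LamJ j.1 a b)

/-- `Y` takes values in the (completed) subalgebra of the affine algebra that has negative degree
in the homogeneous gradation: all coefficients lie in the simple Lie algebra, and only strictly
negative powers of `z` occur. -/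
def IsNegative (X : AffType) (Y : X.TMatNeg) : Prop :=
  ∀ (d : X.Idx →₀ ℕ) (k : ℕ),
    (Matrix.of fun a b => PowerSeries.coeff k (MvPowerSeries.coeff d (Y a b))) ∈ X.finiteAlg ∧
    (k = 0 → ∀ a b, PowerSeries.coeff k (MvPowerSeries.coeff d (Y a b)) = 0)

/-- The exponential `∑ Yⁿ / n!` of a matrix `Y` of series in strictly negative powers of `z`: the
terms with `n > k` do not contribute to the coefficient of `z ^ (-k)`. -/
def expNeg (X : AffType) (Y : X.TMatNeg) : X.TMatNeg :=
  Matrix.of fun a b => fun d => PowerSeries.mk fun k =>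
    ∑ n ∈ Finset.range (k + 1),
      ((n.factorial : ℂ)⁻¹) * PowerSeries.coeff k (MvPowerSeries.coeff d ((Y ^ n) a b))

/-- `Θ = exp Y`, an element of the Lie group of the subalgebra of negative homogeneous degree. -/
def Theta (X : AffType) (Y : X.TMatNeg) : X.TMat := (X.expNeg Y).toTMat

/-- The part of `f` consisting of the strictly negative powers of the loop variable. -/
def negT (X : AffType) (f : X.TLoop) : X.TLoop := fun d => negPart (MvPowerSeries.coeff d f)

/-- The Drinfeld–Sokolov hierarchy `∂Θ/∂t_j = (Θ Λ_j Θ⁻¹)_{<0} Θ`, `j ∈ E_{>0}`. -/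
def IsSolution (X : AffType) (Y : X.TMatNeg) : Prop :=
  ∀ j : X.Idx,
    (X.Theta Y).map (MvPowerSeries.pderiv Loop j) =
      (X.Theta Y * X.const (X.LamJ j.1) * (X.Theta Y)⁻¹).map X.negT * X.Theta Y

/-! ### The central extension and the tau function -/

/-- The Euler operator `x ∂/∂x` on series in the times and the loop variable. -/
def eulerT (X : AffType) (f : X.TLoop) : X.TLoop := fun d => euler (MvPowerSeries.coeff d f)

/-- The 2-cocycle of the affine algebra: it is bilinear over the series in the times, and
`(M z ^ j, N z ^ k) ↦ δ_{j,-k} j (M | N)₀` with `(M | N)₀ = κ Tr (M N)`. -/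
def cocycle (X : AffType) (M N : X.TMat) : X.TSer :=
  fun d => X.kappa *
    (MvPowerSeries.coeff d (Matrix.trace (M.map X.eulerT * N))).coeff 0

/-- The bracket of the affine algebra; the pair `(M, a)` stands for `M + a c`. -/
def affBracket (X : AffType) (U V : X.TMat × X.TSer) : X.TMat × X.TSer :=
  (U.1 * V.1 - V.1 * U.1, X.cocycle U.1 V.1)

/-- The coordinate `(Θ Λ_j Θ⁻¹)_c`, where `Θ = exp Y` acts on the affine algebra by the adjoint
action `exp (ad Y)`. Only finitely many terms of the sum are nonzero. -/
def centralCoord (X : AffType) (Y : X.TMatNeg) (j : ℕ) : X.TSer :=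
  ∑ᶠ n : ℕ, ((n.factorial : ℂ)⁻¹) •
    ((X.affBracket (Y.toTMat, 0))^[n] (X.const (X.LamJ j), 0)).2

/-- The logarithm `log c + ∑_{n ≥ 1} (-1) ^ (n+1) (τ / c - 1) ^ n / n` of a power series `τ` with
constant term `c ≠ 0`: the terms with `n` greater than the total degree of `d` do not contribute
to the coefficient of `t ^ d`. -/
def logSer (X : AffType) (tau : X.TSer) : X.TSer := fun d =>
  (if d = 0 then Complex.log (MvPowerSeries.constantCoeff tau) else 0) +
    ∑ n ∈ Finset.Icc 1 d.degree, ((-1 : ℂ) ^ (n + 1) / (n : ℂ)) *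
      MvPowerSeries.coeff d
        ((MvPowerSeries.C (MvPowerSeries.constantCoeff tau)⁻¹ * tau - 1) ^ n)

/-- `τ` is a tau function of the solution `Θ = exp Y`: `∂ log τ / ∂t_j = - (Θ Λ_j Θ⁻¹)_c`. -/
def IsTau (X : AffType) (Y : X.TMatNeg) (tau : X.TSer) : Prop :=
  MvPowerSeries.constantCoeff tau ≠ 0 ∧
    ∀ j : X.Idx, MvPowerSeries.pderiv ℂ j (X.logSer tau) = -X.centralCoord Y j.1

/-! ### The wave function -/

/-- The wave function `w = g Θ⁻¹`. -/
def wave (X : AffType) (Y : X.TMatNeg) : X.TMat := X.g * (X.Theta Y)⁻¹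

/-- `Ψ(ζ) = P(ζ)⁻¹ w(ζ ^ h)`. -/
def Psi (X : AffType) (Y : X.TMatNeg) : X.TMat :=
  X.const X.P⁻¹ * (X.wave Y).map (MvPowerSeries.map (substPow X.cox X.cox_pos))

/-- `K(ζ) = Ψ(ζ)⁻¹ D Ψ(ζ)`. -/
def K (X : AffType) (Y : X.TMatNeg) : X.TMat :=
  (X.Psi Y)⁻¹ * X.const X.bigD * X.Psi Y

/-! ### Generating series and the star product -/

/-- Formal power series in the times, whose coefficients are series in `ζ₁⁻¹, …, ζₘ⁻¹`. -/
abbrev TMulti (X : AffType) (m : ℕ) : Type := MvPowerSeries X.Idx (MultiLoop m)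

/-- The iterated derivative `∂ᵐ f / ∂t_{j₁} ⋯ ∂t_{jₘ}`. -/
def iterPderiv (X : AffType) {m : ℕ} (j : Fin m → X.Idx) (f : X.TSer) : X.TSer :=
  (List.ofFn j).foldr (fun i f => MvPowerSeries.pderiv ℂ i f) f

open scoped Classical in
/-- The generating series `F_m(ζ₁, …, ζₘ) = ∑ ζ₁ ^ (-j₁) ⋯ ζₘ ^ (-jₘ) ∂ᵐ log τ / ∂t_{j₁} ⋯ ∂t_{jₘ}`,
the sum being over all `j₁, …, jₘ ∈ E_{>0}`. -/
def genSeries (X : AffType) (tau : X.TSer) (m : ℕ) : X.TMulti m := fun d =>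
  { coeff := fun v =>
      if hv : ∀ i, 0 ≤ ofLex v i ∧ (ofLex v i).toNat ∈ X.exponents then
        MvPowerSeries.coeff d
          (X.iterPderiv (fun i => ⟨(ofLex v i).toNat, (hv i).2⟩) (X.logSer tau))
      else 0
    isPWO_support' := (isPWO_nonneg m).mono (by
      intro v hv
      by_contra hn
      refine hv (dif_neg fun h => hn fun i => (h i).1)) }

/-- `f(ζ) ↦ f(ζᵢ)` on series in the times and one loop variable. -/
def atVar (X : AffType) {m : ℕ} (i : Fin m) : X.TLoop →+* X.TMulti m :=
  MvPowerSeries.map (inVar i)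

/-- The star product `M₁(x₁) ⋆ ⋯ ⋆ Mₘ(xₘ)`, that is
`x₁ ^ h ⋯ xₘ ^ h M₁ ⋯ Mₘ / ((x₂ ^ h - x₁ ^ h) ⋯ (xₘ ^ h - xₘ₋₁ ^ h) (x₁ ^ h - xₘ ^ h))`. -/
def star (X : AffType) {m : ℕ} (x : Fin m → MultiLoop m)
    (M : Fin m → Matrix (Fin X.size) (Fin X.size) (X.TMulti m)) :
    Matrix (Fin X.size) (Fin X.size) (X.TMulti m) :=
  ((∏ i, x i ^ X.cox) / ∏ i, (x (finRotate m i) ^ X.cox - x i ^ X.cox)) • (List.ofFn M).prod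

end AffType

end DrinfeldSokolov

end

/-! All identities are proved one coefficient of `ζ₁` at a time. The matrix `P` simultaneously
diagonalizes the `Λ_j` (`exists_diagData`), and `D` is chosen so that `P D P⁻¹` is the sum of `ζ ^
(-a) Λ_a(ζ ^ h)` over the exponents `0 < a < h`. Hence `P` and the vacuum factor `g` drop out of
`K`, which is the superposition of the dressed elements `Θ Λ_a Θ⁻¹` (`K_eq_sum`). Because `Λ_{a+h} =
z Λ_a`, it encodes `Θ Λ_n Θ⁻¹` for every `n`.

One point. The formula for the derivative of an exponential and the invariance of the trace form
turn the central coordinate into the residue of `κ Tr (Θ⁻¹ (z ∂_z Θ) Λ_j)` (`centralCoord_eq`);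
superposed over the residue classes modulo `h` these residues are `F_1` (`genSeries_one`). The
logarithmic derivative of `Ψ`, traced against `D`, has three contributions: that of `P` vanishes by
homogeneity, that of `g` is `∑ j t_j ζ ^ j` up to the factor `h / κ`, and that of `Θ` is the residue
series (`firstSeries_eq`).

Induction on the number of points. The coefficient of `ζ₁ ^ (-n)` in `F_{m+1}` is `∂F_m / ∂t_n`, or
zero if `n` is not a positive exponent. The hierarchy gives `∂K / ∂t_n = [V_n, K]`, where `V_n` is
minus the part of `Θ Λ_n Θ⁻¹` with nonnegative powers of `z`, at `z = ζ ^ h` (`pderivM_K`). On the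
other hand `V_n` (`flowGen`) is, for every integer `n`, the coefficient of `ζ₁ ^ (-n)` in `ζ₁ ^ h
K(ζ₁) / (ζ ^ h - ζ₁ ^ h)`: the two satisfy the same recursion in steps of `h` and vanish for very
negative `n` (`headT_eq_of_recursion`). When `ζ₁` is inserted into a cyclic word, partial fractions
leave simple poles at its two neighbours with opposite signs (`starFactor_cons`), so the coefficient
involves a difference of two `V_n`. A rotation under the trace turns this difference into the
commutator `[V_n, K]`, that is, into the flow (`headT_starSum_of_mem`). If `n` is not a positive
exponent, `V_n` is independent of `ζ` and the difference is zero.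

For two points the neighbours coincide, the pole is double and `V_n` is replaced by an Euler
derivative (`headT_starSum_two`). Differentiating the one-point series gives the same trace minus
the monomial `n ζ ^ n` (`pderiv_firstSeries`); these monomials are the coefficients of the rational
correction (`headT_correction`). The correction does not depend on the times, so it disappears from
three points on. -/

noncomputable section

namespace DrinfeldSokolov

/-! ### Exponentials in filtered algebras -/

section FilteredExp

variable {A : Type*} [Ring A] [Algebra ℂ A]

/-- A separated decreasing multiplicative filtration of a `ℂ`-algebra. -/
structure RingFil (A : Type*) [Ring A] [Algebra ℂ A] where
  F : ℤ → Submodule ℂ A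
  anti : Antitone F
  mul_mem : ∀ {m n : ℤ} {a b : A}, a ∈ F m → b ∈ F n → a * b ∈ F (m + n)
  one_mem : (1 : A) ∈ F 0
  sep : ∀ a : A, (∀ n : ℕ, a ∈ F n) → a = 0

namespace RingFil

variable (φ : RingFil A)

theorem mem_of_le {m n : ℤ} (h : m ≤ n) {a : A} (ha : a ∈ φ.F n) : a ∈ φ.F m := φ.anti h ha

theorem mul_mem' {m n k : ℤ} (h : k ≤ m + n) {a b : A} (ha : a ∈ φ.F m) (hb : b ∈ φ.F n) :
    a * b ∈ φ.F k := φ.anti h (φ.mul_mem ha hb)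

theorem pow_mem {M : A} (hM : M ∈ φ.F 1) (n : ℕ) : M ^ n ∈ φ.F n := by
  induction n with
  | zero => simpa using φ.one_mem
  | succ n ih =>
    rw [pow_succ]
    exact φ.mul_mem' (by push_cast; exact le_rfl) ih hM

/-- `E = ∑ Mⁿ / n!` with respect to the filtration `φ`. -/
def IsExp (M E : A) : Prop :=
  ∀ N : ℕ, E - ∑ n ∈ Finset.range N, ((n.factorial : ℂ)⁻¹) • M ^ n ∈ φ.F N

variable {φ}

/-- The truncated sums commute with `C`, so the commutator of `E` with `C` equals that of the
remainder, which lies in every step of the filtration. -/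
theorem IsExp.commute {M E C : A} (h : φ.IsExp M E) {c : ℤ} (hC : C ∈ φ.F c)
    (hMC : Commute M C) : Commute E C := by
  rw [commute_iff_eq, ← sub_eq_zero]
  apply φ.sep
  intro n
  -- `C` may have negative order `c`, so the truncation has to go `-c` steps beyond the target.
  set N : ℕ := (n - c).toNat
  have hN : (n : ℤ) ≤ N + c := by simp only [N]; omega
  have h1 : _ ∈ φ.F n := φ.mul_mem' hN (h N) hC
  have h2 : _ ∈ φ.F n := φ.mul_mem' (by rw [add_comm]; exact hN) hC (h N)
  have h3 : Commute (∑ n ∈ Finset.range N, ((n.factorial : ℂ)⁻¹) • M ^ n) C :=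
    Finset.sum_induction _ (fun x => Commute x C) (fun _ _ => Commute.add_left)
      (Commute.zero_left _) (fun i _ => (hMC.pow_left i).smul_left _)
  have := Submodule.sub_mem _ h1 h2
  rwa [sub_mul, mul_sub, h3.eq, sub_sub_sub_cancel_right] at this

end RingFil

/-- This is the part of degree `k` of `exp L * (exp (R - L) - 1) / (R - L) = (exp R - exp L) / (R -
L)`, in a form that does not divide by `R - L`. -/
theorem sum_antidiagonal_exp_mul {B : Type*} [Ring B] [Algebra ℂ B] {L R : B} (h : Commute L R)
    (k : ℕ) :
    ((k + 1).factorial : ℂ) • ∑ p ∈ Finset.HasAntidiagonal.antidiagonal k,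
      (((p.1.factorial : ℂ)⁻¹) • L ^ p.1) * ((((p.2 + 1).factorial : ℂ)⁻¹) • (R - L) ^ p.2) =
    ∑ p ∈ Finset.HasAntidiagonal.antidiagonal k, L ^ p.1 * R ^ p.2 := by
  have hL : Commute L (R - L) := (h.sub_right (Commute.refl L))
  have hbin : ∀ k : ℕ, ∑ p ∈ Finset.HasAntidiagonal.antidiagonal k,
      (((p.1.factorial : ℂ)⁻¹) • L ^ p.1) * (((p.2.factorial : ℂ)⁻¹) • (R - L) ^ p.2) =
      ((k.factorial : ℂ)⁻¹) • R ^ k := by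
    intro k
    have hR : R ^ k = (L + (R - L)) ^ k := by rw [add_sub_cancel]
    rw [hR, hL.add_pow', Finset.smul_sum]
    refine Finset.sum_congr rfl fun p hp => ?_
    rw [Finset.HasAntidiagonal.mem_antidiagonal] at hp
    rw [smul_mul_smul_comm, ← Nat.cast_smul_eq_nsmul ℂ, smul_smul]
    congr 1
    subst hp
    have h1 : ((p.1 + p.2).factorial : ℂ) ≠ 0 := by exact_mod_cast (Nat.factorial_pos _).ne'
    have h2 : ((p.2.factorial : ℂ)) ≠ 0 := by exact_mod_cast (Nat.factorial_pos _).ne'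
    have h4 : ((p.1.factorial : ℂ)) ≠ 0 := by exact_mod_cast (Nat.factorial_pos _).ne'
    field_simp
    have h3 := Nat.add_choose_mul_factorial_mul_factorial p.1 p.2
    rw [← h3, Nat.choose_symm_add]
    push_cast
    ring
  induction k with
  | zero => simp
  | succ k ih =>
    -- Split `k + 2 = p.1 + (p.2 + 1)`. The first summand lowers `p.1!` and leaves `L` times the sum
    -- for `k`; the second lowers `(p.2 + 1)!` and leaves a binomial expansion of `R ^ (k + 1)`.
    have key : ((k + 1 + 1 : ℕ) : ℂ) • ∑ p ∈ Finset.HasAntidiagonal.antidiagonal (k + 1),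
        (((p.1.factorial : ℂ)⁻¹) • L ^ p.1) * ((((p.2 + 1).factorial : ℂ)⁻¹) • (R - L) ^ p.2)
        = L * ∑ p ∈ Finset.HasAntidiagonal.antidiagonal k,
        (((p.1.factorial : ℂ)⁻¹) • L ^ p.1) * ((((p.2 + 1).factorial : ℂ)⁻¹) • (R - L) ^ p.2)
        + (((k + 1).factorial : ℂ)⁻¹) • R ^ (k + 1) := by
      have h1 : ∀ p ∈ Finset.HasAntidiagonal.antidiagonal (k + 1), ((k + 1 + 1 : ℕ) : ℂ) •
          ((((p.1.factorial : ℂ)⁻¹) • L ^ p.1) * ((((p.2 + 1).factorial : ℂ)⁻¹) • (R - L) ^ p.2))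
          = (((p.1 : ℂ) * ((p.1.factorial : ℂ)⁻¹)) • L ^ p.1)
              * ((((p.2 + 1).factorial : ℂ)⁻¹) • (R - L) ^ p.2)
          + (((p.1.factorial : ℂ)⁻¹) • L ^ p.1) * (((p.2.factorial : ℂ)⁻¹) • (R - L) ^ p.2) := by
        intro p hp
        rw [Finset.HasAntidiagonal.mem_antidiagonal] at hp
        simp only [smul_mul_smul_comm, smul_smul, ← add_smul]
        congr 1
        have h2 : ((p.2.factorial : ℂ)) ≠ 0 := by exact_mod_cast (Nat.factorial_pos _).ne'
        have h3 : ((p.2 : ℂ) + 1) ≠ 0 := Nat.cast_add_one_ne_zero _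
        have h4 : ((p.1.factorial : ℂ)) ≠ 0 := by exact_mod_cast (Nat.factorial_pos _).ne'
        rw [← hp, Nat.factorial_succ]
        push_cast
        field_simp
        ring
      rw [Finset.smul_sum, Finset.sum_congr rfl h1, Finset.sum_add_distrib, hbin,
        Finset.Nat.sum_antidiagonal_succ, Finset.mul_sum]
      congr 1
      simp only [Nat.cast_zero, zero_mul, zero_smul, zero_add]
      refine Finset.sum_congr rfl fun p _ => ?_
      rw [← mul_assoc, mul_smul_comm _ L, ← pow_succ']
      congr 2
      have h3 : ((p.1 : ℂ) + 1) ≠ 0 := Nat.cast_add_one_ne_zero _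
      rw [Nat.factorial_succ]
      push_cast
      field_simp
    have h5 : ((k + 1).factorial : ℂ) ≠ 0 := by exact_mod_cast (Nat.factorial_pos _).ne'
    rw [Nat.factorial_succ (k + 1), Nat.cast_mul, mul_comm, mul_smul, key, smul_add, smul_smul,
      mul_inv_cancel₀ h5, one_smul, ← mul_smul_comm, ih, Finset.Nat.sum_antidiagonal_succ,
      Finset.mul_sum, pow_zero, one_mul, add_comm]
    congr 1
    refine Finset.sum_congr rfl fun p _ => ?_
    rw [← mul_assoc, pow_succ']

theorem derivation_pow_succ (δ : A →ₗ[ℂ] A) (hδ : ∀ a b, δ (a * b) = δ a * b + a * δ b) (M : A)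
    (k : ℕ) : δ (M ^ (k + 1)) = ∑ p ∈ Finset.HasAntidiagonal.antidiagonal k, M ^ p.1 * δ M * M ^ p.2 := by
  induction k with
  | zero => simp
  | succ k ih =>
    rw [pow_succ', hδ, ih, Finset.Nat.sum_antidiagonal_succ, Finset.mul_sum]
    simp only [pow_zero, one_mul, pow_succ', mul_assoc]

/-- The operator `x ↦ x M - M x`. -/
def negAd (M : A) : Module.End ℂ A := LinearMap.mulRight ℂ M - LinearMap.mulLeft ℂ M

theorem negAd_apply (M x : A) : negAd M x = x * M - M * x := rfl

theorem RingFil.negAd_pow_mem {φ : RingFil A} {M : A} (hM : M ∈ φ.F 1) {c : ℤ} {x : A}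
    (hx : x ∈ φ.F c) (n : ℕ) : (negAd M ^ n) x ∈ φ.F (n + c) := by
  induction n with
  | zero => simpa using hx
  | succ n ih =>
    rw [pow_succ', Module.End.mul_apply, negAd_apply]
    exact Submodule.sub_mem _ (φ.mul_mem' (by push_cast; linarith) ih hM)
      (φ.mul_mem' (by push_cast; linarith) hM ih)

/-- The derivative of an exponential. -/
theorem RingFil.IsExp.derivation {φ : RingFil A} {M E : A} (h : φ.IsExp M E) (hM : M ∈ φ.F 1)
    (δ : A →ₗ[ℂ] A) (hδ : ∀ a b, δ (a * b) = δ a * b + a * δ b)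
    (hδF : ∀ {n : ℤ} {a : A}, a ∈ φ.F n → δ a ∈ φ.F n) (N : ℕ) :
    δ E - E * ∑ n ∈ Finset.range N, (((n + 1).factorial : ℂ)⁻¹) • (negAd M ^ n) (δ M) ∈ φ.F N := by
  have h1 : δ E - ∑ k ∈ Finset.range N, (((k + 1).factorial : ℂ)⁻¹) • δ (M ^ (k + 1)) ∈ φ.F N := by
    have := φ.mem_of_le (by push_cast; linarith : (N : ℤ) ≤ (N + 1 : ℕ)) (hδF (h (N + 1)))
    rw [map_sub, map_sum, Finset.sum_range_succ'] at this
    have h0 : δ 1 = 0 := by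
      have := hδ 1 1
      simpa using this
    simpa [h0] using this
  have h2 : ∀ k : ℕ, (((k + 1).factorial : ℂ)⁻¹) • δ (M ^ (k + 1)) =
      ∑ n ∈ Finset.range (k + 1), ((((k - n).factorial : ℂ)⁻¹) • M ^ (k - n)) *
        ((((n + 1).factorial : ℂ)⁻¹) • (negAd M ^ n) (δ M)) := by
    intro k
    -- The identity for commuting `L` and `R` is applied to left and right multiplication by `M`,
    -- whose difference `R - L` is `negAd M`.
    have hc : Commute (LinearMap.mulLeft ℂ M) (LinearMap.mulRight ℂ M) :=
      LinearMap.commute_mulLeft_right M M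
    have h3 := congrArg (fun f : Module.End ℂ A => f (δ M)) (sum_antidiagonal_exp_mul hc k)
    have h5 : ((k + 1).factorial : ℂ) ≠ 0 := by exact_mod_cast (Nat.factorial_pos _).ne'
    rw [derivation_pow_succ δ hδ, inv_smul_eq_iff₀ h5]
    have h6 : ∑ p ∈ Finset.HasAntidiagonal.antidiagonal k, M ^ p.1 * δ M * M ^ p.2 =
        (∑ p ∈ Finset.HasAntidiagonal.antidiagonal k, (LinearMap.mulLeft ℂ M) ^ p.1 *
          (LinearMap.mulRight ℂ M) ^ p.2 : Module.End ℂ A) (δ M) := by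
      rw [LinearMap.sum_apply]
      refine Finset.sum_congr rfl fun p _ => ?_
      rw [Module.End.mul_apply, LinearMap.pow_mulLeft, LinearMap.pow_mulRight]
      simp [mul_assoc]
    rw [h6, ← h3, LinearMap.smul_apply, LinearMap.sum_apply, ← Finset.Nat.sum_antidiagonal_swap,
      Finset.Nat.sum_antidiagonal_eq_sum_range_succ_mk]
    congr 1
    refine Finset.sum_congr rfl fun i _ => ?_
    rw [Module.End.mul_apply, LinearMap.smul_apply, LinearMap.pow_mulLeft, LinearMap.smul_apply]
    simp [negAd, smul_comm ((k - i).factorial : ℂ)⁻¹]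
  have h4 : E * ∑ n ∈ Finset.range N, (((n + 1).factorial : ℂ)⁻¹) • (negAd M ^ n) (δ M) -
      ∑ k ∈ Finset.range N, (((k + 1).factorial : ℂ)⁻¹) • δ (M ^ (k + 1)) ∈ φ.F N := by
    -- Exchanging the sums attaches to the `n`-th bracket a truncated exponential of length `N - n`.
    -- Its remainder has order `N - n` and the bracket supplies the missing `n`.
    have h7 := Finset.sum_range_diag_flip N (fun n i => (((i.factorial : ℂ)⁻¹) • M ^ i) *
        ((((n + 1).factorial : ℂ)⁻¹) • (negAd M ^ n) (δ M)))
    rw [Finset.sum_congr rfl fun k _ => h2 k, h7, Finset.mul_sum, ← Finset.sum_sub_distrib]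
    refine Submodule.sum_mem _ fun n hn => ?_
    rw [Finset.mem_range] at hn
    rw [← Finset.sum_mul, ← sub_mul]
    exact φ.mul_mem' (by push_cast [hn.le]; linarith) (h (N - n))
      (Submodule.smul_mem _ _ (RingFil.negAd_pow_mem hM (hδF hM) n))
  have := Submodule.sub_mem _ h1 h4
  rwa [sub_sub_sub_cancel_right] at this

/-- The derivative of an exponential, under a trace and against an element that commutes with the
exponent. -/
theorem RingFil.IsExp.trace_derivation {φ : RingFil A} {M E C : A} (h : φ.IsExp M E)
    (hM : M ∈ φ.F 1) (δ : A →ₗ[ℂ] A) (hδ : ∀ a b, δ (a * b) = δ a * b + a * δ b)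
    (hδF : ∀ {n : ℤ} {a : A}, a ∈ φ.F n → δ a ∈ φ.F n)
    {B : Type*} [AddCommGroup B] (T : A →+ B) (hT : ∀ a b, T (a * b) = T (b * a))
    {c : ℤ} (hC : C ∈ φ.F c) (hMC : Commute M C) (N : ℕ) :
    ∃ r ∈ φ.F (N + c), T (δ E * C) = T (E * δ M * C) + T r := by
  have hEM : Commute E M := h.commute hM (Commute.refl M)
  -- `E` and `C` both commute with `M`, so brackets with `M` have zero trace here and only the first
  -- term of the derivative series survives.
  have hz : ∀ x, T (E * negAd M x * C) = 0 := by
    intro x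
    rw [negAd_apply, mul_sub, sub_mul, map_sub, sub_eq_zero]
    calc T (E * (x * M) * C) = T (E * x * C * M) := by simp only [mul_assoc, hMC.eq]
      _ = T (M * (E * x * C)) := hT _ _
      _ = T (E * (M * x) * C) := by simp only [← mul_assoc, hEM.eq]
  have h1 := h.derivation hM δ hδ hδF (N + 1)
  refine ⟨_, φ.mul_mem (φ.mem_of_le (by push_cast; linarith) h1) hC, ?_⟩
  rw [Finset.sum_range_succ', mul_add, sub_mul, map_sub, add_mul, map_add]
  have h2 : T ((E * ∑ k ∈ Finset.range N,
      (((k + 1 + 1).factorial : ℂ)⁻¹) • (negAd M ^ (k + 1)) (δ M)) * C) = 0 := by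
    rw [Finset.mul_sum, Finset.sum_mul, map_sum]
    refine Finset.sum_eq_zero fun k _ => ?_
    rw [pow_succ', Module.End.mul_apply, ← map_smul, hz]
  rw [h2]
  simp

end FilteredExp

end DrinfeldSokolov

namespace DrinfeldSokolov

/-! ### One loop variable -/

theorem loop_coeff_mul (f g : Loop) (k : ℤ) :
    (f * g).coeff k = ∑ p ∈ Finset.antidiagonal f.isPWO_support g.isPWO_support k,
      f.coeff p.1 * g.coeff p.2 := HahnSeries.coeff_mul

theorem mono_coeff (k j : ℤ) (c : ℂ) : (mono k c).coeff j = if j = -k then c else 0 := by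
  rw [mono, HahnSeries.coeff_single]
  congr

theorem mono_mul_mono (j k : ℤ) (c d : ℂ) : mono j c * mono k d = mono (j + k) (c * d) := by
  simp [mono, HahnSeries.single_mul_single, add_comm]

theorem mono_zero_one : mono 0 1 = 1 := by simp [mono]

theorem mono_zero_right (k : ℤ) : mono k 0 = 0 := by simp [mono]

theorem mono_add (k : ℤ) (c d : ℂ) : mono k (c + d) = mono k c + mono k d := by simp [mono]

theorem loop_smul_coeff (c : ℂ) (f : Loop) (k : ℤ) : (c • f).coeff k = c * f.coeff k := rfl

/-- Reconciles two actions of `ℂ` on Laurent series: the one induced from the power series algebra,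
which scalars on `X.TLoop` use, and the coefficientwise one. -/
theorem algebra_smul_loop (c : ℂ) (f : Loop) :
    (HahnSeries.powerSeriesAlgebra (Γ := ℤ) (R := ℂ) (S := ℂ)).toSMul.smul c f = c • f := by
  have h1 : (HahnSeries.powerSeriesAlgebra (Γ := ℤ) (R := ℂ) (S := ℂ)).toSMul.smul c f =
      HahnSeries.C c * f := by
    rw [← HahnSeries.ofPowerSeries_C]
    exact Algebra.smul_def _ _
  rw [h1, HahnSeries.C_mul_eq_smul]

theorem smul_mono (k : ℤ) (c d : ℂ) : c • mono k d = mono k (c * d) := by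
  ext j
  rw [loop_smul_coeff, mono_coeff, mono_coeff]
  split_ifs <;> simp

theorem mono_pow (k : ℤ) (c : ℂ) (n : ℕ) : mono k c ^ n = mono (n * k) (c ^ n) := by
  simp [mono, HahnSeries.single_pow]

theorem mono_mul_coeff (j k : ℤ) (c : ℂ) (f : Loop) :
    (mono j c * f).coeff k = c * f.coeff (k + j) := by
  have := HahnSeries.coeff_single_mul_add (r := c) (x := f) (a := k + j) (b := -j)
  simpa [mono] using this

theorem mono_injective (k : ℤ) : Function.Injective (mono k) := HahnSeries.single_injective _

@[simp] theorem euler_coeff (f : Loop) (k : ℤ) : (euler f).coeff k = -(k : ℂ) * f.coeff k := rfl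

@[simp] theorem negPart_coeff (f : Loop) (k : ℤ) :
    (negPart f).coeff k = if 0 < k then f.coeff k else 0 := rfl

theorem euler_mul (f g : Loop) : euler (f * g) = euler f * g + f * euler g := by
  ext k
  have h1 : (euler f).support ⊆ f.support := fun k hk h => hk (by simp [h])
  have h2 : (euler g).support ⊆ g.support := fun k hk h => hk (by simp [h])
  rw [euler_coeff, HahnSeries.coeff_add,
    HahnSeries.coeff_mul_left' f.isPWO_support h1, HahnSeries.coeff_mul_right' g.isPWO_support h2,
    HahnSeries.coeff_mul, Finset.mul_sum, ← Finset.sum_add_distrib]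
  refine Finset.sum_congr rfl fun p hp => ?_
  have h3 : p.1 + p.2 = k := (Finset.mem_antidiagonal.mp hp).2.2
  rw [euler_coeff, euler_coeff, ← h3]
  push_cast
  ring

theorem euler_add (f g : Loop) : euler (f + g) = euler f + euler g := by
  ext k; simp [mul_add]

theorem euler_mono (k : ℤ) (c : ℂ) : euler (mono k c) = mono k (k * c) := by
  ext j
  rw [euler_coeff, mono_coeff, mono_coeff]
  split_ifs with h <;> simp [h]

theorem substPow_coeff_mul (h : ℕ) (hh : 0 < h) (f : Loop) (k : ℤ) :
    (substPow h hh f).coeff (h * k) = f.coeff k :=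
  HahnSeries.embDomain_coeff (f := (⟨⟨_, _⟩, _⟩ : ℤ ↪o ℤ)) (a := k)

theorem substPow_coeff_of_not_dvd (h : ℕ) (hh : 0 < h) (f : Loop) {k : ℤ} (hk : ¬ (h : ℤ) ∣ k) :
    (substPow h hh f).coeff k = 0 := by
  apply HahnSeries.embDomain_of_notMem_range (f := (⟨⟨_, _⟩, _⟩ : ℤ ↪o ℤ))
  rintro ⟨j, rfl⟩
  exact hk ⟨j, rfl⟩

theorem substPow_injective (h : ℕ) (hh : 0 < h) : Function.Injective (substPow h hh) :=
  (substPow h hh).injective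

theorem loop_ext_mod {h : ℕ} (hh : 0 < h) {f g : Loop}
    (h1 : ∀ k : ℤ, f.coeff (h * k) = g.coeff (h * k))
    (h2 : ∀ k : ℤ, ¬ (h : ℤ) ∣ k → f.coeff k = g.coeff k) : f = g := by
  ext k
  by_cases hk : (h : ℤ) ∣ k
  · obtain ⟨j, rfl⟩ := hk
    exact h1 j
  · exact h2 k hk

theorem euler_substPow (h : ℕ) (hh : 0 < h) (f : Loop) :
    euler (substPow h hh f) = (h : ℂ) • substPow h hh (euler f) := by
  apply loop_ext_mod hh
  · intro k
    rw [HahnSeries.coeff_smul, euler_coeff, substPow_coeff_mul, substPow_coeff_mul, euler_coeff]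
    push_cast
    simp only [smul_eq_mul]
    ring
  · intro k hk
    rw [HahnSeries.coeff_smul, euler_coeff, substPow_coeff_of_not_dvd _ _ _ hk,
      substPow_coeff_of_not_dvd _ _ _ hk]
    simp

theorem substPow_mono (h : ℕ) (hh : 0 < h) (k : ℤ) (c : ℂ) :
    substPow h hh (mono k c) = mono (h * k) c := by
  have h0 : (h : ℤ) ≠ 0 := by exact_mod_cast hh.ne'
  apply loop_ext_mod hh
  · intro j
    simp only [substPow_coeff_mul, mono_coeff, ← mul_neg, mul_right_inj' h0]
  · intro j hj
    rw [substPow_coeff_of_not_dvd _ _ _ hj, mono_coeff, if_neg]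
    rintro rfl
    exact hj ⟨-k, by ring⟩

theorem substPow_smul (h : ℕ) (hh : 0 < h) (c : ℂ) (f : Loop) :
    substPow h hh (c • f) = c • substPow h hh f := by
  have : ∀ f : Loop, c • f = mono 0 c * f := fun f => by
    rw [mono]; simp
  rw [this, this, map_mul, substPow_mono, mul_zero]

/-! ### Power series in the times -/

theorem pderiv_map {σ A B : Type*} [CommRing A] [CommRing B] (φ : A →+* B)
    (f : MvPowerSeries σ A) (i : σ) :
    MvPowerSeries.pderiv B i (MvPowerSeries.map φ f) =
      MvPowerSeries.map φ (MvPowerSeries.pderiv A i f) := by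
  ext d
  simp [MvPowerSeries.coeff_pderiv]

/-- Additive maps that satisfy the Leibniz rule. -/
structure IsDer {R : Type*} [CommRing R] (D : R → R) : Prop where
  add : ∀ a b, D (a + b) = D a + D b
  mul : ∀ a b, D (a * b) = D a * b + a * D b

namespace IsDer

section

variable {R : Type*} [CommRing R] {D : R → R} (hD : IsDer D)

include hD

theorem zero : D 0 = 0 := by simpa using hD.add 0 0

theorem one : D 1 = 0 := by simpa using hD.mul 1 1

theorem neg (a : R) : D (-a) = -D a := by
  rw [eq_neg_iff_add_eq_zero, ← hD.add, neg_add_cancel, hD.zero]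

theorem sub (a b : R) : D (a - b) = D a - D b := by
  rw [sub_eq_add_neg, hD.add, hD.neg, sub_eq_add_neg]

theorem sum {ι : Type*} (s : Finset ι) (f : ι → R) : D (∑ i ∈ s, f i) = ∑ i ∈ s, D (f i) :=
  map_sum (AddMonoidHom.mk' D hD.add) f s

variable {n : Type*} [Fintype n]

theorem matrix_add (A B : Matrix n n R) : (A + B).map D = A.map D + B.map D := by
  ext i j; simp [hD.add]

theorem matrix_mul (A B : Matrix n n R) : (A * B).map D = A.map D * B + A * B.map D := by
  ext i j
  simp only [Matrix.map_apply, Matrix.mul_apply, Matrix.add_apply, hD.sum,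
    ← Finset.sum_add_distrib, hD.mul]

theorem trace (A : Matrix n n R) : (A.map D).trace = D A.trace := by
  simp [Matrix.trace, hD.sum]

variable [DecidableEq n]

theorem matrix_one : (1 : Matrix n n R).map D = 0 := by
  ext i j
  by_cases h : i = j
  · subst h; simp [hD.one]
  · simp [h, hD.zero]

theorem matrix_inv {A : Matrix n n R} (hA : IsUnit A.det) :
    A⁻¹.map D = -(A⁻¹ * A.map D * A⁻¹) := by
  have h := hD.matrix_mul A⁻¹ A
  rw [Matrix.nonsing_inv_mul _ hA, hD.matrix_one] at h
  have h2 := congrArg (· * A⁻¹) h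
  simp only [zero_mul, add_mul, mul_assoc, Matrix.mul_nonsing_inv _ hA, mul_one] at h2
  rw [mul_assoc]
  exact eq_neg_of_add_eq_zero_left h2.symm

end

end IsDer

theorem isDer_pderiv {σ A : Type*} [CommRing A] (i : σ) : IsDer (MvPowerSeries.pderiv A i) where
  add a b := map_add _ a b
  mul a b := by rw [Derivation.leibniz, smul_eq_mul, smul_eq_mul, add_comm, mul_comm b]

theorem isDer_euler : IsDer euler := ⟨euler_add, euler_mul⟩

section MatrixMap

variable {R : Type*} [CommRing R] {n : Type*} [Fintype n] [DecidableEq n]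

theorem map_inv_of_isUnit {R' : Type*} [CommRing R'] (φ : R →+* R') {A : Matrix n n R}
    (hA : IsUnit A.det) : A⁻¹.map φ = (A.map φ)⁻¹ := by
  symm
  apply Matrix.inv_eq_left_inv
  rw [← Matrix.map_mul, Matrix.nonsing_inv_mul _ hA]
  simp

theorem isUnit_det_map {R' : Type*} [CommRing R'] (φ : R →+* R') {A : Matrix n n R}
    (hA : IsUnit A.det) : IsUnit (A.map φ).det := by
  have := hA.map φ
  rwa [RingHom.map_det] at this

end MatrixMap

namespace AffType

variable (X : AffType)

@[simp] theorem coeff_eulerT (f : X.TLoop) (d : X.Idx →₀ ℕ) :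
    MvPowerSeries.coeff d (X.eulerT f) = euler (MvPowerSeries.coeff d f) := rfl

@[simp] theorem coeff_negT (f : X.TLoop) (d : X.Idx →₀ ℕ) :
    MvPowerSeries.coeff d (X.negT f) = negPart (MvPowerSeries.coeff d f) := rfl

theorem isDer_eulerT : IsDer X.eulerT where
  add f g := by
    ext1 d
    simp [euler_add]
  mul f g := by
    classical
    ext1 d
    simp only [map_add, coeff_eulerT, MvPowerSeries.coeff_mul, isDer_euler.sum, euler_mul,
      Finset.sum_add_distrib]

theorem eulerT_pderiv (f : X.TLoop) (i : X.Idx) :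
    X.eulerT (MvPowerSeries.pderiv Loop i f) = MvPowerSeries.pderiv Loop i (X.eulerT f) := by
  ext1 d
  have h : euler ((d i : Loop) + 1) = 0 := by
    rw [euler_add, isDer_euler.one, add_zero]
    induction d i with
    | zero => simp [isDer_euler.zero]
    | succ n ih => rw [Nat.cast_succ, euler_add, ih, isDer_euler.one, add_zero]
  rw [coeff_eulerT, MvPowerSeries.coeff_pderiv, MvPowerSeries.coeff_pderiv, coeff_eulerT,
    euler_mul, h, mul_zero, add_zero]

/-- The substitution `z = ζ ^ h` in series in the times. -/
def substT : X.TLoop →+* X.TLoop := MvPowerSeries.map (substPow X.cox X.cox_pos)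

@[simp] theorem coeff_substT (f : X.TLoop) (d : X.Idx →₀ ℕ) :
    MvPowerSeries.coeff d (X.substT f) = substPow X.cox X.cox_pos (MvPowerSeries.coeff d f) := by
  rw [substT, MvPowerSeries.coeff_map]

theorem coeff_smul_TLoop (c : ℂ) (f : X.TLoop) (d : X.Idx →₀ ℕ) :
    MvPowerSeries.coeff d (c • f) = c • MvPowerSeries.coeff d f :=
  algebra_smul_loop c _

theorem smul_TLoop (c : ℂ) (f : X.TLoop) : c • f = MvPowerSeries.C (mono 0 c) * f := by
  ext d k
  rw [coeff_smul_TLoop, MvPowerSeries.coeff_C_mul, mono_mul_coeff, loop_smul_coeff, add_zero]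

theorem eulerT_smul (c : ℂ) (f : X.TLoop) : X.eulerT (c • f) = c • X.eulerT f := by
  ext d k
  simp only [coeff_eulerT, coeff_smul_TLoop, euler_coeff, loop_smul_coeff]
  ring

/-- The chain rule for `z = ζ ^ h`; this factor is the one that `1 / h` in part (i) cancels. -/
theorem eulerT_substT (f : X.TLoop) : X.eulerT (X.substT f) = (X.cox : ℂ) • X.substT (X.eulerT f) := by
  ext1 d
  rw [coeff_smul_TLoop, coeff_eulerT, coeff_substT, coeff_substT, coeff_eulerT, euler_substPow]

theorem substT_smul (c : ℂ) (f : X.TLoop) : X.substT (c • f) = c • X.substT f := by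
  ext1 d
  rw [coeff_smul_TLoop, coeff_substT, coeff_substT, coeff_smul_TLoop, substPow_smul]

theorem pderiv_substT (i : X.Idx) (f : X.TLoop) :
    MvPowerSeries.pderiv Loop i (X.substT f) = X.substT (MvPowerSeries.pderiv Loop i f) :=
  pderiv_map _ _ _

end AffType

end DrinfeldSokolov

namespace DrinfeldSokolov

/-! ### The first one of several loop variables -/

section Head

variable {m : ℕ}

/-- The exponent vector `(n, v)`. -/
def consExp (n : ℤ) (v : Lex (Fin m → ℤ)) : Lex (Fin (m + 1) → ℤ) :=
  toLex (Fin.cons n (ofLex v))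

theorem exists_consExp (w : Lex (Fin (m + 1) → ℤ)) : ∃ n v, consExp n v = w :=
  ⟨ofLex w 0, toLex (Fin.tail (ofLex w)), by
    rw [consExp, ofLex_toLex, Fin.cons_self_tail]; rfl⟩

theorem consExp_inj {n n' : ℤ} {v v' : Lex (Fin m → ℤ)} :
    consExp n v = consExp n' v' ↔ n = n' ∧ v = v' := by
  constructor
  · intro h
    have h' : (Fin.cons n (ofLex v) : Fin (m + 1) → ℤ) = Fin.cons n' (ofLex v') :=
      congrArg ofLex h
    rw [Fin.cons_inj] at h'
    exact ⟨h'.1, ofLex.injective h'.2⟩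
  · rintro ⟨rfl, rfl⟩
    rfl

theorem consExp_add (n n' : ℤ) (v v' : Lex (Fin m → ℤ)) :
    consExp n v + consExp n' v' = consExp (n + n') (v + v') := by
  apply ofLex.injective
  funext i
  refine Fin.cases ?_ (fun i => ?_) i <;> rfl

theorem consExp_strictMono (n : ℤ) : StrictMono (consExp (m := m) n) := by
  rintro v w ⟨i, hi, hlt⟩
  refine ⟨i.succ, fun j hj => ?_, hlt⟩
  refine Fin.cases (fun _ => rfl) (fun j hj => hi j (Fin.succ_lt_succ_iff.mp hj)) j hj

theorem consExp_lt {n n' : ℤ} (h : n < n') (v v' : Lex (Fin m → ℤ)) :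
    consExp n v < consExp n' v' :=
  ⟨0, fun j hj => absurd hj (Fin.not_lt_zero j), h⟩

/-- The exponent vector `(0, v)`. -/
def tailExp : Lex (Fin m → ℤ) →+ Lex (Fin (m + 1) → ℤ) where
  toFun := consExp 0
  map_zero' := by
    apply ofLex.injective
    funext i
    refine Fin.cases ?_ (fun i => ?_) i <;> rfl
  map_add' v w := by rw [consExp_add, add_zero]

/-- Series in all variables but the first one. -/
def tailEmb : MultiLoop m →+* MultiLoop (m + 1) :=
  HahnSeries.embDomainRingHom tailExp (consExp_strictMono 0).injective
    (fun _ _ => (consExp_strictMono 0).le_iff_le)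

theorem tailEmb_coeff (f : MultiLoop m) (v : Lex (Fin m → ℤ)) :
    (tailEmb f).coeff (consExp 0 v) = f.coeff v :=
  HahnSeries.embDomain_coeff (f := (⟨⟨_, _⟩, _⟩ : Lex (Fin m → ℤ) ↪o Lex (Fin (m + 1) → ℤ)))
    (a := v)

theorem tailEmb_coeff_of_ne (f : MultiLoop m) {n : ℤ} (hn : n ≠ 0) (v : Lex (Fin m → ℤ)) :
    (tailEmb f).coeff (consExp n v) = 0 := by
  apply HahnSeries.embDomain_of_notMem_range
    (f := (⟨⟨_, _⟩, _⟩ : Lex (Fin m → ℤ) ↪o Lex (Fin (m + 1) → ℤ)))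
  rintro ⟨w, hw⟩
  exact hn (consExp_inj.mp hw).1.symm

/-- The coefficient of `ζ₁ ^ (-n)`, where `ζ₁` is the first variable. -/
def headCoeff (n : ℤ) : MultiLoop (m + 1) →+ MultiLoop m where
  toFun f :=
    { coeff := fun v => f.coeff (consExp n v)
      isPWO_support' := by
        intro s
        obtain ⟨i, j, hij, h⟩ := f.isPWO_support (fun k => ⟨consExp n (s k).1, (s k).2⟩)
        exact ⟨i, j, hij, (consExp_strictMono n).le_iff_le.mp h⟩ }
  map_zero' := rfl
  map_add' _ _ := rfl

@[simp] theorem headCoeff_coeff (n : ℤ) (f : MultiLoop (m + 1)) (v : Lex (Fin m → ℤ)) :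
    (headCoeff n f).coeff v = f.coeff (consExp n v) := rfl

theorem headCoeff_ext {f g : MultiLoop (m + 1)} (h : ∀ n, headCoeff n f = headCoeff n g) :
    f = g := by
  ext w
  obtain ⟨n, v, rfl⟩ := exists_consExp w
  rw [← headCoeff_coeff, h, headCoeff_coeff]

/-- The left factor has only the first exponent `0`, so series in the remaining variables act as
scalars on the coefficients with respect to `ζ₁`. -/
theorem headCoeff_tailEmb_mul (n : ℤ) (f : MultiLoop m) (g : MultiLoop (m + 1)) :
    headCoeff n (tailEmb f * g) = f * headCoeff n g := by
  ext v
  rw [headCoeff_coeff, HahnSeries.coeff_mul, HahnSeries.coeff_mul]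
  symm
  refine Finset.sum_bij (fun p _ => (consExp 0 p.1, consExp n p.2)) ?_ ?_ ?_ ?_
  · intro p hp
    rw [Finset.mem_antidiagonal] at hp ⊢
    refine ⟨?_, hp.2.1, ?_⟩
    · rw [HahnSeries.mem_support, tailEmb_coeff]
      exact hp.1
    · rw [consExp_add, zero_add, hp.2.2]
  · intro p _ q _ h
    rw [Prod.mk.injEq, consExp_inj, consExp_inj] at h
    exact Prod.ext h.1.2 h.2.2
  · rintro ⟨a, b⟩ hp
    rw [Finset.mem_antidiagonal] at hp
    obtain ⟨i, v', rfl⟩ := exists_consExp a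
    obtain ⟨j, w', rfl⟩ := exists_consExp b
    have hi : i = 0 := by
      by_contra hi
      exact hp.1 (tailEmb_coeff_of_ne f hi v')
    subst hi
    have h := hp.2.2
    simp only [consExp_add, consExp_inj, zero_add] at h
    obtain ⟨rfl, h⟩ := h
    refine ⟨(v', w'), ?_, rfl⟩
    rw [Finset.mem_antidiagonal]
    refine ⟨?_, hp.2.1, h⟩
    have := hp.1
    rwa [HahnSeries.mem_support, tailEmb_coeff] at this
  · intro p _
    rw [tailEmb_coeff]
    rfl

/-- The first exponent decides the lexicographic order, so the order of `f` bounds it from below.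
This fixes the direction of expansion: `1 / (x - ζ₁ ^ h)`, with `x` free of `ζ₁`, is a series in
`ζ₁⁻¹`. -/
theorem exists_headCoeff_eq_zero (f : MultiLoop (m + 1)) :
    ∃ N : ℤ, ∀ n < N, headCoeff n f = 0 := by
  obtain ⟨N, v, h⟩ := exists_consExp f.order
  refine ⟨N, fun n hn => ?_⟩
  ext w
  have h1 : consExp n w < f.order := by
    rw [← h]
    exact consExp_lt hn w v
  exact HahnSeries.coeff_eq_zero_of_lt_order (x := f) h1

theorem inVar_coeff_placeExp (i : Fin m) (f : Loop) (k : ℤ) :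
    (inVar i f).coeff (placeExp i k) = f.coeff k :=
  HahnSeries.embDomain_coeff (f := (⟨⟨_, _⟩, _⟩ : ℤ ↪o Lex (Fin m → ℤ))) (a := k)

theorem inVar_coeff_of_notMem (i : Fin m) (f : Loop) {v : Lex (Fin m → ℤ)}
    (hv : ∀ k, placeExp i k ≠ v) : (inVar i f).coeff v = 0 := by
  apply HahnSeries.embDomain_of_notMem_range (f := (⟨⟨_, _⟩, _⟩ : ℤ ↪o Lex (Fin m → ℤ)))
  rintro ⟨k, hk⟩
  exact hv k hk

theorem inVar_mono (i : Fin m) (k : ℤ) (c : ℂ) :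
    inVar i (mono k c) = HahnSeries.single (placeExp i (-k)) c :=
  HahnSeries.embDomain_single (f := (⟨⟨_, _⟩, _⟩ : ℤ ↪o Lex (Fin m → ℤ)))

theorem zeta_pow (i : Fin m) (k : ℕ) : zeta i ^ k = inVar i (mono k 1) := by
  rw [zeta, ← map_pow, mono_pow, mul_one, one_pow]

theorem placeExp_zero_eq (k : ℤ) : placeExp (0 : Fin (m + 1)) k = consExp k 0 := by
  apply ofLex.injective
  funext i
  refine Fin.cases ?_ (fun i => ?_) i <;> rfl

theorem placeExp_succ_eq (i : Fin m) (k : ℤ) : placeExp i.succ k = consExp 0 (placeExp i k) := by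
  apply ofLex.injective
  funext j
  refine Fin.cases ?_ (fun j => ?_) j
  · exact Pi.single_eq_of_ne (M := fun _ => ℤ) (Fin.succ_ne_zero i).symm k
  · change (Pi.single i.succ k : Fin (m + 1) → ℤ) j.succ = (Pi.single i k : Fin m → ℤ) j
    by_cases h : j = i
    · subst h; simp
    · rw [Pi.single_eq_of_ne h, Pi.single_eq_of_ne (fun h' => h (Fin.succ_injective _ h'))]

theorem inVar_succ (i : Fin m) (f : Loop) : inVar i.succ f = tailEmb (inVar i f) := by
  ext w
  obtain ⟨n, v, rfl⟩ := exists_consExp w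
  by_cases hn : n = 0
  · subst hn
    rw [tailEmb_coeff]
    by_cases hv : ∃ k, placeExp i k = v
    · obtain ⟨k, rfl⟩ := hv
      rw [← placeExp_succ_eq, inVar_coeff_placeExp, inVar_coeff_placeExp]
    · push Not at hv
      rw [inVar_coeff_of_notMem _ _ hv, inVar_coeff_of_notMem]
      intro k hk
      rw [placeExp_succ_eq, consExp_inj] at hk
      exact hv k hk.2
  · rw [tailEmb_coeff_of_ne _ hn, inVar_coeff_of_notMem]
    intro k hk
    rw [placeExp_succ_eq, consExp_inj] at hk
    exact hn hk.1.symm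

theorem headCoeff_inVar_zero (n : ℤ) (f : Loop) :
    headCoeff n (inVar (0 : Fin (m + 1)) f) = HahnSeries.C (f.coeff n) := by
  ext v
  rw [headCoeff_coeff, HahnSeries.C_apply]
  by_cases hv : v = 0
  · subst hv
    rw [← placeExp_zero_eq, inVar_coeff_placeExp, HahnSeries.coeff_single_same]
  · rw [HahnSeries.coeff_single_of_ne hv, inVar_coeff_of_notMem]
    intro k hk
    rw [placeExp_zero_eq, consExp_inj] at hk
    exact hv hk.2.symm

theorem headCoeff_zeta_pow_mul (n : ℤ) (k : ℕ) (f : MultiLoop (m + 1)) :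
    headCoeff n (zeta 0 ^ k * f) = headCoeff (n + k) f := by
  ext v
  rw [zeta_pow, inVar_mono, headCoeff_coeff, headCoeff_coeff, placeExp_zero_eq]
  have : consExp n v = consExp (n + k) v + consExp (-k) 0 := by
    rw [consExp_add, add_zero]
    congr 1
    ring
  rw [this, HahnSeries.coeff_single_mul_add, one_mul]

theorem placeExp_injective_left {i j : Fin m} {a b : ℤ} (ha : a ≠ 0)
    (h : placeExp i a = placeExp j b) : i = j := by
  by_contra hij
  have := congrFun (congrArg ofLex h) i
  change (Pi.single i a : Fin m → ℤ) i = (Pi.single j b : Fin m → ℤ) i at this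
  rw [Pi.single_eq_same, Pi.single_eq_of_ne hij] at this
  exact ha this

theorem zeta_pow_injective {h : ℕ} (hh : 0 < h) :
    Function.Injective (fun i : Fin m => zeta i ^ h) := by
  intro i j hij
  simp only [zeta_pow, inVar_mono] at hij
  have h1 := congrArg (fun f => f.coeff (placeExp i (-h))) hij
  simp only [HahnSeries.coeff_single_same] at h1
  by_contra hne
  rw [HahnSeries.coeff_single_of_ne] at h1
  · exact one_ne_zero h1
  · intro h2
    exact hne (placeExp_injective_left (by simpa using hh.ne') h2)

end Head

namespace AffType

variable (X : AffType) {m : ℕ}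

/-- Series in all loop variables but the first one. -/
def tailT : X.TMulti m →+* X.TMulti (m + 1) := MvPowerSeries.map tailEmb

/-- The coefficient of `ζ₁ ^ (-n)`, where `ζ₁` is the first loop variable. -/
def headT (n : ℤ) : X.TMulti (m + 1) →+ X.TMulti m where
  toFun f := fun d => headCoeff n (MvPowerSeries.coeff d f)
  map_zero' := by
    funext d
    rw [map_zero, map_zero]; rfl
  map_add' f g := by
    funext d
    rw [map_add, map_add]; rfl

@[simp] theorem coeff_headT (n : ℤ) (f : X.TMulti (m + 1)) (d : X.Idx →₀ ℕ) :
    MvPowerSeries.coeff d (X.headT n f) = headCoeff n (MvPowerSeries.coeff d f) := rfl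

@[simp] theorem coeff_tailT (f : X.TMulti m) (d : X.Idx →₀ ℕ) :
    MvPowerSeries.coeff d (X.tailT f) = tailEmb (MvPowerSeries.coeff d f) := by
  rw [tailT, MvPowerSeries.coeff_map]

@[simp] theorem coeff_atVar (i : Fin m) (f : X.TLoop) (d : X.Idx →₀ ℕ) :
    MvPowerSeries.coeff d (X.atVar i f) = inVar i (MvPowerSeries.coeff d f) := by
  rw [atVar, MvPowerSeries.coeff_map]

theorem headT_ext {f g : X.TMulti (m + 1)} (h : ∀ n, X.headT n f = X.headT n g) : f = g := by
  ext1 d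
  apply headCoeff_ext
  intro n
  rw [← coeff_headT, h, coeff_headT]

theorem headT_tailT_mul (n : ℤ) (f : X.TMulti m) (g : X.TMulti (m + 1)) :
    X.headT n (X.tailT f * g) = f * X.headT n g := by
  classical
  ext1 d
  rw [coeff_headT, MvPowerSeries.coeff_mul, MvPowerSeries.coeff_mul, map_sum]
  refine Finset.sum_congr rfl fun p _ => ?_
  rw [coeff_tailT, headCoeff_tailEmb_mul, coeff_headT]

theorem atVar_succ (i : Fin m) (f : X.TLoop) : X.atVar i.succ f = X.tailT (X.atVar i f) := by
  ext1 d
  rw [coeff_atVar, coeff_tailT, coeff_atVar, inVar_succ]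

/-- A series that does not depend on the loop variable, seen as a series in `m` of them. -/
def constMulti (m : ℕ) : X.TSer →+* X.TMulti m := MvPowerSeries.map HahnSeries.C

/-- The coefficient of `x ^ (-n)`. -/
def loopCoeff (n : ℤ) (f : X.TLoop) : X.TSer := fun d => (MvPowerSeries.coeff d f).coeff n

@[simp] theorem coeff_loopCoeff (n : ℤ) (f : X.TLoop) (d : X.Idx →₀ ℕ) :
    MvPowerSeries.coeff d (X.loopCoeff n f) = (MvPowerSeries.coeff d f).coeff n := rfl

theorem headT_atVar_zero (n : ℤ) (f : X.TLoop) :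
    X.headT n (X.atVar (0 : Fin (m + 1)) f) = X.constMulti m (X.loopCoeff n f) := by
  ext1 d
  rw [coeff_headT, coeff_atVar, headCoeff_inVar_zero, constMulti, MvPowerSeries.coeff_map,
    coeff_loopCoeff]

theorem headT_zeta_pow_smul (n : ℤ) (k : ℕ) (f : X.TMulti (m + 1)) :
    X.headT n (zeta (0 : Fin (m + 1)) ^ k • f) = X.headT (n + k) f := by
  ext1 d
  rw [coeff_headT, MvPowerSeries.coeff_smul, headCoeff_zeta_pow_mul, coeff_headT]

theorem headT_tailEmb_smul (n : ℤ) (a : MultiLoop m) (f : X.TMulti (m + 1)) :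
    X.headT n (tailEmb a • f) = a • X.headT n f := by
  ext1 d
  rw [coeff_headT, MvPowerSeries.coeff_smul, headCoeff_tailEmb_mul, MvPowerSeries.coeff_smul,
    coeff_headT]

/-- A series is determined by the recursion for its coefficients with respect to the first
variable that multiplication by `x - ζ₁ ^ h` gives. -/
theorem headT_eq_of_recursion {h : ℕ} (hh : 0 < h) (x : MultiLoop m) (f : X.TMulti (m + 1))
    (e : ℤ → X.TMulti m) (he : ∃ N : ℤ, ∀ n < N, e n = 0)
    (hrec : ∀ n, x • X.headT n f - X.headT (n + h) f = x • e n - e (n + h)) (n : ℤ) :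
    X.headT n f = e n := by
  rw [← sub_eq_zero]
  ext1 d
  obtain ⟨N, hN⟩ := he
  -- This bound depends on `d`; hence the comparison for one monomial in the times at a time.
  obtain ⟨M, hM⟩ := exists_headCoeff_eq_zero (MvPowerSeries.coeff d f)
  rw [map_zero]
  have h0 : ∀ n < min N M, MvPowerSeries.coeff d (X.headT n f - e n) = 0 := by
    intro n hn
    rw [map_sub, coeff_headT, hM n (lt_of_lt_of_le hn (min_le_right _ _)),
      hN n (lt_of_lt_of_le hn (min_le_left _ _)), map_zero, sub_zero]
  have h1 : ∀ k : ℕ, ∀ n < min N M + k, MvPowerSeries.coeff d (X.headT n f - e n) = 0 := by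
    intro k
    induction k with
    | zero => simpa using h0
    | succ k ih =>
      intro n hn
      have h2 := ih (n - h) (by push_cast at hn; omega)
      have h3 := hrec (n - h)
      rw [sub_add_cancel, sub_eq_sub_iff_sub_eq_sub, ← smul_sub] at h3
      rw [← h3, MvPowerSeries.coeff_smul, h2, mul_zero]
  obtain ⟨k, hk⟩ : ∃ k : ℕ, n < min N M + k := ⟨(n - min N M + 1).toNat, by omega⟩
  exact h1 k n hk

theorem exists_headT_eq_zero_of_atVar (i : Fin m) {e : ℤ → X.TLoop}
    (he : ∃ N : ℤ, ∀ n < N, e n = 0) : ∃ N : ℤ, ∀ n < N, X.atVar i (e n) = 0 := by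
  obtain ⟨N, hN⟩ := he
  exact ⟨N, fun n hn => by rw [hN n hn, map_zero]⟩

/-- A series without the loop variable, seen as a series with it. -/
def constLoop : X.TSer →+* X.TLoop := MvPowerSeries.map HahnSeries.C

theorem atVar_constLoop (i : Fin m) (f : X.TSer) :
    X.atVar i (X.constLoop f) = X.constMulti m f := by
  ext1 d
  rw [coeff_atVar, constLoop, constMulti, MvPowerSeries.coeff_map, MvPowerSeries.coeff_map]
  have : ∀ c : ℂ, (HahnSeries.C c : Loop) = mono 0 c := fun c => by simp [mono]
  rw [this, inVar_mono, neg_zero, map_zero]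
  rfl

theorem zeta_pow_smul_atVar (i : Fin m) (k : ℕ) (f : X.TLoop) :
    zeta i ^ k • X.atVar i f = X.atVar i (mono k 1 • f) := by
  ext1 d
  rw [MvPowerSeries.coeff_smul, coeff_atVar, coeff_atVar, MvPowerSeries.coeff_smul, map_mul,
    zeta_pow]

theorem sub_zeta_ne_zero {h : ℕ} (hh : 0 < h) {i j : Fin m} (hij : i ≠ j) :
    (zeta i ^ h - zeta j ^ h : MultiLoop m) ≠ 0 := fun h0 =>
  hij (zeta_pow_injective hh (sub_eq_zero.mp h0))

/-- Clearing the denominator, the coefficients `g n` of the left side satisfy `ζᵢ ^ h g n - g (n +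
h) = f (n + h)`, where `f (n + h)` is a coefficient of `f`. A sequence `e` with this recursion that
vanishes for very negative `n` must be the same. It is used with `e = flowGen`. -/
theorem headT_div_smul (i : Fin m) (f : X.TLoop) (e : ℤ → X.TLoop)
    (he : ∃ N : ℤ, ∀ n < N, e n = 0)
    (hrec : ∀ n, e (n + X.cox) =
      mono X.cox 1 • e n - X.constLoop (X.loopCoeff (n + X.cox) f)) (n : ℤ) :
    X.headT n ((zeta 0 ^ X.cox / (zeta i.succ ^ X.cox - zeta 0 ^ X.cox)) •
      X.atVar (0 : Fin (m + 1)) f) = X.atVar i (e n) := by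
  have hz : (zeta i.succ : MultiLoop (m + 1)) = tailEmb (zeta i) := inVar_succ _ _
  refine X.headT_eq_of_recursion X.cox_pos (zeta i ^ X.cox) _ (fun n => X.atVar i (e n))
    (X.exists_headT_eq_zero_of_atVar i he) (fun n => ?_) n
  rw [hrec, map_sub, atVar_constLoop, zeta_pow_smul_atVar, sub_sub_cancel,
    ← headT_atVar_zero, ← headT_zeta_pow_smul, ← headT_tailEmb_smul, ← headT_zeta_pow_smul,
    ← map_sub, ← sub_smul, map_pow, ← hz, smul_smul,
    mul_div_cancel₀ _ (sub_zeta_ne_zero X.cox_pos (Fin.succ_ne_zero i))]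

/-- For a double pole the recursion is inverted twice: the solution `e` for the simple pole becomes
the inhomogeneity of the recursion for `e'`. It is used with `e' = flowGenEuler`. -/
theorem headT_div_sq_smul (i : Fin m) (f : X.TLoop) (e e' : ℤ → X.TLoop)
    (he : ∃ N : ℤ, ∀ n < N, e n = 0) (he' : ∃ N : ℤ, ∀ n < N, e' n = 0)
    (hrec : ∀ n, e (n + X.cox) =
      mono X.cox 1 • e n - X.constLoop (X.loopCoeff (n + X.cox) f))
    (hrec' : ∀ n, e' (n + X.cox) = mono X.cox 1 • e' n - mono X.cox 1 • e n) (n : ℤ) :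
    X.headT n ((zeta i.succ ^ X.cox * zeta 0 ^ X.cox /
        (zeta i.succ ^ X.cox - zeta 0 ^ X.cox) ^ 2) •
      X.atVar (0 : Fin (m + 1)) f) = X.atVar i (e' n) := by
  have hz : (zeta i.succ : MultiLoop (m + 1)) = tailEmb (zeta i) := inVar_succ _ _
  refine X.headT_eq_of_recursion X.cox_pos (zeta i ^ X.cox) _ (fun n => X.atVar i (e' n))
    (X.exists_headT_eq_zero_of_atVar i he') (fun n => ?_) n
  rw [hrec', map_sub, zeta_pow_smul_atVar, sub_sub_cancel, ← zeta_pow_smul_atVar,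
    ← X.headT_div_smul i f e he hrec, ← headT_tailEmb_smul, ← headT_zeta_pow_smul,
    ← headT_tailEmb_smul, ← map_sub, ← sub_smul, map_pow, ← hz, smul_smul, smul_smul]
  congr 2
  have := sub_zeta_ne_zero X.cox_pos (Fin.succ_ne_zero i)
  field_simp

end AffType

end DrinfeldSokolov

namespace DrinfeldSokolov

/-! ### Cyclic sums over permutations -/

section Cyclic

variable {m : ℕ}

theorem finRotate_castSucc (i : Fin m) : finRotate (m + 1) i.castSucc = i.succ := by
  rw [finRotate_apply, Fin.coeSucc_eq_succ]

theorem exists_finRotate_pow (k : Fin (m + 1)) : ∃ j : ℕ, ((finRotate (m + 1)) ^ j) 0 = k := by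
  induction k using Fin.induction with
  | zero => exact ⟨0, rfl⟩
  | succ i ih =>
    obtain ⟨j, hj⟩ := ih
    exact ⟨j + 1, by rw [pow_succ', Equiv.Perm.mul_apply, hj, finRotate_castSucc]⟩

theorem invariant_pow {A : Type*} {f : Equiv.Perm (Fin (m + 1)) → A}
    (hf : ∀ ρ, f (ρ * finRotate (m + 1)) = f ρ) (ρ : Equiv.Perm (Fin (m + 1))) (j : ℕ) :
    f (ρ * finRotate (m + 1) ^ j) = f ρ := by
  induction j with
  | zero => simp
  | succ j ih => rw [pow_succ, ← mul_assoc, hf, ih]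

/-- The sum of a cyclically invariant function over all permutations. -/
theorem sum_perm_of_invariant {A : Type*} [AddCommGroup A]
    (f : Equiv.Perm (Fin (m + 1)) → A) (hf : ∀ ρ, f (ρ * finRotate (m + 1)) = f ρ) :
    ∑ ρ, f ρ = (m + 1) • ∑ π : Equiv.Perm (Fin m), f (Equiv.Perm.decomposeFin.symm (0, π)) := by
  -- Each `ρ` is counted at the unique place `k` where it takes the value `0`; by invariance under
  -- rotations all places contribute equally.
  have h1 : ∑ ρ, f ρ = ∑ k : Fin (m + 1), ∑ ρ : Equiv.Perm (Fin (m + 1)),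
      if ρ k = 0 then f ρ else 0 := by
    rw [Finset.sum_comm]
    refine Finset.sum_congr rfl fun ρ _ => ?_
    rw [Finset.sum_eq_single (ρ⁻¹ 0)]
    · simp
    · intro k _ hk
      rw [if_neg]
      rintro h
      exact hk (by rw [← h]; simp)
    · simp
  have h2 : ∀ k : Fin (m + 1), (∑ ρ : Equiv.Perm (Fin (m + 1)), if ρ k = 0 then f ρ else 0) =
      ∑ ρ : Equiv.Perm (Fin (m + 1)), if ρ 0 = 0 then f ρ else 0 := by
    intro k
    obtain ⟨j, hj⟩ := exists_finRotate_pow k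
    rw [← Equiv.sum_comp (Equiv.mulRight (finRotate (m + 1) ^ j))
      (fun ρ => if ρ 0 = 0 then f ρ else 0)]
    refine Finset.sum_congr rfl fun ρ _ => ?_
    rw [Equiv.coe_mulRight, invariant_pow hf, Equiv.Perm.mul_apply, hj]
  have h3 : (∑ ρ : Equiv.Perm (Fin (m + 1)), if ρ 0 = 0 then f ρ else 0) =
      ∑ π : Equiv.Perm (Fin m), f (Equiv.Perm.decomposeFin.symm (0, π)) := by
    rw [← Equiv.sum_comp Equiv.Perm.decomposeFin.symm, Fintype.sum_prod_type]
    rw [Finset.sum_eq_single 0]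
    · refine Finset.sum_congr rfl fun π _ => ?_
      rw [Equiv.Perm.decomposeFin_symm_apply_zero, if_pos rfl]
    · intro k _ hk
      refine Finset.sum_eq_zero fun π _ => ?_
      rw [Equiv.Perm.decomposeFin_symm_apply_zero, if_neg hk]
    · simp
  rw [h1, Finset.sum_congr rfl fun k _ => h2 k, h3, Finset.sum_const, Finset.card_univ,
    Fintype.card_fin]

theorem comp_decomposeFin_zero {A : Type*} (f : Fin (m + 1) → A) (π : Equiv.Perm (Fin m)) :
    (f ∘ Equiv.Perm.decomposeFin.symm (0, π)) = Fin.cons (f 0) (fun i => f (π i).succ) := by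
  funext i
  refine Fin.cases ?_ (fun i => ?_) i
  · simp
  · simp [Equiv.Perm.decomposeFin_symm_apply_succ]

theorem prod_finRotate {A : Type*} [CommMonoid A] (g : Fin (m + 1) → Fin (m + 1) → A) :
    ∏ i, g (finRotate (m + 1) i) i = (∏ i : Fin m, g i.succ i.castSucc) * g 0 (Fin.last m) := by
  rw [Fin.prod_univ_castSucc]
  simp only [finRotate_castSucc, finRotate_last]

/-! ### Partial fractions for the scalar factor of the star product -/

section Pref

variable {F : Type*} [Field F]

/-- The scalar factor of the star product. -/
def starFactor (x : Fin m → F) : F := (∏ i, x i) / ∏ i, (x (finRotate m i) - x i)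

theorem starFactor_rotate (x : Fin m → F) : starFactor (x ∘ finRotate m) = starFactor x := by
  unfold starFactor
  rw [← Equiv.prod_comp (finRotate m) x,
    ← Equiv.prod_comp (finRotate m) (fun i => x (finRotate m i) - x i)]
  rfl

/-- With a single other variable the two neighbours of `y` coincide, and their poles merge into a
double one. -/
theorem starFactor_two (x y : F) :
    starFactor (Fin.cons y (fun _ => x) : Fin 2 → F) = -(x * y / (x - y) ^ 2) := by
  rw [starFactor, prod_finRotate (fun i j => (Fin.cons y (fun _ => x) : Fin 2 → F) i -
    (Fin.cons y (fun _ => x) : Fin 2 → F) j)]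
  have h : (Fin.last 1 : Fin 2) = Fin.succ 0 := rfl
  simp only [Fin.prod_univ_succ, Fin.cons_zero, Fin.cons_succ, Finset.univ_eq_empty,
    Finset.prod_empty, Fin.castSucc_zero, h]
  rw [mul_one, mul_one, ← neg_sub x y, mul_neg, div_neg, mul_comm y, sq]

/-- Inserting `y` replaces the factor `1 / (x 0 - x last)` by `y / ((x 0 - y) (y - x last))`. Its
partial fractions in `y` are simple poles of opposite sign at the two neighbours of `y` in the
cycle. -/
theorem starFactor_cons (y : F) (x : Fin (m + 2) → F) (h0 : x 0 ≠ y) (hl : x (Fin.last _) ≠ y)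
    (h0l : x 0 ≠ x (Fin.last _)) :
    starFactor (Fin.cons y x : Fin (m + 3) → F) =
      starFactor x * (y / (x 0 - y) - y / (x (Fin.last _) - y)) := by
  have h1 := sub_ne_zero.mpr h0
  have h2 := sub_ne_zero.mpr hl
  have h3 := sub_ne_zero.mpr h0l
  have h4 : (∏ i : Fin (m + 3), ((Fin.cons y x : Fin (m + 3) → F) (finRotate _ i) -
      (Fin.cons y x : Fin (m + 3) → F) i)) =
      (x 0 - y) * (∏ i : Fin (m + 1), (x i.succ - x i.castSucc)) * (y - x (Fin.last _)) := by
    rw [prod_finRotate (fun i j => (Fin.cons y x : Fin (m + 3) → F) i -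
      (Fin.cons y x : Fin (m + 3) → F) j), Fin.prod_univ_succ]
    simp only [Fin.cons_zero, Fin.cons_succ, Fin.castSucc_zero, Fin.castSucc_succ, ← Fin.succ_last]
  rw [starFactor, starFactor, h4, prod_finRotate (fun i j => x i - x j),
    Fin.prod_univ_succ (Fin.cons y x : Fin (m + 3) → F)]
  simp only [Fin.cons_zero, Fin.cons_succ]
  have h5 : y / (x 0 - y) - y / (x (Fin.last _) - y) =
      y * (x (Fin.last _) - x 0) / ((x 0 - y) * (x (Fin.last _) - y)) := by
    field_simp
    ring
  rw [h5, div_mul_div_comm]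
  have h6 : (∏ i : Fin (m + 1), (x i.succ - x i.castSucc)) * (x 0 - x (Fin.last _)) *
      ((x 0 - y) * (x (Fin.last _) - y)) =
      ((x 0 - y) * (∏ i : Fin (m + 1), (x i.succ - x i.castSucc)) * (y - x (Fin.last _))) *
        (x (Fin.last _) - x 0) := by ring
  have h7 : x (Fin.last _) - x 0 ≠ 0 := by rwa [← neg_sub, neg_ne_zero]
  rw [h6, ← mul_assoc, mul_div_mul_right _ _ h7, mul_comm y]

end Pref

/-! ### Cyclic traces, their derivatives and commutators -/

section Trace

variable {R : Type*} [CommRing R] {n : Type*} [Fintype n] [DecidableEq n]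

/-- The trace of the product of a sequence of matrices. -/
def cycTrace (M : Fin m → Matrix n n R) : R := Matrix.trace (List.ofFn M).prod

theorem cycTrace_cons (A : Matrix n n R) (M : Fin m → Matrix n n R) :
    cycTrace (Fin.cons A M : Fin (m + 1) → Matrix n n R) =
      Matrix.trace (A * (List.ofFn M).prod) := by
  rw [cycTrace, List.ofFn_succ, List.prod_cons]
  simp only [Fin.cons_zero, Fin.cons_succ]

theorem prod_ofFn_rotate (M : Fin (m + 1) → Matrix n n R) :
    (List.ofFn (M ∘ finRotate (m + 1))).prod = (List.ofFn fun i : Fin m => M i.succ).prod * M 0 := by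
  rw [List.ofFn_succ', List.concat_eq_append, List.prod_append, List.prod_singleton]
  simp only [Function.comp_apply, finRotate_castSucc, finRotate_last]

theorem cycTrace_rotate (M : Fin (m + 1) → Matrix n n R) :
    cycTrace (M ∘ finRotate (m + 1)) = cycTrace M := by
  rw [cycTrace, prod_ofFn_rotate, Matrix.trace_mul_comm, cycTrace, List.ofFn_succ, List.prod_cons]

theorem IsDer.prod_ofFn {D : R → R} (hD : IsDer D) (M : Fin m → Matrix n n R) :
    (List.ofFn M).prod.map D =
      ∑ i, (List.ofFn (Function.update M i ((M i).map D))).prod := by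
  induction m with
  | zero => simp [hD.matrix_one]
  | succ m ih =>
    rw [List.ofFn_succ, List.prod_cons, hD.matrix_mul, ih, Fin.sum_univ_succ, Finset.mul_sum]
    congr 1
    · rw [List.ofFn_succ, List.prod_cons]
      simp
    · refine Finset.sum_congr rfl fun i _ => ?_
      rw [List.ofFn_succ, List.prod_cons, Function.update_of_ne (Fin.succ_ne_zero i).symm]
      congr 3
      funext j
      by_cases h : j = i
      · subst h; simp
      · rw [Function.update_of_ne h, Function.update_of_ne (fun h' => h (Fin.succ_injective _ h'))]

variable {F : Type*} [Field F] [Algebra F R]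

/-- Rotating the cyclic word brings the modified slot `i` to the front. -/
theorem cycTrace_update_comp (M N : Fin (m + 1) → Matrix n n R) (i : Fin (m + 1)) (j : ℕ)
    (hj : ((finRotate (m + 1)) ^ j) 0 = i) (ρ : Equiv.Perm (Fin (m + 1))) :
    cycTrace (Function.update (M ∘ ρ) i (N (ρ i))) =
      Matrix.trace (N ((ρ * finRotate (m + 1) ^ j) 0) *
        (List.ofFn fun l : Fin m => M ((ρ * finRotate (m + 1) ^ j) l.succ)).prod) := by
  have h : cycTrace (Function.update (M ∘ ρ) i (N (ρ i))) =
      cycTrace (Function.update (M ∘ ρ) i (N (ρ i)) ∘ (finRotate (m + 1) ^ j : Equiv.Perm _)) := by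
    clear hj
    induction j with
    | zero => simp
    | succ j ih =>
      rw [ih, pow_succ, Equiv.Perm.coe_mul, ← Function.comp_assoc, cycTrace_rotate]
  rw [h, cycTrace, List.ofFn_succ, List.prod_cons]
  congr 2
  · simp [hj]
  · congr 2
    funext l
    rw [Function.comp_apply, Function.update_of_ne]
    · rfl
    · rw [← hj]
      exact fun h' => Fin.succ_ne_zero l ((finRotate (m + 1) ^ j).injective h')

/-- The derivative of a cyclic sum. -/
theorem sum_smul_derivation_cycTrace {D : R → R} (hD : IsDer D) (x : Fin (m + 1) → F)
    (M : Fin (m + 1) → Matrix n n R) :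
    ∑ ρ : Equiv.Perm (Fin (m + 1)), starFactor (x ∘ ρ) • D (cycTrace (M ∘ ρ)) =
      (m + 1) • ∑ ρ : Equiv.Perm (Fin (m + 1)), starFactor (x ∘ ρ) •
        Matrix.trace ((M (ρ 0)).map D * (List.ofFn fun l : Fin m => M (ρ l.succ)).prod) := by
  have h1 : ∀ ρ : Equiv.Perm (Fin (m + 1)), starFactor (x ∘ ρ) • D (cycTrace (M ∘ ρ)) =
      ∑ i, starFactor (x ∘ ρ) • cycTrace (Function.update (M ∘ ρ) i ((M (ρ i)).map D)) := by
    intro ρ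
    rw [cycTrace, ← hD.trace, hD.prod_ofFn, Matrix.trace_sum, Finset.smul_sum]
    rfl
  rw [Finset.sum_congr rfl fun ρ _ => h1 ρ, Finset.sum_comm]
  -- Reindexing the permutations by a rotation shows that every differentiated slot contributes as
  -- much as the first one.
  have h2 : ∀ i : Fin (m + 1), ∑ ρ : Equiv.Perm (Fin (m + 1)),
      starFactor (x ∘ ρ) • cycTrace (Function.update (M ∘ ρ) i ((M (ρ i)).map D)) =
      ∑ ρ : Equiv.Perm (Fin (m + 1)), starFactor (x ∘ ρ) •
        Matrix.trace ((M (ρ 0)).map D * (List.ofFn fun l : Fin m => M (ρ l.succ)).prod) := by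
    intro i
    obtain ⟨j, hj⟩ := exists_finRotate_pow i
    rw [← Equiv.sum_comp (Equiv.mulRight (finRotate (m + 1) ^ j)) (fun ρ => starFactor (x ∘ ρ) •
        Matrix.trace ((M (ρ 0)).map D * (List.ofFn fun l : Fin m => M (ρ l.succ)).prod))]
    refine Finset.sum_congr rfl fun ρ _ => ?_
    rw [Equiv.coe_mulRight, cycTrace_update_comp M (fun i => (M i).map D) i j hj,
      invariant_pow (f := fun ρ => starFactor (x ∘ ρ))]
    intro ρ
    exact starFactor_rotate (x ∘ ρ)
  rw [Finset.sum_congr rfl fun i _ => h2 i, Finset.sum_const, Finset.card_univ, Fintype.card_fin]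

/-- After a rotation of the permutations, `E` at the last place stands directly behind the first
matrix. The difference of `E` at the two ends thus becomes a commutator with that matrix, which is
the form of the flow of `K`. -/
theorem sum_smul_trace_last (x : Fin (m + 1) → F) (M E : Fin (m + 1) → Matrix n n R) :
    ∑ ρ : Equiv.Perm (Fin (m + 1)), starFactor (x ∘ ρ) •
        Matrix.trace ((E (ρ 0) - E (ρ (Fin.last m))) * (List.ofFn (M ∘ ρ)).prod) =
      ∑ ρ : Equiv.Perm (Fin (m + 1)), starFactor (x ∘ ρ) •
        Matrix.trace ((E (ρ 0) * M (ρ 0) - M (ρ 0) * E (ρ 0)) *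
          (List.ofFn fun l : Fin m => M (ρ l.succ)).prod) := by
  simp only [sub_mul, Matrix.trace_sub, smul_sub, Finset.sum_sub_distrib]
  congr 1
  · refine Finset.sum_congr rfl fun ρ _ => ?_
    rw [List.ofFn_succ, List.prod_cons, mul_assoc]
    rfl
  · rw [← Equiv.sum_comp (Equiv.mulRight (finRotate (m + 1)))]
    refine Finset.sum_congr rfl fun ρ _ => ?_
    have h1 : starFactor (x ∘ (ρ * finRotate (m + 1) : Equiv.Perm _)) = starFactor (x ∘ ρ) :=
      starFactor_rotate (x ∘ ρ)
    have h2 := prod_ofFn_rotate (M ∘ ρ)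
    rw [Equiv.coe_mulRight, h1, Equiv.Perm.mul_apply, finRotate_last, Equiv.Perm.coe_mul,
      ← Function.comp_assoc, h2, ← mul_assoc, Matrix.trace_mul_comm, ← mul_assoc]
    rfl

/-- A sum over all permutations of star products, in terms of those that begin with the first
matrix. -/
theorem sum_perm_star (x : Fin (m + 1) → F) (M : Fin (m + 1) → Matrix n n R) :
    ∑ ρ : Equiv.Perm (Fin (m + 1)), starFactor (x ∘ ρ) • cycTrace (M ∘ ρ) =
      (m + 1) • ∑ π : Equiv.Perm (Fin m),
        starFactor (Fin.cons (x 0) (fun i => x (π i).succ) : Fin (m + 1) → F) •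
          Matrix.trace (M 0 * (List.ofFn fun i => M (π i).succ).prod) := by
  rw [sum_perm_of_invariant (fun ρ => starFactor (x ∘ ρ) • cycTrace (M ∘ ρ))]
  · simp only [comp_decomposeFin_zero, cycTrace_cons]
  · intro ρ
    rw [Equiv.Perm.coe_mul, ← Function.comp_assoc, ← Function.comp_assoc, starFactor_rotate,
      cycTrace_rotate]

end Trace

end Cyclic

end DrinfeldSokolov

namespace DrinfeldSokolov

namespace AffType

/-! ### Diagonalization of the principal Heisenberg subalgebra -/

/-- `P` diagonalizes the `Λ_j`: the eigenvalues of `Λ_j` are the `d j k ζ ^ j`; the row `a` of `P` is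
homogeneous of degree `-r a`. -/
structure DiagData (X : AffType) (r : Fin X.size → ℤ) (d : ℕ → Fin X.size → ℂ) : Prop where
  r_nonneg : ∀ a, 0 ≤ r a
  r_le : ∀ a, r a ≤ X.cox
  euler_P : X.P.map euler = -(Matrix.diagonal (fun a => mono 0 (r a)) * X.P)
  isUnit_P : IsUnit X.P.det
  lam_mul_P : ∀ j ∈ X.exponents, (X.LamJ j).map (substPow X.cox X.cox_pos) * X.P =
    X.P * Matrix.diagonal (fun k => mono j (d j k))
  periodic : ∀ j ∈ X.exponents, d (j + X.cox) = d j
  orthogonal : ∀ a ∈ X.smallExp, ∀ b ∈ X.smallExp,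
    X.kappa * ∑ k, d a k * d b k = if a + b = X.cox then (X.cox : ℂ) else 0

variable (X : AffType)

theorem mem_smallExp {a : ℕ} : a ∈ X.smallExp ↔ a < X.cox ∧ a ∈ X.exponents := by
  classical
  rw [smallExp, Finset.mem_filter, Finset.mem_range]

theorem add_cox_mem_exponents (j : ℕ) : j + X.cox ∈ X.exponents ↔ j ∈ X.exponents := by
  cases X with
  | A l hl => simp [exponents, cox]
  | B l hl => simp [exponents, cox, Nat.odd_add]
  | C l hl => simp [exponents, cox, Nat.odd_add]
  | D l hl ho =>
    have h1 : Odd (j + (2 * l - 2)) ↔ Odd j := by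
      have : Even (2 * l - 2) := ⟨l - 1, by omega⟩
      simp [Nat.odd_add, this]
    simp [exponents, cox, h1]
  | G => simp only [exponents, cox, Set.mem_ofPred_eq]; omega

theorem zero_notMem_exponents : 0 ∉ X.exponents := by
  cases X with
  | D l hl ho => simp [exponents]; omega
  | _ => simp [exponents]

theorem cox_sub_mem_exponents {a : ℕ} (h1 : a < X.cox) (ha : a ∈ X.exponents) :
    X.cox - a ∈ X.exponents := by
  cases X with
  | A l hl =>
    simp only [exponents, cox, Set.mem_ofPred_eq] at *
    intro h
    apply ha
    have := (Nat.dvd_sub_iff_right h1.le (dvd_refl (l + 1))).mp h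
    exact this
  | B l hl =>
    simp only [exponents, cox, Set.mem_ofPred_eq, Nat.odd_iff] at *
    omega
  | C l hl =>
    simp only [exponents, cox, Set.mem_ofPred_eq, Nat.odd_iff] at *
    omega
  | D l hl ho =>
    simp only [exponents, cox, Set.mem_ofPred_eq, Nat.odd_iff] at *
    rw [Nat.mod_eq_of_lt h1] at ha
    rcases ha with ha | ha
    · left; omega
    · right
      rw [Nat.mod_eq_of_lt (by omega)]
      omega
  | G => simp only [exponents, cox, Set.mem_ofPred_eq] at *; omega

section Roots

variable {h : ℕ} {w : ℂ}

theorem omega_isPrimitiveRoot : IsPrimitiveRoot X.omega X.cox :=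
  Complex.isPrimitiveRoot_exp _ X.cox_pos.ne'

theorem sum_root_pow (hw : IsPrimitiveRoot w h) (s : ℕ) :
    ∑ k ∈ Finset.range h, (w ^ k) ^ s = if h ∣ s then (h : ℂ) else 0 := by
  have h1 : ∀ k, (w ^ k) ^ s = (w ^ s) ^ k := fun k => by rw [← pow_mul, ← pow_mul, mul_comm]
  simp only [h1]
  split_ifs with hs
  · rw [(hw.pow_eq_one_iff_dvd s).mpr hs]
    simp
  · have h2 : w ^ s ≠ 1 := fun h3 => hs ((hw.pow_eq_one_iff_dvd s).mp h3)
    rw [geom_sum_eq h2, ← pow_mul, mul_comm, pow_mul, hw.pow_eq_one, one_pow, sub_self, zero_div]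

/-- The system is a Vandermonde system in the distinct numbers `w ^ (-k)`. -/
theorem eq_zero_of_sum_root (hw : IsPrimitiveRoot w h) (v : ℕ → ℂ)
    (hv : ∀ a < h, ∑ k ∈ Finset.range h, (w ^ (k * a))⁻¹ * v k = 0) : ∀ k < h, v k = 0 := by
  have hinj : Function.Injective (fun k : Fin h => (w ^ (k : ℕ))⁻¹) := by
    intro i j hij
    exact Fin.ext (hw.pow_inj i.2 j.2 (inv_injective hij))
  have := Matrix.eq_zero_of_forall_pow_sum_mul_pow_eq_zero (v := fun k : Fin h => v k) hinj (by
    intro a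
    have h1 := hv a a.2
    rw [← Fin.sum_univ_eq_sum_range (fun k => (w ^ (k * (a : ℕ)))⁻¹ * v k)] at h1
    rw [← h1]
    refine Finset.sum_congr rfl fun k _ => ?_
    rw [inv_pow, ← pow_mul, mul_comm])
  intro k hk
  exact congrFun this ⟨k, hk⟩

end Roots

/-- Homogeneity of the rows factors `M` as an invertible diagonal matrix of monomials times a
constant matrix, whose kernel is trivial by `hp`. -/
theorem isUnit_det_of_graded (M : X.LMat) (r : ℕ → ℤ) (p : ℕ → ℕ → ℂ)
    (hM : ∀ a k : Fin X.size, M a k = mono (-(r a)) (p a k))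
    (hp : ∀ v : ℕ → ℂ, (∀ a < X.size, ∑ k ∈ Finset.range X.size, p a k * v k = 0) →
      ∀ k < X.size, v k = 0) : IsUnit M.det := by
  set p0 : X.CMat := Matrix.of fun a k => p a k
  have h1 : M = Matrix.diagonal (fun a : Fin X.size => mono (-(r a)) 1) *
      p0.map (HahnSeries.C : ℂ →+* Loop) := by
    ext1 a k
    rw [Matrix.diagonal_mul, hM]
    have : ∀ c : ℂ, (HahnSeries.C c : Loop) = mono 0 c := fun c => by simp [mono]
    simp [p0, this, mono_mul_mono]
  have h2 : p0.det ≠ 0 := by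
    intro h0
    obtain ⟨v, hv, hv0⟩ := Matrix.exists_mulVec_eq_zero_iff.mpr h0
    apply hv
    funext k
    have := hp (fun k => if hk : k < X.size then v ⟨k, hk⟩ else 0) (by
      intro a ha
      rw [← Fin.sum_univ_eq_sum_range
        (fun k => p a k * if hk : k < X.size then v ⟨k, hk⟩ else 0)]
      have h3 := congrFun hv0 ⟨a, ha⟩
      simpa [Matrix.mulVec, dotProduct, p0] using h3) k k.2
    simpa using this
  rw [h1, Matrix.det_mul, isUnit_iff_ne_zero, Matrix.det_diagonal]
  refine mul_ne_zero (Finset.prod_ne_zero_iff.mpr fun a _ => ?_) ?_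
  · exact HahnSeries.single_ne_zero one_ne_zero
  · have := RingHom.map_det (HahnSeries.C : ℂ →+* Loop) p0
    rw [RingHom.mapMatrix_apply] at this
    rw [← this]
    simpa using h2

theorem euler_of_graded (M : X.LMat) (r : ℕ → ℤ) (p : ℕ → ℕ → ℂ)
    (hM : ∀ a k : Fin X.size, M a k = mono (-(r a)) (p a k)) :
    M.map euler = -(Matrix.diagonal (fun a : Fin X.size => mono 0 (r a)) * M) := by
  ext1 a k
  rw [Matrix.neg_apply, Matrix.diagonal_mul, Matrix.map_apply, hM, euler_mono, mono_mul_mono,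
    zero_add]
  push_cast
  rw [neg_mul, eq_neg_iff_add_eq_zero, ← mono_add, neg_add_cancel, mono_zero_right]

/-- Row `p` of the product of `x ^ k M` with the column vector with entries `V 1, V 2, …`. -/
def rowAct (V : ℕ → Loop) (k : ℤ) (M : X.CMat) (p : Fin X.size) : Loop :=
  ∑ b : Fin X.size, mono k (M p b) * V (b + 1)

theorem rowAct_add (V : ℕ → Loop) (k : ℤ) (M N : X.CMat) (p : Fin X.size) :
    X.rowAct V k (M + N) p = X.rowAct V k M p + X.rowAct V k N p := by
  simp only [rowAct, Matrix.add_apply, mono_add, add_mul, Finset.sum_add_distrib]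

theorem rowAct_smul (V : ℕ → Loop) (k : ℤ) (c : ℂ) (M : X.CMat) (p : Fin X.size) :
    X.rowAct V k (c • M) p = mono 0 c * X.rowAct V k M p := by
  simp only [rowAct, Matrix.smul_apply, smul_eq_mul, Finset.mul_sum, ← mul_assoc, mono_mul_mono,
    zero_add]

theorem rowAct_unit (V : ℕ → Loop) (k : ℤ) (a b : ℕ) (hb : 1 ≤ b) (hb' : b ≤ X.size)
    (p : Fin X.size) :
    X.rowAct V k (X.unit a b) p = if (p : ℕ) + 1 = a then mono k 1 * V b else 0 := by
  rw [rowAct, Finset.sum_eq_single ⟨b - 1, by omega⟩]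
  · have h1 : b - 1 + 1 = b := by omega
    by_cases hp : (p : ℕ) + 1 = a
    · simp [unit, hp, h1]
    · simp [unit, hp, mono_zero_right]
  · intro q _ hq
    have : ¬ ((q : ℕ) + 1 = b) := fun h => hq (Fin.ext (by simp; omega))
    simp [unit, this, mono_zero_right]
  · simp

theorem monoMat_map_substPow (k : ℤ) (M : X.CMat) :
    (X.monoMat k M).map (substPow X.cox X.cox_pos) = X.monoMat (X.cox * k) M := by
  ext1 a b
  simp [monoMat, substPow_mono]

theorem monoMat_mul_apply (V : ℕ → ℕ → Loop) (Q : X.LMat)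
    (hQ : ∀ a k : Fin X.size, Q a k = V (a + 1) k) (k : ℤ) (M : X.CMat) (p q : Fin X.size) :
    (X.monoMat k M * Q) p q = X.rowAct (fun s => V s q) k M p := by
  simp only [Matrix.mul_apply, monoMat, Matrix.map_apply, rowAct, hQ]

theorem lam_mul_apply (V : ℕ → ℕ → Loop) (Q : X.LMat)
    (hQ : ∀ a k : Fin X.size, Q a k = V (a + 1) k) (p q : Fin X.size) :
    (X.Lam.map (substPow X.cox X.cox_pos) * Q) p q =
      X.rowAct (fun s => V s q) X.cox (X.weylE 0) p +
        ∑ i ∈ Finset.range X.rank, X.rowAct (fun s => V s q) 0 (X.weylE (i + 1)) p := by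
  have h1 : X.Lam.map (substPow X.cox X.cox_pos) = ∑ i ∈ Finset.range (X.rank + 1),
      X.monoMat (X.cox * (if i = 0 then 1 else 0)) (X.weylE i) := by
    have := map_sum (substPow X.cox X.cox_pos).mapMatrix
      (fun i => X.monoMat (if i = 0 then 1 else 0) (X.weylE i)) (Finset.range (X.rank + 1))
    rw [Lam]
    simpa only [RingHom.mapMatrix_apply, monoMat_map_substPow] using this
  rw [h1, Finset.sum_range_succ', add_mul, Finset.sum_mul, Matrix.add_apply, Matrix.sum_apply,
    add_comm]
  congr 1
  · simpa using X.monoMat_mul_apply V Q hQ _ _ p q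
  · refine Finset.sum_congr rfl fun i _ => ?_
    simpa using X.monoMat_mul_apply V Q hQ _ _ p q

theorem map_pow_mul_of_diag (M Q : X.LMat) (c : Fin X.size → ℂ) (n : ℤ)
    (h : M.map (substPow X.cox X.cox_pos) * Q = Q * Matrix.diagonal (fun k => mono n (c k)))
    (j : ℕ) :
    (M ^ j).map (substPow X.cox X.cox_pos) * Q =
      Q * Matrix.diagonal (fun k => mono (j * n) (c k ^ j)) := by
  have h1 : (M ^ j).map (substPow X.cox X.cox_pos) = (M.map (substPow X.cox X.cox_pos)) ^ j :=
    map_pow (substPow X.cox X.cox_pos).mapMatrix M j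
  rw [h1]
  clear h1
  induction j with
  | zero => simp [mono_zero_one]
  | succ j ih =>
    rw [pow_succ', mul_assoc, ih, ← mul_assoc, h, mul_assoc, Matrix.diagonal_mul_diagonal]
    simp only [mono_mul_mono, pow_succ']
    congr 3
    funext k
    congr 1
    push_cast
    ring

theorem smul_map_mul_of_diag (M Q : X.LMat) (c : Fin X.size → ℂ) (n : ℤ) (s : ℂ)
    (h : M.map (substPow X.cox X.cox_pos) * Q = Q * Matrix.diagonal (fun k => mono n (c k))) :
    (s • M).map (substPow X.cox X.cox_pos) * Q =
      Q * Matrix.diagonal (fun k => mono n (s * c k)) := by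
  have h1 : ∀ f : Loop, s • f = mono 0 s * f := fun f => by
    ext k
    rw [mono_mul_coeff, loop_smul_coeff, add_zero]
  ext1 a b
  have h2 : ((s • M).map (substPow X.cox X.cox_pos) * Q) a b =
      mono 0 s * (M.map (substPow X.cox X.cox_pos) * Q) a b := by
    simp only [Matrix.mul_apply, Matrix.map_apply, Matrix.smul_apply, substPow_smul]
    rw [Finset.mul_sum]
    refine Finset.sum_congr rfl fun k _ => ?_
    rw [h1, mul_assoc]
  rw [h2, h, Matrix.mul_diagonal, Matrix.mul_diagonal, mul_left_comm, mono_mul_mono, zero_add]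

end AffType

end DrinfeldSokolov

namespace DrinfeldSokolov

namespace AffType

/-! ### The diagonalization type by type -/

section

variable (X : AffType)

/-- The eigenvalues of `Λ` at `ζ = 1`. -/
def lamEig (k : ℕ) : ℂ := if k < X.cox then X.omega ^ k else 0

/-- Positivity of `j` matters for the columns beyond the `h`-th, where the eigenvalue is `0` and `0
^ 0 = 1` would break the periodicity. -/
theorem lamEig_pow_add (k : ℕ) {j : ℕ} (hj : 0 < j) :
    X.lamEig k ^ (j + X.cox) = X.lamEig k ^ j := by
  unfold lamEig
  split_ifs with h
  · rw [pow_add, ← pow_mul _ k X.cox, mul_comm k, pow_mul, X.omega_isPrimitiveRoot.pow_eq_one,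
      one_pow, mul_one]
  · rw [zero_pow hj.ne', zero_pow (by omega)]

theorem sum_lamEig_pow (hs : X.cox ≤ X.size) {s : ℕ} (h0 : 0 < s) :
    ∑ k : Fin X.size, X.lamEig k ^ s = if X.cox ∣ s then (X.cox : ℂ) else 0 := by
  rw [Fin.sum_univ_eq_sum_range (fun k => X.lamEig k ^ s), ← sum_root_pow X.omega_isPrimitiveRoot,
    ← Finset.sum_subset (Finset.range_mono hs)]
  · refine Finset.sum_congr rfl fun k hk => ?_
    rw [lamEig, if_pos (Finset.mem_range.mp hk)]
  · intro k _ hk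
    rw [lamEig, if_neg (by simpa using hk), zero_pow h0.ne']

theorem pos_of_mem_exponents {j : ℕ} (hj : j ∈ X.exponents) : 0 < j :=
  Nat.pos_of_ne_zero fun h => X.zero_notMem_exponents (h ▸ hj)

/-- Both exponents lie strictly between `0` and `h`, so `h` is the only multiple of `h` that their
sum can be. -/
theorem sum_lamEig_pow_small (hs : X.cox ≤ X.size) {a b : ℕ} (ha : a ∈ X.smallExp)
    (hb : b ∈ X.smallExp) :
    ∑ k : Fin X.size, X.lamEig k ^ (a + b) = if a + b = X.cox then (X.cox : ℂ) else 0 := by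
  rw [mem_smallExp] at ha hb
  have h1 := X.pos_of_mem_exponents ha.2
  rw [X.sum_lamEig_pow hs (by omega)]
  congr 1
  rw [eq_iff_iff]
  constructor
  · rintro ⟨c, hc⟩
    have : c < 2 := by
      by_contra h
      have : X.cox * 2 ≤ X.cox * c := Nat.mul_le_mul_left _ (by omega)
      omega
    interval_cases c <;> omega
  · rintro h
    rw [h]

/-- Serves the types in which every `Λ_j` is `ν Λ ^ j`; only the eigenvector equation for `Λ` and
the injectivity of the constant part of `P` are left to check. The relation `κ ν² = 1` normalizes
the orthogonality. -/
theorem diagData_of_lam (hJ : ∀ j, X.LamJ j = X.nu • X.Lam ^ j) (hs : X.cox ≤ X.size)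
    (hn : X.kappa * X.nu ^ 2 = 1) (r : ℕ → ℤ) (p : ℕ → ℕ → ℂ)
    (hr : ∀ a < X.size, 0 ≤ r a ∧ r a ≤ X.cox)
    (hP : ∀ a k : Fin X.size, X.P a k = mono (-(r a)) (p a k))
    (hp : ∀ v : ℕ → ℂ, (∀ a < X.size, ∑ k ∈ Finset.range X.size, p a k * v k = 0) →
      ∀ k < X.size, v k = 0)
    (hlam : ∀ a k : Fin X.size, (X.Lam.map (substPow X.cox X.cox_pos) * X.P) a k =
      X.P a k * mono 1 (X.lamEig k)) :
    X.DiagData (fun a => r a) (fun j k => X.nu * X.lamEig k ^ j) where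
  r_nonneg a := (hr a a.2).1
  r_le a := (hr a a.2).2
  euler_P := X.euler_of_graded X.P r p hP
  isUnit_P := X.isUnit_det_of_graded X.P r p hP hp
  lam_mul_P j _ := by
    rw [hJ]
    apply smul_map_mul_of_diag
    have h : X.Lam.map (substPow X.cox X.cox_pos) * X.P =
        X.P * Matrix.diagonal (fun k : Fin X.size => mono 1 (X.lamEig k)) := by
      ext1 a k
      rw [hlam, Matrix.mul_diagonal]
    simpa using X.map_pow_mul_of_diag X.Lam X.P _ 1 h j
  periodic j hj := by
    funext k
    rw [X.lamEig_pow_add _ (X.pos_of_mem_exponents hj)]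
  orthogonal a ha b hb := by
    rw [← X.sum_lamEig_pow_small hs ha hb, Finset.mul_sum]
    refine Finset.sum_congr rfl fun k _ => ?_
    rw [pow_add]
    linear_combination (X.lamEig k ^ a * X.lamEig k ^ b) * hn

theorem omega_ne_zero : X.omega ≠ 0 := Complex.exp_ne_zero _

theorem omega_pow_inv_mul (a k : ℕ) :
    (X.omega ^ (k * (a + 1)))⁻¹ * X.omega ^ k = (X.omega ^ (k * a))⁻¹ := by
  have h := X.omega_ne_zero
  rw [mul_add, pow_add, mul_one]
  field_simp

theorem omega_pow_inv_last {a : ℕ} (ha : a + 1 = X.cox) (k : ℕ) :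
    (X.omega ^ (k * a))⁻¹ = X.omega ^ k := by
  have h := X.omega_pow_inv_mul a k
  have h1 : X.omega ^ (k * (a + 1)) = 1 := by
    rw [ha, mul_comm, pow_mul, X.omega_isPrimitiveRoot.pow_eq_one, one_pow]
  rw [h1, inv_one, one_mul] at h
  exact h.symm

theorem omega_pow_cox (k : ℕ) : X.omega ^ (k * X.cox) = 1 := by
  rw [mul_comm, pow_mul, X.omega_isPrimitiveRoot.pow_eq_one, one_pow]

end

/-- Collects the entries `e_{i+1,i}` of the Weyl generators; `sum_shift_rev` collects their mirror
images. Together they make `Λ` a shift of rows, apart from a few exceptional rows. -/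
theorem sum_shift (f : ℕ → Loop) (l p : ℕ) :
    ∑ i ∈ Finset.range l, (if p + 1 = i + 1 + 1 then f (i + 1) else 0) =
      if 1 ≤ p ∧ p ≤ l then f p else 0 := by
  split_ifs with h
  · rw [Finset.sum_eq_single (p - 1)]
    · rw [if_pos (by omega)]
      congr 1
      omega
    · intro i _ hi
      rw [if_neg (by omega)]
    · intro hi
      rw [Finset.mem_range] at hi
      omega
  · refine Finset.sum_eq_zero fun i hi => ?_
    rw [Finset.mem_range] at hi
    rw [if_neg (by omega)]

theorem sum_shift_rev (f : ℕ → Loop) (l p N : ℕ) (hl : l < N) :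
    ∑ i ∈ Finset.range l, (if p + 1 = N - (i + 1) then f (N - 1 - (i + 1)) else 0) =
      if p + 1 < N ∧ N ≤ p + 1 + l then f p else 0 := by
  split_ifs with h
  · rw [Finset.sum_eq_single (N - p - 2)]
    · rw [if_pos (by omega)]
      congr 1
      omega
    · intro i _ hi
      rw [if_neg (by omega)]
    · intro hi
      rw [Finset.mem_range] at hi
      omega
  · refine Finset.sum_eq_zero fun i hi => ?_
    rw [Finset.mem_range] at hi
    rw [if_neg (by omega)]

theorem lam_mul_P_A (l : ℕ) (hl : 1 ≤ l) (V : ℕ → ℕ → Loop)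
    (hV : ∀ a k : Fin (A l hl).size, (A l hl).P a k = V (a + 1) k) (p q : Fin (A l hl).size) :
    ((A l hl).Lam.map (substPow _ (A l hl).cox_pos) * (A l hl).P) p q =
      if (p : ℕ) = 0 then mono (l + 1) 1 * V (l + 1) q else V p q := by
  have hsz : (A l hl).size = l + 1 := rfl
  have hp : (p : ℕ) < l + 1 := p.2
  rw [(A l hl).lam_mul_apply V _ hV]
  have h0 : (A l hl).weylE 0 = (A l hl).unit 1 (l + 1) := rfl
  have hi : ∀ i ∈ Finset.range l, (A l hl).rowAct (fun s => V s q) 0 ((A l hl).weylE (i + 1)) p =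
      if (p : ℕ) + 1 = i + 1 + 1 then V (i + 1) q else 0 := by
    intro i hi
    rw [Finset.mem_range] at hi
    have h1 : (A l hl).weylE (i + 1) = (A l hl).unit (i + 1 + 1) (i + 1) := rfl
    rw [h1, rowAct_unit _ _ _ _ _ (by omega) (by omega), mono_zero_one, one_mul]
  have hr : (A l hl).rank = l := rfl
  rw [hr, Finset.sum_congr rfl hi, sum_shift (fun s => V s q), h0,
    rowAct_unit _ _ _ _ _ (by omega) (by omega)]
  have hc : ((A l hl).cox : ℤ) = l + 1 := by simp [cox]
  rw [hc]
  by_cases h : (p : ℕ) = 0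
  · simp [h]
  · rw [if_neg (by omega), if_pos (by omega), if_neg h, zero_add]

theorem lam_mul_P_B (l : ℕ) (hl : 3 ≤ l) (V : ℕ → ℕ → Loop)
    (hV : ∀ a k : Fin (B l hl).size, (B l hl).P a k = V (a + 1) k) (p q : Fin (B l hl).size) :
    ((B l hl).Lam.map (substPow _ (B l hl).cox_pos) * (B l hl).P) p q =
      if (p : ℕ) = 0 then mono (2 * l) (1 / 2) * V (2 * l) q
      else if (p : ℕ) = 1 then mono (2 * l) (1 / 2) * V (2 * l + 1) q + V 1 q else V p q := by
  have hsz : (B l hl).size = 2 * l + 1 := rfl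
  have hp : (p : ℕ) < 2 * l + 1 := p.2
  rw [(B l hl).lam_mul_apply V _ hV]
  have h0 : (B l hl).weylE 0 =
    (1 / 2 : ℂ) • ((B l hl).unit 1 (2 * l) + (B l hl).unit 2 (2 * l + 1)) := rfl
  have hi : ∀ i ∈ Finset.range l, (B l hl).rowAct (fun s => V s q) 0 ((B l hl).weylE (i + 1)) p =
      (if (p : ℕ) + 1 = i + 1 + 1 then V (i + 1) q else 0) +
      (if (p : ℕ) + 1 = 2 * l + 2 - (i + 1) then V (2 * l + 2 - 1 - (i + 1)) q else 0) := by
    intro i hi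
    rw [Finset.mem_range] at hi
    have h1 : (B l hl).weylE (i + 1) = (B l hl).unit (i + 1 + 1) (i + 1) +
      (B l hl).unit (2 * l + 2 - (i + 1)) (2 * l + 1 - (i + 1)) := rfl
    rw [h1, rowAct_add, rowAct_unit _ _ _ _ _ (by omega) (by omega),
      rowAct_unit _ _ _ _ _ (by omega) (by omega), mono_zero_one, one_mul, one_mul]
    rfl
  have hr : (B l hl).rank = l := rfl
  rw [hr, Finset.sum_congr rfl hi, Finset.sum_add_distrib, sum_shift (fun s => V s q),
    sum_shift_rev (fun s => V s q) _ _ _ (by omega), h0, rowAct_smul, rowAct_add,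
    rowAct_unit _ _ _ _ _ (by omega) (by omega), rowAct_unit _ _ _ _ _ (by omega) (by omega)]
  have hc : ((B l hl).cox : ℤ) = 2 * l := by simp [cox]
  rw [hc]
  by_cases h : (p : ℕ) = 0
  · rw [if_pos (by omega), if_neg (by omega), if_neg (by omega), if_neg (by omega), if_pos h,
      add_zero, add_zero, add_zero, ← mul_assoc, mono_mul_mono, zero_add, mul_one]
  · by_cases h1 : (p : ℕ) = 1
    · rw [if_neg (by omega), if_pos (by omega), if_pos (by omega), if_neg (by omega), if_neg h,
        if_pos h1, add_zero, zero_add, ← mul_assoc, mono_mul_mono, zero_add, mul_one, h1]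
    · rw [if_neg (by omega), if_neg (by omega), if_neg h, if_neg h1]
      by_cases h2 : (p : ℕ) ≤ l
      · rw [if_pos (by omega), if_neg (by omega)]; simp
      · rw [if_neg (by omega), if_pos (by omega)]; simp

theorem lam_mul_P_C (l : ℕ) (hl : 2 ≤ l) (V : ℕ → ℕ → Loop)
    (hV : ∀ a k : Fin (C l hl).size, (C l hl).P a k = V (a + 1) k) (p q : Fin (C l hl).size) :
    ((C l hl).Lam.map (substPow _ (C l hl).cox_pos) * (C l hl).P) p q =
      if (p : ℕ) = 0 then mono (2 * l) 1 * V (2 * l) q else V p q := by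
  have hsz : (C l hl).size = 2 * l := rfl
  have hp : (p : ℕ) < 2 * l := p.2
  rw [(C l hl).lam_mul_apply V _ hV]
  have h0 : (C l hl).weylE 0 = (C l hl).unit 1 (2 * l) := rfl
  have hi : ∀ i ∈ Finset.range (l - 1),
      (C l hl).rowAct (fun s => V s q) 0 ((C l hl).weylE (i + 1)) p =
      (if (p : ℕ) + 1 = i + 1 + 1 then V (i + 1) q else 0) +
      (if (p : ℕ) + 1 = 2 * l + 1 - (i + 1) then V (2 * l + 1 - 1 - (i + 1)) q else 0) := by
    intro i hi
    rw [Finset.mem_range] at hi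
    have h1 : (C l hl).weylE (i + 1) = (C l hl).unit (i + 1 + 1) (i + 1) +
      (C l hl).unit (2 * l + 1 - (i + 1)) (2 * l - (i + 1)) := by
      simp only [weylE]
      rw [if_neg (by omega), if_neg (by omega)]
    rw [h1, rowAct_add, rowAct_unit _ _ _ _ _ (by omega) (by omega),
      rowAct_unit _ _ _ _ _ (by omega) (by omega), mono_zero_one, one_mul, one_mul]
    rfl
  have hlast : (C l hl).weylE (l - 1 + 1) = (C l hl).unit (l + 1) l := by
    simp only [weylE]
    rw [if_neg (by omega), if_pos (by omega)]
  have hr : (C l hl).rank = l - 1 + 1 := by simp only [rank]; omega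
  rw [hr, Finset.sum_range_succ, Finset.sum_congr rfl hi, Finset.sum_add_distrib,
    sum_shift (fun s => V s q), sum_shift_rev (fun s => V s q) _ _ _ (by omega), h0, hlast,
    rowAct_unit _ _ _ _ _ (by omega) (by omega), rowAct_unit _ _ _ _ _ (by omega) (by omega)]
  have hc : ((C l hl).cox : ℤ) = 2 * l := by simp [cox]
  rw [hc, mono_zero_one, one_mul]
  by_cases h : (p : ℕ) = 0
  · rw [if_pos (by omega), if_neg (by omega), if_neg (by omega), if_neg (by omega), if_pos h]
    simp
  · rw [if_neg (by omega), if_neg h]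
    by_cases h2 : (p : ℕ) < l
    · rw [if_pos (by omega), if_neg (by omega), if_neg (by omega)]; simp
    · by_cases h3 : (p : ℕ) = l
      · rw [if_neg (by omega), if_neg (by omega), if_pos (by omega), h3]; simp
      · rw [if_neg (by omega), if_pos (by omega), if_neg (by omega)]; simp

theorem lam_mul_P_D (l : ℕ) (hl : 4 ≤ l) (ho : Odd l) (V : ℕ → ℕ → Loop)
    (hV : ∀ a k : Fin (D l hl ho).size, (D l hl ho).P a k = V (a + 1) k)
    (p q : Fin (D l hl ho).size) :
    ((D l hl ho).Lam.map (substPow _ (D l hl ho).cox_pos) * (D l hl ho).P) p q =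
      if (p : ℕ) = 0 then mono (2 * l - 2) (1 / 2) * V (2 * l - 1) q
      else if (p : ℕ) = 1 then mono (2 * l - 2) (1 / 2) * V (2 * l) q + V 1 q
      else if (p : ℕ) = l then mono 0 (1 / 2) * V (l - 1) q
      else if (p : ℕ) = l + 1 then V (l + 1) q + mono 0 (1 / 2) * V l q
      else V p q := by
  have hsz : (D l hl ho).size = 2 * l := rfl
  have hp : (p : ℕ) < 2 * l := p.2
  rw [(D l hl ho).lam_mul_apply V _ hV]
  have h0 : (D l hl ho).weylE 0 =
    (1 / 2 : ℂ) • ((D l hl ho).unit 1 (2 * l - 1) + (D l hl ho).unit 2 (2 * l)) := rfl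
  have hi : ∀ i ∈ Finset.range (l - 1),
      (D l hl ho).rowAct (fun s => V s q) 0 ((D l hl ho).weylE (i + 1)) p =
      (if (p : ℕ) + 1 = i + 1 + 1 then V (i + 1) q else 0) +
      (if (p : ℕ) + 1 = 2 * l + 1 - (i + 1) then V (2 * l + 1 - 1 - (i + 1)) q else 0) := by
    intro i hi
    rw [Finset.mem_range] at hi
    have h1 : (D l hl ho).weylE (i + 1) = (D l hl ho).unit (i + 1 + 1) (i + 1) +
      (D l hl ho).unit (2 * l + 1 - (i + 1)) (2 * l - (i + 1)) := by
      simp only [weylE]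
      rw [if_neg (by omega), if_neg (by omega)]
    rw [h1, rowAct_add, rowAct_unit _ _ _ _ _ (by omega) (by omega),
      rowAct_unit _ _ _ _ _ (by omega) (by omega), mono_zero_one, one_mul, one_mul]
    rfl
  have hlast : (D l hl ho).weylE (l - 1 + 1) =
      (1 / 2 : ℂ) • ((D l hl ho).unit (l + 1) (l - 1) + (D l hl ho).unit (l + 2) l) := by
    simp only [weylE]
    rw [if_neg (by omega), if_pos (by omega)]
  have hr : (D l hl ho).rank = l - 1 + 1 := by simp only [rank]; omega
  rw [hr, Finset.sum_range_succ, Finset.sum_congr rfl hi, Finset.sum_add_distrib,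
    sum_shift (fun s => V s q), sum_shift_rev (fun s => V s q) _ _ _ (by omega), h0, hlast,
    rowAct_smul, rowAct_add, rowAct_smul, rowAct_add,
    rowAct_unit _ _ _ _ _ (by omega) (by omega), rowAct_unit _ _ _ _ _ (by omega) (by omega),
    rowAct_unit _ _ _ _ _ (by omega) (by omega), rowAct_unit _ _ _ _ _ (by omega) (by omega)]
  have hc : ((D l hl ho).cox : ℤ) = 2 * l - 2 := by simp only [cox]; omega
  rw [hc, mono_zero_one, one_mul, one_mul]
  have hm : ∀ f : Loop, mono 0 (1 / 2) * (mono (2 * l - 2) 1 * f) =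
      mono (2 * l - 2) (1 / 2) * f := by
    intro f
    rw [← mul_assoc, mono_mul_mono, zero_add, mul_one]
  by_cases h : (p : ℕ) = 0
  · rw [if_pos (by omega), if_neg (by omega), if_neg (by omega), if_neg (by omega),
      if_neg (by omega), if_neg (by omega), if_pos h, add_zero, hm]
    simp
  · rw [if_neg h, if_neg (by omega)]
    by_cases h1 : (p : ℕ) = 1
    · rw [if_pos (by omega), if_pos (by omega), if_neg (by omega), if_neg (by omega),
        if_neg (by omega), if_pos h1, zero_add, hm, h1]
      simp
    · rw [if_neg (by omega), if_neg h1]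
      by_cases h2 : (p : ℕ) < l
      · rw [if_pos (by omega), if_neg (by omega), if_neg (by omega), if_neg (by omega),
          if_neg (by omega), if_neg (by omega)]
        simp
      · rw [if_neg (by omega)]
        by_cases h3 : (p : ℕ) = l
        · rw [if_neg (by omega), if_pos (by omega), if_neg (by omega), if_pos h3]
          simp
        · rw [if_pos (by omega), if_neg (by omega), if_neg h3]
          by_cases h4 : (p : ℕ) = l + 1
          · rw [if_pos (by omega), if_pos h4, h4]
            simp
          · rw [if_neg (by omega), if_neg h4]
            simp

/-- `E_1 + E_2` is the full subdiagonal and `E_0` is that of `B_3`, so `Λ` is the same matrix as in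
type `B_3` and `pB` with `l = 3` serves for both. -/
theorem lam_mul_P_G (V : ℕ → ℕ → Loop)
    (hV : ∀ a k : Fin G.size, G.P a k = V (a + 1) k) (p q : Fin G.size) :
    (G.Lam.map (substPow _ G.cox_pos) * G.P) p q =
      if (p : ℕ) = 0 then mono 6 (1 / 2) * V 6 q
      else if (p : ℕ) = 1 then mono 6 (1 / 2) * V 7 q + V 1 q else V p q := by
  have hsz : G.size = 7 := rfl
  have hp : (p : ℕ) < 7 := p.2
  rw [G.lam_mul_apply V _ hV]
  have h0 : G.weylE 0 = (1 / 2 : ℂ) • (G.unit 1 6 + G.unit 2 7) := rfl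
  have h1 : G.weylE (0 + 1) = G.unit 2 1 + G.unit 4 3 + G.unit 5 4 + G.unit 7 6 := rfl
  have h2 : G.weylE (1 + 1) = G.unit 3 2 + G.unit 6 5 := rfl
  have hr : G.rank = 2 := rfl
  have hc : (G.cox : ℤ) = 6 := rfl
  have hm : ∀ f : Loop, mono 0 (1 / 2) * (mono 6 1 * f) = mono 6 (1 / 2) * f := by
    intro f
    rw [← mul_assoc, mono_mul_mono, zero_add, mul_one]
  have hu : ∀ k a b, 1 ≤ b → b ≤ 7 → G.rowAct (fun s => V s q) k (G.unit a b) p =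
    if (p : ℕ) + 1 = a then mono k 1 * V b q else 0 := fun k a b hb hb' =>
      G.rowAct_unit _ k a b hb hb' p
  rw [hr, Finset.sum_range_succ, Finset.sum_range_succ, Finset.sum_range_zero, h0, h1, h2, hc]
  simp only [rowAct_add, rowAct_smul]
  rw [hu _ _ 6 (by norm_num) (by norm_num), hu _ _ 7 (by norm_num) (by norm_num),
    hu _ _ 1 (by norm_num) (by norm_num), hu _ _ 3 (by norm_num) (by norm_num),
    hu _ _ 4 (by norm_num) (by norm_num), hu _ _ 6 (by norm_num) (by norm_num),
    hu _ _ 2 (by norm_num) (by norm_num), hu _ _ 5 (by norm_num) (by norm_num)]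
  simp only [mono_zero_one, one_mul]
  generalize (p : ℕ) = s at hp
  interval_cases s <;> simp <;> simpa using hm _

end AffType

end DrinfeldSokolov

namespace DrinfeldSokolov

namespace AffType

theorem diagData_A (l : ℕ) (hl : 1 ≤ l) : ∃ r d, (A l hl).DiagData r d := by
  set X := A l hl with hX
  have hsz : X.size = l + 1 := rfl
  have hcox : X.cox = l + 1 := rfl
  set p : ℕ → ℕ → ℂ := fun a k => (1 / ((l : ℂ) + 1)) * (X.omega ^ (k * a))⁻¹ with hpdef
  have hP : ∀ a k : Fin X.size, X.P a k = mono (-((a : ℕ) : ℤ)) (p a k) := fun a k => rfl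
  refine ⟨_, _, X.diagData_of_lam (fun j => rfl) le_rfl ?_ (fun a => (a : ℤ)) p ?_ hP ?_ ?_⟩
  · simp [hX, kappa, nu]
  · intro a ha
    rw [hcox]
    omega
  · intro v hv
    refine eq_zero_of_sum_root X.omega_isPrimitiveRoot v fun a ha => ?_
    have h1 := hv a ha
    simp only [hpdef, mul_assoc, ← Finset.mul_sum] at h1
    exact (mul_eq_zero.mp h1).resolve_left (by
      simpa using Nat.cast_add_one_ne_zero (R := ℂ) l)
  · intro a k
    rw [lam_mul_P_A l hl (fun s q => mono (-((s - 1 : ℕ) : ℤ)) (p (s - 1) q)) hP, hP]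
    have hk : (k : ℕ) < X.cox := k.2
    have he : X.lamEig k = X.omega ^ (k : ℕ) := if_pos hk
    rw [mono_mul_mono, he]
    simp only [hpdef, Nat.add_sub_cancel]
    split_ifs with h
    · rw [h, mono_mul_mono, X.omega_pow_inv_last rfl]
      congr 1
      · push_cast; ring
      · simp
    · obtain ⟨b, hb⟩ := Nat.exists_eq_succ_of_ne_zero h
      rw [hb, Nat.succ_eq_add_one, Nat.add_sub_cancel, mono_mul_mono, mul_assoc, omega_pow_inv_mul]
      congr 1
      push_cast; ring

theorem diagData_C (l : ℕ) (hl : 2 ≤ l) : ∃ r d, (C l hl).DiagData r d := by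
  set X := C l hl with hX
  have hsz : X.size = 2 * l := rfl
  have hcox : X.cox = 2 * l := rfl
  set p : ℕ → ℕ → ℂ := fun a k => (1 / (2 * (l : ℂ))) * (X.omega ^ (k * a))⁻¹ with hpdef
  have hP : ∀ a k : Fin X.size, X.P a k = mono (-((a : ℕ) : ℤ)) (p a k) := fun a k => rfl
  refine ⟨_, _, X.diagData_of_lam (fun j => rfl) le_rfl ?_ (fun a => (a : ℤ)) p ?_ hP ?_ ?_⟩
  · simp [hX, kappa, nu]
  · intro a ha
    rw [hcox]
    omega
  · intro v hv
    refine eq_zero_of_sum_root X.omega_isPrimitiveRoot v fun a ha => ?_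
    have h1 := hv a ha
    simp only [hpdef, mul_assoc, ← Finset.mul_sum] at h1
    exact (mul_eq_zero.mp h1).resolve_left (by
      have : (l : ℂ) ≠ 0 := by exact_mod_cast (by omega : l ≠ 0)
      simpa using this)
  · intro a k
    rw [lam_mul_P_C l hl (fun s q => mono (-((s - 1 : ℕ) : ℤ)) (p (s - 1) q)) hP, hP]
    have hk : (k : ℕ) < X.cox := k.2
    have he : X.lamEig k = X.omega ^ (k : ℕ) := if_pos hk
    rw [mono_mul_mono, he]
    simp only [hpdef]
    split_ifs with h
    · rw [h, mono_mul_mono, X.omega_pow_inv_last (a := 2 * l - 1) (by omega)]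
      congr 1
      · push_cast [(by omega : 1 ≤ 2 * l)]; ring
      · simp
    · obtain ⟨b, hb⟩ := Nat.exists_eq_succ_of_ne_zero h
      rw [hb, Nat.succ_eq_add_one, Nat.add_sub_cancel, mono_mul_mono, mul_assoc, omega_pow_inv_mul]
      congr 1
      push_cast; ring

theorem kappa_nu_sqrt_two : (1 / 2 : ℂ) * ((Real.sqrt 2 : ℝ) : ℂ) ^ 2 = 1 := by
  rw [← Complex.ofReal_pow, Real.sq_sqrt (by norm_num)]
  norm_num

/-- The constant matrix underlying `P` in types `B` and `G₂`. -/
def pB (w : ℂ) (l a k : ℕ) : ℂ := (1 / (2 * (l : ℂ))) *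
  (if k < 2 * l then (if a = 0 then 1 / 2 else (w ^ (k * a))⁻¹)
  else if a = 0 then (l : ℂ) else if a = 2 * l then -(2 * (l : ℂ)) else 0)

/-- Since `w ^ (2 * l) = 1`, rows `0` and `2 * l` are proportional on the first `2 * l` columns.
Comparing them kills the last coordinate, and a Vandermonde system remains. -/
theorem pB_injective {w : ℂ} {l : ℕ} (hl : 3 ≤ l) (hw : IsPrimitiveRoot w (2 * l)) (v : ℕ → ℂ)
    (hv : ∀ a < 2 * l + 1, ∑ k ∈ Finset.range (2 * l + 1), pB w l a k * v k = 0) :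
    ∀ k < 2 * l + 1, v k = 0 := by
  have hl0 : (l : ℂ) ≠ 0 := by exact_mod_cast (by omega : l ≠ 0)
  have h1 : ∀ a < 2 * l + 1,
      (∑ k ∈ Finset.range (2 * l), (if a = 0 then 1 / 2 else (w ^ (k * a))⁻¹) * v k) +
      (if a = 0 then (l : ℂ) else if a = 2 * l then -(2 * (l : ℂ)) else 0) * v (2 * l) = 0 := by
    intro a ha
    have h2 := hv a ha
    simp only [pB, mul_assoc, ← Finset.mul_sum] at h2
    have h3 := (mul_eq_zero.mp h2).resolve_left (by simpa using hl0)
    rw [Finset.sum_range_succ, if_neg (lt_irrefl _)] at h3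
    refine Eq.trans (congrArg (· + _) ?_) h3
    refine Finset.sum_congr rfl fun k hk => ?_
    rw [if_pos (Finset.mem_range.mp hk)]
  have h0 := h1 0 (by omega)
  have hlast := h1 (2 * l) (by omega)
  have hne : 2 * l ≠ 0 := by omega
  simp only [if_true, if_neg hne, ← Finset.mul_sum] at h0 hlast
  have hone : ∀ k, (w ^ (k * (2 * l)))⁻¹ = 1 := fun k => by
    rw [mul_comm, pow_mul, hw.pow_eq_one, one_pow, inv_one]
  simp only [hone, one_mul] at hlast
  have hv2 : v (2 * l) = 0 := by
    have h5 : 2 * (l : ℂ) * v (2 * l) = 0 := by linear_combination h0 - hlast / 2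
    exact (mul_eq_zero.mp h5).resolve_left (by simpa using hl0)
  have hv1 := eq_zero_of_sum_root hw v (by
    intro a ha
    rcases Nat.eq_zero_or_pos a with rfl | ha0
    · rw [hv2] at hlast
      simpa using hlast
    · have h6 := h1 a (by omega)
      rw [hv2, mul_zero, add_zero] at h6
      simpa only [if_neg ha0.ne'] using h6)
  intro k hk
  rcases Nat.lt_succ_iff_lt_or_eq.mp hk with h | h
  · exact hv1 k h
  · rw [h, hv2]

theorem pB_eigenvector (X : AffType) {l : ℕ} (hl : 3 ≤ l) (hcox : X.cox = 2 * l) (a k : ℕ)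
    (ha : a < 2 * l + 1) :
    (if a = 0 then mono (2 * l) (1 / 2) * mono (-((2 * l - 1 : ℕ) : ℤ)) (pB X.omega l (2 * l - 1) k)
      else if a = 1 then mono (2 * l) (1 / 2) * mono (-((2 * l : ℕ) : ℤ)) (pB X.omega l (2 * l) k)
        + mono 0 (pB X.omega l 0 k)
      else mono (-((a - 1 : ℕ) : ℤ)) (pB X.omega l (a - 1) k)) =
    mono (-(a : ℤ)) (pB X.omega l a k) * mono 1 (X.lamEig k) := by
  have hl0 : (l : ℂ) ≠ 0 := by exact_mod_cast (by omega : l ≠ 0)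
  simp only [mono_mul_mono, lamEig, hcox]
  by_cases hk : k < 2 * l
  · simp only [pB, if_pos hk]
    split_ifs with h1 h2 h3 h4 h5
    · omega
    · rw [X.omega_pow_inv_last (a := 2 * l - 1) (by omega), h1]
      congr 1
      · push_cast [(by omega : 1 ≤ 2 * l)]; ring
      · ring
    · omega
    · have h7 := X.omega_pow_cox k
      rw [hcox] at h7
      have h8 := X.omega_pow_inv_mul 0 k
      rw [zero_add, mul_one, mul_zero, pow_zero, inv_one] at h8
      have e1 : (2 * (l : ℤ) + -((2 * l : ℕ) : ℤ)) = 0 := by push_cast; ring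
      have e2 : -(((1 : ℕ)) : ℤ) + 1 = 0 := by norm_num
      rw [h7, h3, e1, e2, ← mono_add, mul_one, mul_assoc (1 / (2 * (l : ℂ))), h8]
      congr 1
      ring
    · omega
    · obtain ⟨b, hb⟩ := Nat.exists_eq_succ_of_ne_zero h1
      rw [hb, Nat.succ_eq_add_one, Nat.add_sub_cancel, mul_assoc, omega_pow_inv_mul]
      congr 1
      push_cast; ring
  · simp only [pB, if_neg hk, mul_zero, mono_zero_right]
    split_ifs with h1 h2 h3 h4 h5 h6 h7
    all_goals first
      | omega
      | (simp only [mul_zero, mono_zero_right])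
      | skip
    -- The one nontrivial row of the extra column: its entries `l` and `-2 l`, the latter halved by
    -- `E_0`, cancel. This column lies in the kernel of `Λ`.
    rw [show (2 * (l : ℤ) + -((2 * l : ℕ) : ℤ)) = 0 by push_cast; ring, ← mono_add]
    rw [show (1 / 2 * (1 / (2 * (l : ℂ)) * -(2 * (l : ℂ))) + 1 / (2 * (l : ℂ)) * (l : ℂ)) = 0 by
      field_simp; ring]
    exact mono_zero_right 0

theorem diagData_B (l : ℕ) (hl : 3 ≤ l) : ∃ r d, (B l hl).DiagData r d := by
  set X := B l hl with hX
  have hsz : X.size = 2 * l + 1 := rfl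
  have hcox : X.cox = 2 * l := rfl
  have hP : ∀ a k : Fin X.size, X.P a k = mono (-((a : ℕ) : ℤ)) (pB X.omega l a k) :=
    fun a k => rfl
  refine ⟨_, _, X.diagData_of_lam (fun j => rfl) (by omega) kappa_nu_sqrt_two (fun a => (a : ℤ))
    (pB X.omega l) ?_ hP ?_ ?_⟩
  · intro a ha
    rw [hcox]
    omega
  · intro v hv
    exact pB_injective hl X.omega_isPrimitiveRoot v hv
  · intro a k
    rw [lam_mul_P_B l hl (fun s q => mono (-((s - 1 : ℕ) : ℤ)) (pB X.omega l (s - 1) q)) hP, hP,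
      ← pB_eigenvector X hl hcox a k a.2]
    simp

theorem diagData_G : ∃ r d, G.DiagData r d := by
  have hP : ∀ a k : Fin G.size, G.P a k = mono (-((a : ℕ) : ℤ)) (pB G.omega 3 a k) := by
    intro a k
    simp only [P, pB, Matrix.of_apply]
    norm_num
  refine ⟨_, _, G.diagData_of_lam (fun j => rfl) (by decide) kappa_nu_sqrt_two (fun a => (a : ℤ))
    (pB G.omega 3) ?_ hP ?_ ?_⟩
  · intro a ha
    have hsz : G.size = 7 := rfl
    have hcox : G.cox = 6 := rfl
    rw [hcox]
    omega
  · intro v hv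
    exact pB_injective le_rfl G.omega_isPrimitiveRoot v hv
  · intro a k
    rw [lam_mul_P_G (fun s q => mono (-((s - 1 : ℕ) : ℤ)) (pB G.omega 3 (s - 1) q)) hP, hP,
      ← pB_eigenvector G le_rfl rfl a k a.2]
    simp

end AffType

end DrinfeldSokolov

/-! ### Type D: two extra columns and the matrix `Γ` -/

namespace DrinfeldSokolov

namespace AffType

/-- The signs of the two last columns of `P` in type `D`, and `0` for the other ones. -/
def gamEig (l k : ℕ) : ℂ := if k < 2 * l - 2 then 0 else if k = 2 * l - 2 then -1 else 1

/-- The degrees of the rows of `P` in type `D`. -/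
def rD (l a : ℕ) : ℕ := if a < l then a else a - 1

/-- The constant matrix underlying `P` in type `D`. -/
def pD (w : ℂ) (l a k : ℕ) : ℂ := (1 / (2 * (l : ℂ) - 2)) *
  (if k < 2 * l - 2 then (if a = 0 ∨ a = l then 1 / 2 else 1) * (w ^ (k * rD l a))⁻¹
  else ((l : ℂ) - 1) *
    (if a = 0 then 1 / 2
    else if a = l - 1 then (if k = 2 * l - 2 then -1 else 1) / Complex.I
    else if a = l then -(if k = 2 * l - 2 then -1 else 1) / (2 * Complex.I)
    else if a = 2 * l - 1 then -1
    else 0))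

theorem mono_add_mono {k k₁ k₂ : ℤ} (h₁ : k₁ = k) (h₂ : k₂ = k) (c d : ℂ) :
    mono k₁ c + mono k₂ d = mono k (c + d) := by
  rw [h₁, h₂, mono_add]

theorem mono_congr {k k₁ : ℤ} {c d : ℂ} (h₁ : k₁ = k) (h : c = d) : mono k₁ c = mono k d := by
  rw [h₁, h]

section

variable {w : ℂ} {l : ℕ} (hl : 4 ≤ l)

include hl

theorem rD_zero : rD l 0 = 0 := if_pos (by omega)
theorem rD_pred : rD l (l - 1) = l - 1 := if_pos (by omega)
omit hl in
theorem rD_self : rD l l = l - 1 := if_neg (by omega)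
theorem rD_last : rD l (2 * l - 1) = 2 * l - 2 := by rw [rD, if_neg (by omega)]; omega

omit hl in
theorem pD_ge_zero {k : ℕ} (hk : ¬ k < 2 * l - 2) :
    pD w l 0 k = (1 / (2 * (l : ℂ) - 2)) * (((l : ℂ) - 1) * (1 / 2)) := by
  rw [pD, if_neg hk, if_pos rfl]

theorem pD_ge_pred {k : ℕ} (hk : ¬ k < 2 * l - 2) :
    pD w l (l - 1) k = (1 / (2 * (l : ℂ) - 2)) * (((l : ℂ) - 1) * (gamEig l k / Complex.I)) := by
  rw [pD, if_neg hk, if_neg (by omega), if_pos rfl, gamEig, if_neg hk]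

theorem pD_ge_self {k : ℕ} (hk : ¬ k < 2 * l - 2) :
    pD w l l k = (1 / (2 * (l : ℂ) - 2)) * (((l : ℂ) - 1) * (-gamEig l k / (2 * Complex.I))) := by
  rw [pD, if_neg hk, if_neg (by omega), if_neg (by omega), if_pos rfl, gamEig, if_neg hk]

theorem pD_ge_last {k : ℕ} (hk : ¬ k < 2 * l - 2) :
    pD w l (2 * l - 1) k = (1 / (2 * (l : ℂ) - 2)) * (((l : ℂ) - 1) * (-1)) := by
  rw [pD, if_neg hk, if_neg (by omega), if_neg (by omega), if_neg (by omega), if_pos rfl]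

omit hl in
theorem pD_ge_other {a k : ℕ} (hk : ¬ k < 2 * l - 2) (h0 : a ≠ 0) (h1 : a ≠ l - 1)
    (h2 : a ≠ l) (h3 : a ≠ 2 * l - 1) : pD w l a k = 0 := by
  rw [pD, if_neg hk, if_neg h0, if_neg h1, if_neg h2, if_neg h3, mul_zero, mul_zero]

omit hl in
theorem pD_lt {a k : ℕ} (hk : k < 2 * l - 2) : pD w l a k = (1 / (2 * (l : ℂ) - 2)) *
    ((if a = 0 ∨ a = l then 1 / 2 else 1) * (w ^ (k * rD l a))⁻¹) := by
  rw [pD, if_pos hk]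

theorem pD_lt_last {k : ℕ} (hw : w ^ (2 * l - 2) = 1) (hk : k < 2 * l - 2) :
    pD w l (2 * l - 1) k = (1 / (2 * (l : ℂ) - 2)) := by
  rw [pD_lt hk, if_neg (by omega), rD_last hl, mul_comm k, pow_mul, hw]
  simp

theorem pD_lt_zero {k : ℕ} (hk : k < 2 * l - 2) :
    pD w l 0 k = (1 / (2 * (l : ℂ) - 2)) * (1 / 2) := by
  rw [pD_lt hk, if_pos (by omega), rD_zero hl]
  simp

theorem pD_lt_pred {k : ℕ} (hk : k < 2 * l - 2) :
    pD w l (l - 1) k = (1 / (2 * (l : ℂ) - 2)) * (w ^ (k * (l - 1)))⁻¹ := by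
  rw [pD_lt hk, if_neg (by omega), rD_pred hl, one_mul]

omit hl in
theorem pD_lt_self {k : ℕ} (hk : k < 2 * l - 2) :
    pD w l l k = (1 / (2 * (l : ℂ) - 2)) * (1 / 2 * (w ^ (k * (l - 1)))⁻¹) := by
  rw [pD_lt hk, if_pos (by omega), rD_self]

theorem two_mul_sub_two_ne_zero : (2 * (l : ℂ) - 2) ≠ 0 := by
  have h : ((2 * l - 2 : ℕ) : ℂ) ≠ 0 := by exact_mod_cast (by omega : 2 * l - 2 ≠ 0)
  rwa [Nat.cast_sub (by omega), Nat.cast_mul, Nat.cast_ofNat] at h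

/-- On the first `2 * l - 2` columns, row `0` is proportional to row `2 * l - 1`, and row `l - 1` to
row `l`. The first pair kills the sum of the last two coordinates, the second pair their difference;
a Vandermonde system remains. -/
theorem pD_injective (hw : IsPrimitiveRoot w (2 * l - 2)) (v : ℕ → ℂ)
    (hv : ∀ a < 2 * l, ∑ k ∈ Finset.range (2 * l), pD w l a k * v k = 0) :
    ∀ k < 2 * l, v k = 0 := by
  have hc := two_mul_sub_two_ne_zero hl
  have hl1 : (l : ℂ) - 1 ≠ 0 := fun h => hc (by linear_combination 2 * h)
  have hsz : 2 * l = 2 * l - 2 + 1 + 1 := by omega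
  have hg1 : gamEig l (2 * l - 2) = -1 := by simp [gamEig]
  have hg2 : gamEig l (2 * l - 2 + 1) = 1 := by simp [gamEig]
  have hn1 : ¬ (2 * l - 2 < 2 * l - 2) := lt_irrefl _
  have hn2 : ¬ (2 * l - 2 + 1 < 2 * l - 2) := by omega
  have hv' : ∀ a < 2 * l, (∑ k ∈ Finset.range (2 * l - 2), pD w l a k * v k) +
      pD w l a (2 * l - 2) * v (2 * l - 2) + pD w l a (2 * l - 2 + 1) * v (2 * l - 2 + 1) = 0 := by
    intro a ha
    have := hv a ha
    rwa [show Finset.range (2 * l) = Finset.range (2 * l - 2 + 1 + 1) by rw [← hsz],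
      Finset.sum_range_succ, Finset.sum_range_succ] at this
  have h0 := hv' 0 (by omega)
  have h1 := hv' (2 * l - 1) (by omega)
  have h2 := hv' (l - 1) (by omega)
  have h3 := hv' l (by omega)
  rw [pD_ge_zero hn1, pD_ge_zero hn2, Finset.sum_congr rfl fun k hk => by
    rw [pD_lt_zero hl (Finset.mem_range.mp hk), mul_comm _ (1 / 2 : ℂ), mul_assoc],
    ← Finset.mul_sum] at h0
  rw [pD_ge_last hl hn1, pD_ge_last hl hn2, Finset.sum_congr rfl fun k hk => by
    rw [pD_lt_last hl hw.pow_eq_one (Finset.mem_range.mp hk)]] at h1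
  rw [pD_ge_pred hl hn1, pD_ge_pred hl hn2, Finset.sum_congr rfl fun k hk => by
    rw [pD_lt_pred hl (Finset.mem_range.mp hk)]] at h2
  rw [pD_ge_self hl hn1, pD_ge_self hl hn2, Finset.sum_congr rfl fun k hk => by
    rw [pD_lt_self (Finset.mem_range.mp hk), mul_left_comm, mul_assoc], ← Finset.mul_sum] at h3
  rw [hg1, hg2] at h2 h3
  have hI := Complex.I_ne_zero
  have e1 : v (2 * l - 2) + v (2 * l - 2 + 1) = 0 := by
    have : (1 / (2 * (l : ℂ) - 2)) * ((l : ℂ) - 1) * (v (2 * l - 2) + v (2 * l - 2 + 1)) = 0 := by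
      linear_combination h0 - h1 / 2
    exact (mul_eq_zero.mp this).resolve_left (mul_ne_zero (one_div_ne_zero hc) hl1)
  have e2 : v (2 * l - 2 + 1) - v (2 * l - 2) = 0 := by
    have : (1 / (2 * (l : ℂ) - 2)) * ((l : ℂ) - 1) * (1 / Complex.I) *
        (v (2 * l - 2 + 1) - v (2 * l - 2)) = 0 := by
      field_simp at h2 h3 ⊢
      linear_combination (h2 - h3) / 2
    exact (mul_eq_zero.mp this).resolve_left
      (mul_ne_zero (mul_ne_zero (one_div_ne_zero hc) hl1) (one_div_ne_zero hI))
  have e3 : v (2 * l - 2) = 0 := by linear_combination (e1 - e2) / 2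
  have e4 : v (2 * l - 2 + 1) = 0 := by linear_combination (e1 + e2) / 2
  have e5 := eq_zero_of_sum_root hw v (by
    intro r hr
    rcases Nat.eq_zero_or_pos r with rfl | hr0
    · simp only [e3, e4, mul_zero, add_zero] at h1
      rw [← Finset.mul_sum] at h1
      simpa using (mul_eq_zero.mp h1).resolve_left (one_div_ne_zero hc)
    · have key : ∀ a < 2 * l, a ≠ 0 → a ≠ l → rD l a = r →
          ∑ k ∈ Finset.range (2 * l - 2), (w ^ (k * r))⁻¹ * v k = 0 := by
        intro a ha ha0 hal har
        have h6 := hv' a ha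
        simp only [e3, e4, mul_zero, add_zero] at h6
        rw [Finset.sum_congr rfl fun k hk => by
          rw [pD_lt (Finset.mem_range.mp hk), if_neg (by omega), one_mul, har, mul_assoc],
          ← Finset.mul_sum] at h6
        exact (mul_eq_zero.mp h6).resolve_left (one_div_ne_zero hc)
      by_cases hrl : r < l
      · exact key r (by omega) hr0.ne' hrl.ne (if_pos hrl)
      · exact key (r + 1) (by omega) (by omega) (by omega) (by rw [rD, if_neg (by omega)]; omega))
  intro k hk
  by_cases hk1 : k < 2 * l - 2
  · exact e5 k hk1
  · by_cases hk2 : k = 2 * l - 2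
    · rw [hk2, e3]
    · rw [show k = 2 * l - 2 + 1 by omega, e4]

/-- The last two columns lie in the kernel of `Λ`, and rows `l - 1` and `l` have the same degree;
this is why the shift has exceptions in the middle as well as at the top. -/
theorem pD_eigenvector (X : AffType) (hcox : X.cox = 2 * l - 2) (a k : ℕ) (ha : a < 2 * l) :
    (if a = 0 then mono (2 * l - 2) (1 / 2) *
        mono (-(rD l (2 * l - 2) : ℤ)) (pD X.omega l (2 * l - 2) k)
      else if a = 1 then mono (2 * l - 2) (1 / 2) *
        mono (-(rD l (2 * l - 1) : ℤ)) (pD X.omega l (2 * l - 1) k) +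
          mono (-(rD l 0 : ℤ)) (pD X.omega l 0 k)
      else if a = l then mono 0 (1 / 2) * mono (-(rD l (l - 2) : ℤ)) (pD X.omega l (l - 2) k)
      else if a = l + 1 then mono (-(rD l l : ℤ)) (pD X.omega l l k) +
        mono 0 (1 / 2) * mono (-(rD l (l - 1) : ℤ)) (pD X.omega l (l - 1) k)
      else mono (-(rD l (a - 1) : ℤ)) (pD X.omega l (a - 1) k)) =
    mono (-(rD l a : ℤ)) (pD X.omega l a k) * mono 1 (X.lamEig k) := by
  have hc := two_mul_sub_two_ne_zero hl
  have hw : X.omega ^ (2 * l - 2) = 1 := hcox ▸ X.omega_isPrimitiveRoot.pow_eq_one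
  have r1 : rD l (2 * l - 2) = 2 * l - 3 := by rw [rD, if_neg (by omega)]; omega
  have r2 : rD l (l - 2) = l - 2 := if_pos (by omega)
  have r3 : rD l (l + 1) = l := by rw [rD, if_neg (by omega)]; omega
  have r4 : rD l 1 = 1 := if_pos (by omega)
  simp only [mono_mul_mono, lamEig, hcox]
  by_cases hk : k < 2 * l - 2
  · rw [if_pos hk]
    split_ifs with h1 h2 h3 h4
    · rw [h1, pD_lt_zero hl hk, pD_lt hk, if_neg (by omega), r1, rD_zero hl,
        X.omega_pow_inv_last (a := 2 * l - 3) (by omega)]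
      exact mono_congr (by push_cast [(by omega : 3 ≤ 2 * l)]; ring) (by ring)
    · have h8 := X.omega_pow_inv_mul 0 k
      rw [zero_add, mul_one, mul_zero, pow_zero, inv_one] at h8
      rw [h2, pD_lt_zero hl hk, pD_lt_last hl hw hk, pD_lt hk, if_neg (by omega), rD_last hl,
        rD_zero hl, r4, mul_one, one_mul, mul_assoc _ _ (X.omega ^ k), h8]
      rw [mono_add_mono (k := 0) (by push_cast [(by omega : 2 ≤ 2 * l)]; ring) (by simp)]
      exact mono_congr (by simp) (by ring)
    · have h8 := X.omega_pow_inv_mul (l - 2) k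
      rw [show l - 2 + 1 = l - 1 by omega] at h8
      rw [h3, pD_lt_self hk, pD_lt hk, if_neg (by omega), r2, rD_self, mul_assoc, mul_assoc,
        h8]
      exact mono_congr (by push_cast [(by omega : 2 ≤ l), (by omega : 1 ≤ l)]; ring) (by ring)
    · have h8 := X.omega_pow_inv_mul (l - 1) k
      rw [show l - 1 + 1 = l by omega] at h8
      rw [h4, pD_lt_self hk, pD_lt_pred hl hk, pD_lt hk, if_neg (by omega), r3, rD_self,
        rD_pred hl, one_mul, mul_assoc _ _ (X.omega ^ k), h8]
      rw [mono_add_mono (k := -((l - 1 : ℕ) : ℤ)) rfl (by ring)]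
      exact mono_congr (by push_cast [(by omega : 1 ≤ l)]; ring) (by ring)
    · have hr : rD l a = rD l (a - 1) + 1 := by
        simp only [rD]
        split_ifs <;> omega
      rw [pD_lt hk, pD_lt hk, if_neg (by omega), if_neg (by omega), one_mul, one_mul, hr,
        mul_assoc, X.omega_pow_inv_mul]
      exact mono_congr (by push_cast; ring) rfl
  · rw [if_neg hk, mul_zero, mono_zero_right]
    split_ifs with h1 h2 h3 h4
    · rw [pD_ge_other hk (by omega) (by omega) (by omega) (by omega), mul_zero, mono_zero_right]
    · rw [pD_ge_zero hk, pD_ge_last hl hk, rD_last hl, rD_zero hl,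
        mono_add_mono (k := 0) (by push_cast [(by omega : 2 ≤ 2 * l)]; ring) (by simp)]
      rw [← mono_zero_right 0]
      exact mono_congr rfl (by ring)
    · rw [pD_ge_other hk (by omega) (by omega) (by omega) (by omega), mul_zero, mono_zero_right]
    · rw [pD_ge_self hl hk, pD_ge_pred hl hk, rD_self, rD_pred hl,
        mono_add_mono (k := -((l - 1 : ℕ) : ℤ)) rfl (by ring), ← mono_zero_right 0]
      rw [mono_zero_right, ← mono_zero_right (-((l - 1 : ℕ) : ℤ))]
      refine mono_congr rfl ?_
      have hI := Complex.I_ne_zero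
      field_simp
      ring
    · rw [pD_ge_other hk (by omega) (by omega) (by omega) (by omega), mono_zero_right]

end

theorem rowAct_sub (X : AffType) (V : ℕ → Loop) (k : ℤ) (M N : X.CMat) (p : Fin X.size) :
    X.rowAct V k (M - N) p = X.rowAct V k M p - X.rowAct V k N p := by
  rw [eq_sub_iff_add_eq, ← rowAct_add, sub_add_cancel]

theorem gam_mul_P_D (l : ℕ) (hl : 4 ≤ l) (ho : Odd l) (V : ℕ → ℕ → Loop)
    (hV : ∀ a k : Fin (D l hl ho).size, (D l hl ho).P a k = V (a + 1) k)
    (p q : Fin (D l hl ho).size) :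
    ((Gam l hl ho).map (substPow _ (D l hl ho).cox_pos) * (D l hl ho).P) p q =
      if (p : ℕ) = 0 then mono (2 * l - 2) (-(Complex.I / 2)) * V (l + 1) q +
        mono (2 * l - 2) (Complex.I / 4) * V l q
      else if (p : ℕ) = l - 1 then mono 0 (-Complex.I) * V 1 q +
        mono (2 * l - 2) (Complex.I / 2) * V (2 * l) q
      else if (p : ℕ) = l then mono 0 (Complex.I / 2) * V 1 q +
        mono (2 * l - 2) (-(Complex.I / 4)) * V (2 * l) q
      else if (p : ℕ) = 2 * l - 1 then mono 0 Complex.I * V (l + 1) q +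
        mono 0 (-(Complex.I / 2)) * V l q
      else 0 := by
  have hsz : (D l hl ho).size = 2 * l := rfl
  have hp : (p : ℕ) < 2 * l := p.2
  have hc : ((D l hl ho).cox : ℤ) = 2 * l - 2 := by simp only [cox]; omega
  have hm : ∀ M N : (D l hl ho).LMat, (M + N).map (substPow _ (D l hl ho).cox_pos) =
      M.map (substPow _ (D l hl ho).cox_pos) + N.map (substPow _ (D l hl ho).cox_pos) :=
    fun M N => map_add (substPow _ (D l hl ho).cox_pos).mapMatrix M N
  have hu : ∀ k a b, 1 ≤ b → b ≤ 2 * l →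
      (D l hl ho).rowAct (fun s => V s q) k ((D l hl ho).unit a b) p =
      if (p : ℕ) + 1 = a then mono k 1 * V b q else 0 := fun k a b hb hb' =>
        (D l hl ho).rowAct_unit _ k a b hb hb' p
  rw [Gam, hm, add_mul, Matrix.add_apply, monoMat_map_substPow, monoMat_map_substPow,
    (D l hl ho).monoMat_mul_apply V _ hV, (D l hl ho).monoMat_mul_apply V _ hV, ho.neg_one_pow,
    hc, mul_zero, mul_one]
  simp only [rowAct_add, rowAct_sub, rowAct_smul]
  rw [hu _ _ 1 (by omega) (by omega), hu _ _ 1 (by omega) (by omega),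
    hu _ _ (l + 1) (by omega) (by omega), hu _ _ l (by omega) (by omega),
    hu _ _ (2 * l) (by omega) (by omega), hu _ _ (2 * l) (by omega) (by omega),
    hu _ _ (l + 1) (by omega) (by omega), hu _ _ l (by omega) (by omega)]
  have hmm : ∀ (k : ℤ) (c d : ℂ) (f : Loop), mono 0 c * (mono k d * f) = mono k (c * d) * f := by
    intro k c d f
    rw [← mul_assoc, mono_mul_mono, zero_add]
  have hneg : ∀ (k : ℤ) (c : ℂ) (f : Loop), -(mono k c * f) = mono k (-c) * f := by
    intro k c f
    refine neg_eq_of_add_eq_zero_right ?_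
    rw [← add_mul, ← mono_add, add_neg_cancel, mono_zero_right, zero_mul]
  by_cases h0 : (p : ℕ) = 0
  · rw [if_neg (by omega), if_neg (by omega), if_neg (by omega), if_neg (by omega),
      if_neg (by omega), if_neg (by omega), if_pos (by omega), if_pos (by omega), if_pos h0]
    simp only [mul_zero, sub_zero, add_zero, zero_add, mul_add, hmm]
    congr 3 <;> ring_nf
  by_cases h1 : (p : ℕ) = l - 1
  · rw [if_pos (by omega), if_neg (by omega), if_neg (by omega), if_neg (by omega),
      if_pos (by omega), if_neg (by omega), if_neg (by omega), if_neg (by omega), if_neg h0,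
      if_pos h1]
    simp only [mul_zero, sub_zero, add_zero, hmm]
    congr 3 <;> ring_nf
  by_cases h2 : (p : ℕ) = l
  · rw [if_neg (by omega), if_pos (by omega), if_neg (by omega), if_neg (by omega),
      if_neg (by omega), if_pos (by omega), if_neg (by omega), if_neg (by omega), if_neg h0,
      if_neg h1, if_pos h2]
    simp only [mul_zero, sub_zero, add_zero, zero_sub, mul_add, hmm, hneg]
    congr 3 <;> ring_nf
  by_cases h3 : (p : ℕ) = 2 * l - 1
  · rw [if_neg (by omega), if_neg (by omega), if_pos (by omega), if_pos (by omega),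
      if_neg (by omega), if_neg (by omega), if_neg (by omega), if_neg (by omega), if_neg h0,
      if_neg h1, if_neg h2, if_pos h3]
    simp only [mul_zero, neg_zero, add_zero, zero_add, mul_add, hmm, sub_eq_add_neg, hneg]
    congr 3 <;> ring_nf
  rw [if_neg (by omega), if_neg (by omega), if_neg (by omega), if_neg (by omega),
      if_neg (by omega), if_neg (by omega), if_neg (by omega), if_neg (by omega), if_neg h0,
      if_neg h1, if_neg h2, if_neg h3]
  simp

/-- `Γ` is complementary to `Λ`: it kills the columns on which `Λ` is invertible, and acts by
opposite signs times `ζ ^ (l - 1)` on the two columns in the kernel of `Λ`. -/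
theorem gam_eigenvector {w : ℂ} {l : ℕ} (hl : 4 ≤ l) (hw : w ^ (2 * l - 2) = 1) (a k : ℕ)
    (ha : a < 2 * l) :
    (if a = 0 then mono (2 * l - 2) (-(Complex.I / 2)) * mono (-(rD l l : ℤ)) (pD w l l k) +
        mono (2 * l - 2) (Complex.I / 4) * mono (-(rD l (l - 1) : ℤ)) (pD w l (l - 1) k)
      else if a = l - 1 then mono 0 (-Complex.I) * mono (-(rD l 0 : ℤ)) (pD w l 0 k) +
        mono (2 * l - 2) (Complex.I / 2) * mono (-(rD l (2 * l - 1) : ℤ)) (pD w l (2 * l - 1) k)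
      else if a = l then mono 0 (Complex.I / 2) * mono (-(rD l 0 : ℤ)) (pD w l 0 k) +
        mono (2 * l - 2) (-(Complex.I / 4)) * mono (-(rD l (2 * l - 1) : ℤ)) (pD w l (2 * l - 1) k)
      else if a = 2 * l - 1 then mono 0 Complex.I * mono (-(rD l l : ℤ)) (pD w l l k) +
        mono 0 (-(Complex.I / 2)) * mono (-(rD l (l - 1) : ℤ)) (pD w l (l - 1) k)
      else 0) = mono (-(rD l a : ℤ)) (pD w l a k) * mono (l - 1 : ℕ) (gamEig l k) := by
  have hI := Complex.I_ne_zero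
  have hI2 := Complex.I_sq
  have e1 : (2 * (l : ℤ) - 2) + -((l - 1 : ℕ) : ℤ) = (l - 1 : ℕ) := by omega
  have e2 : (2 * (l : ℤ) - 2) + -((2 * l - 2 : ℕ) : ℤ) = 0 := by omega
  have e3 : (0 : ℤ) + -((0 : ℕ) : ℤ) = 0 := rfl
  have e4 : (0 : ℤ) + -((l - 1 : ℕ) : ℤ) = -(l - 1 : ℕ) := zero_add _
  simp only [mono_mul_mono, rD_zero hl, rD_pred hl, rD_self, rD_last hl]
  by_cases hk : k < 2 * l - 2
  · have hg : gamEig l k = 0 := if_pos hk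
    rw [hg, mul_zero, mono_zero_right, pD_lt_zero hl hk, pD_lt_last hl hw hk, pD_lt_pred hl hk,
      pD_lt_self hk]
    split_ifs
    · rw [mono_add_mono e1 e1, ← mono_zero_right (l - 1 : ℕ)]
      exact mono_congr rfl (by ring)
    · rw [mono_add_mono e3 e2, ← mono_zero_right 0]
      exact mono_congr rfl (by ring)
    · rw [mono_add_mono e3 e2, ← mono_zero_right 0]
      exact mono_congr rfl (by ring)
    · rw [mono_add_mono e4 e4, ← mono_zero_right (-((l - 1 : ℕ) : ℤ))]
      exact mono_congr rfl (by ring)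
    · rfl
  · have hg2 : gamEig l k * gamEig l k = 1 := by
      rw [gamEig, if_neg hk]
      split_ifs <;> ring
    have hIi : (1 : ℂ) / Complex.I = -Complex.I := by rw [one_div, Complex.inv_I]
    split_ifs with h0 h1 h2 h3
    · rw [h0, rD_zero hl, pD_ge_zero hk, pD_ge_pred hl hk, pD_ge_self hl hk,
        mono_add_mono e1 e1]
      refine mono_congr (by simp) ?_
      field_simp
      ring
    · rw [h1, rD_pred hl, pD_ge_zero hk, pD_ge_pred hl hk, pD_ge_last hl hk,
        mono_add_mono e3 e2]
      refine mono_congr (by simp) ?_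
      rw [div_eq_mul_one_div (gamEig l k), hIi]
      linear_combination (1 / (2 * (l : ℂ) - 2)) * ((l : ℂ) - 1) * Complex.I * hg2
    · rw [h2, rD_self, pD_ge_zero hk, pD_ge_self hl hk, pD_ge_last hl hk,
        mono_add_mono e3 e2]
      refine mono_congr (by simp) ?_
      have : -gamEig l k / (2 * Complex.I) = gamEig l k * Complex.I / 2 := by
        rw [mul_comm 2, ← div_div, div_eq_mul_one_div (-gamEig l k), hIi]
        ring
      rw [this]
      linear_combination (-(1 / (2 * (l : ℂ) - 2)) * ((l : ℂ) - 1) * Complex.I / 2) * hg2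
    · rw [h3, rD_last hl, pD_ge_pred hl hk, pD_ge_self hl hk, pD_ge_last hl hk,
        mono_add_mono e4 e4]
      refine mono_congr (by omega) ?_
      field_simp
      ring
    · rw [pD_ge_other hk h0 h1 h2 h3, zero_mul, mono_zero_right]

theorem diagData_D (l : ℕ) (hl : 4 ≤ l) (ho : Odd l) : ∃ r d, (D l hl ho).DiagData r d := by
  set X := D l hl ho with hX
  have hsz : X.size = 2 * l := rfl
  have hcox : X.cox = 2 * l - 2 := rfl
  have hw : X.omega ^ (2 * l - 2) = 1 := hcox ▸ X.omega_isPrimitiveRoot.pow_eq_one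
  have hP : ∀ a k : Fin X.size, X.P a k = mono (-(rD l a : ℤ)) (pD X.omega l a k) :=
    fun a k => rfl
  have hlam : X.Lam.map (substPow X.cox X.cox_pos) * X.P =
      X.P * Matrix.diagonal (fun k : Fin X.size => mono 1 (X.lamEig k)) := by
    ext1 a k
    rw [lam_mul_P_D l hl ho (fun s q => mono (-(rD l (s - 1) : ℤ)) (pD X.omega l (s - 1) q)) hP,
      Matrix.mul_diagonal, hP, ← pD_eigenvector hl X hcox a k a.2]
    rfl
  have hgam : (Gam l hl ho).map (substPow X.cox X.cox_pos) * X.P =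
      X.P * Matrix.diagonal (fun k : Fin X.size => mono (l - 1 : ℕ) (gamEig l k)) := by
    ext1 a k
    rw [gam_mul_P_D l hl ho (fun s q => mono (-(rD l (s - 1) : ℤ)) (pD X.omega l (s - 1) q)) hP,
      Matrix.mul_diagonal, hP, ← gam_eigenvector hl hw a k a.2]
    rfl
  have hodd : ∀ j, Odd (j + X.cox) ↔ Odd j := by
    intro j
    have : Even (2 * l - 2) := ⟨l - 1, by omega⟩
    simp [hcox, Nat.odd_add, this]
  -- Even exponents are odd multiples `(2 s + 1) (l - 1)`, and an odd power of `0` or of a sign is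
  -- itself; so the eigenvalues of these `Λ_j` do not depend on `s`.
  have hgodd : ∀ k s, gamEig l k ^ (2 * s + 1) = gamEig l k := by
    intro k s
    unfold gamEig
    split_ifs
    · simp
    · rw [Odd.neg_one_pow ⟨s, rfl⟩]
    · simp
  have hsmall : ∀ a ∈ X.smallExp, Odd a ∨ ¬ Odd a ∧ a = l - 1 := by
    intro a ha
    rw [mem_smallExp] at ha
    rcases em (Odd a) with h | h
    · exact Or.inl h
    · refine Or.inr ⟨h, ?_⟩
      have h1 : a % (2 * l - 2) = l - 1 := ha.2.resolve_left h
      have h2 : a < 2 * l - 2 := ha.1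
      rwa [Nat.mod_eq_of_lt h2] at h1
  have hle : Odd l := ho
  rw [Nat.odd_iff] at hle
  refine ⟨fun a => rD l a, fun j k => if Odd j then X.nu * X.lamEig k ^ j
    else ((Real.sqrt (2 * (l : ℝ) - 2) : ℝ) : ℂ) * gamEig l k, ?_⟩
  refine
    { r_nonneg := fun a => Int.natCast_nonneg _
      r_le := fun a => ?_
      euler_P := X.euler_of_graded X.P (fun a => rD l a) _ hP
      isUnit_P := X.isUnit_det_of_graded X.P (fun a => rD l a) _ hP
        (pD_injective hl X.omega_isPrimitiveRoot)
      lam_mul_P := fun j hj => ?_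
      periodic := fun j hj => ?_
      orthogonal := fun a ha b hb => ?_ }
  · have : (a : ℕ) < 2 * l := a.2
    rw [hcox]
    simp only [rD]
    split_ifs <;> omega
  · by_cases h : Odd j
    · have h1 : X.LamJ j = X.nu • X.Lam ^ j := if_pos h
      simp only [if_pos h]
      rw [h1]
      apply smul_map_mul_of_diag
      simpa using X.map_pow_mul_of_diag X.Lam X.P _ 1 hlam j
    · have h1 : X.LamJ j = ((Real.sqrt (2 * (l : ℝ) - 2) : ℝ) : ℂ) • Gam l hl ho ^ (j / (l - 1)) :=
        if_neg h
      simp only [if_neg h]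
      rw [h1]
      apply smul_map_mul_of_diag
      have h2 : j % (2 * l - 2) = l - 1 := hj.resolve_left h
      have h3 := Nat.div_add_mod j (2 * l - 2)
      set s := j / (2 * l - 2)
      have h5 : j = (l - 1) * (2 * s + 1) := by
        rw [← h3, h2, show 2 * l - 2 = (l - 1) * 2 by omega]
        ring
      have h4 : j / (l - 1) = 2 * s + 1 := by
        rw [h5, Nat.mul_div_cancel_left _ (by omega)]
      have h6 := X.map_pow_mul_of_diag (Gam l hl ho) X.P _ _ hgam (2 * s + 1)
      rw [h4, h6]
      congr 2
      funext k
      refine mono_congr ?_ (hgodd _ _)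
      conv_rhs => rw [h5]
      push_cast
      ring
  · funext k
    simp only [hodd]
    split_ifs with h
    · rw [X.lamEig_pow_add _ (X.pos_of_mem_exponents hj)]
    · rfl
  · have hmix : ∀ (k : Fin X.size) (s : ℕ), 0 < s → X.lamEig k ^ s * gamEig l k = 0 := by
      intro k s hs
      unfold lamEig gamEig
      rw [hcox]
      split_ifs
      · rw [mul_zero]
      all_goals rw [zero_pow hs.ne', zero_mul]
    have ha0 := X.pos_of_mem_exponents (X.mem_smallExp.mp ha).2
    have hb0 := X.pos_of_mem_exponents (X.mem_smallExp.mp hb).2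
    rcases hsmall a ha with h1 | ⟨h1, h1'⟩ <;> rcases hsmall b hb with h2 | ⟨h2, h2'⟩
    · simp only [if_pos h1, if_pos h2]
      rw [← X.sum_lamEig_pow_small (by omega) ha hb, Finset.mul_sum]
      refine Finset.sum_congr rfl fun k _ => ?_
      have hn : X.kappa * X.nu ^ 2 = 1 := kappa_nu_sqrt_two
      rw [pow_add]
      linear_combination (X.lamEig k ^ a * X.lamEig k ^ b) * hn
    · simp only [if_pos h1, if_neg h2]
      rw [if_neg (by rw [hcox]; rw [Nat.odd_iff] at h1; omega), Finset.sum_eq_zero, mul_zero]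
      intro k _
      linear_combination (X.nu * ((Real.sqrt (2 * (l : ℝ) - 2) : ℝ) : ℂ)) * hmix k a ha0
    · simp only [if_neg h1, if_pos h2]
      rw [if_neg (by rw [hcox]; rw [Nat.odd_iff] at h2; omega), Finset.sum_eq_zero, mul_zero]
      intro k _
      linear_combination (X.nu * ((Real.sqrt (2 * (l : ℝ) - 2) : ℝ) : ℂ)) * hmix k b hb0
    · simp only [if_neg h1, if_neg h2]
      rw [if_pos (by rw [hcox]; omega)]
      have hsq : ((Real.sqrt (2 * (l : ℝ) - 2) : ℝ) : ℂ) ^ 2 = 2 * (l : ℂ) - 2 := by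
        have h4 : (4 : ℝ) ≤ l := by exact_mod_cast hl
        rw [← Complex.ofReal_pow, Real.sq_sqrt (by linarith)]
        push_cast
        ring
      -- The two signs contribute `2`, which `κ = 1 / 2` cancels; the normalization `√(2 l - 2)` of
      -- `Λ_{l-1}` supplies the factor `h`.
      have hsum : ∑ k : Fin X.size, gamEig l k ^ 2 = 2 := by
        rw [Fin.sum_univ_eq_sum_range (fun k => gamEig l k ^ 2), hsz,
          show Finset.range (2 * l) = Finset.range (2 * l - 2 + 1 + 1) by
            rw [show 2 * l - 2 + 1 + 1 = 2 * l by omega],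
          Finset.sum_range_succ, Finset.sum_range_succ, Finset.sum_eq_zero]
        · rw [show gamEig l (2 * l - 2) = -1 by simp [gamEig],
            show gamEig l (2 * l - 2 + 1) = 1 by simp [gamEig]]
          norm_num
        · intro k hk
          rw [Finset.mem_range] at hk
          rw [gamEig, if_pos (by omega)]
          simp
      have hk : X.kappa = 1 / 2 := rfl
      have h5 : ∀ k : Fin X.size, ((Real.sqrt (2 * (l : ℝ) - 2) : ℝ) : ℂ) * gamEig l k *
          (((Real.sqrt (2 * (l : ℝ) - 2) : ℝ) : ℂ) * gamEig l k) =
          (2 * (l : ℂ) - 2) * gamEig l k ^ 2 := by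
        intro k
        rw [← hsq]
        ring
      rw [Finset.sum_congr rfl fun k _ => h5 k, ← Finset.mul_sum, hsum, hk, hcox,
        Nat.cast_sub (by omega)]
      push_cast
      ring

theorem exists_diagData (X : AffType) : ∃ r d, X.DiagData r d := by
  cases X with
  | A l hl => exact diagData_A l hl
  | B l hl => exact diagData_B l hl
  | C l hl => exact diagData_C l hl
  | D l hl ho => exact diagData_D l hl ho
  | G => exact diagData_G

end AffType

end DrinfeldSokolov

namespace DrinfeldSokolov

section MatrixSMul

variable {R : Type*} [CommRing R] {n : Type*} [Fintype n] (c : R) (A B : Matrix n n R)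

theorem matrix_smul_mul : c • A * B = c • (A * B) := Matrix.smul_mul c A B

theorem matrix_mul_smul : A * c • B = c • (A * B) := Matrix.mul_smul A c B

theorem matrix_trace_smul : (c • A).trace = c * A.trace := Matrix.trace_smul c A

omit [Fintype n] in
theorem matrix_smul_diagonal [DecidableEq n] (f : n → R) :
    c • Matrix.diagonal f = Matrix.diagonal fun i => c * f i := (Matrix.diagonal_smul c f).symm

end MatrixSMul

namespace AffType

/-! ### Properties of the principal Heisenberg subalgebra -/

namespace DiagData

variable {X : AffType} {r : Fin X.size → ℤ} {d : ℕ → Fin X.size → ℂ} (h : X.DiagData r d)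

include h

theorem mul_P_cancel {A B : X.LMat} (hAB : A * X.P = B * X.P) : A = B := by
  have := congrArg (· * X.P⁻¹) hAB
  simpa only [mul_assoc, Matrix.mul_nonsing_inv _ h.isUnit_P, mul_one] using this

theorem map_lam {j : ℕ} (hj : j ∈ X.exponents) : (X.LamJ j).map (substPow X.cox X.cox_pos) =
    X.P * Matrix.diagonal (fun k => mono j (d j k)) * X.P⁻¹ := by
  apply h.mul_P_cancel
  rw [h.lam_mul_P j hj, mul_assoc, Matrix.nonsing_inv_mul _ h.isUnit_P, mul_one]

omit h in
theorem _root_.DrinfeldSokolov.matrix_map_substPow_injective {n : Type*} {k : ℕ} (hk : 0 < k) :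
    Function.Injective (fun M : Matrix n n Loop => M.map (substPow k hk)) :=
  Matrix.map_injective (substPow_injective k hk)

theorem map_lam_mul_map_lam {i j : ℕ} (hi : i ∈ X.exponents) (hj : j ∈ X.exponents) :
    (X.LamJ i).map (substPow X.cox X.cox_pos) * (X.LamJ j).map (substPow X.cox X.cox_pos) =
      X.P * Matrix.diagonal (fun k => mono (i + j) (d i k * d j k)) * X.P⁻¹ := by
  rw [h.map_lam hi, h.map_lam hj]
  simp only [← mul_assoc]
  rw [mul_assoc (X.P * _) X.P⁻¹ X.P, Matrix.nonsing_inv_mul _ h.isUnit_P, mul_one,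
    mul_assoc X.P, Matrix.diagonal_mul_diagonal]
  simp only [mono_mul_mono]

/-- Identities between the `Λ_j` may be tested after the injective substitution `z = ζ ^ h`, where
`P` diagonalizes all of them. -/
theorem commute_lam {i j : ℕ} (hi : i ∈ X.exponents) (hj : j ∈ X.exponents) :
    Commute (X.LamJ i) (X.LamJ j) := by
  apply matrix_map_substPow_injective X.cox_pos
  simp only [Matrix.map_mul]
  rw [h.map_lam_mul_map_lam hi hj, h.map_lam_mul_map_lam hj hi]
  simp only [add_comm, mul_comm]

theorem lam_add_cox {j : ℕ} (hj : j ∈ X.exponents) :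
    X.LamJ (j + X.cox) = mono 1 1 • X.LamJ j := by
  apply matrix_map_substPow_injective X.cox_pos
  have h1 : (mono 1 1 • X.LamJ j).map (substPow X.cox X.cox_pos) =
      mono X.cox 1 • (X.LamJ j).map (substPow X.cox X.cox_pos) := by
    ext1 a b
    rw [Matrix.map_apply, Matrix.smul_apply, Matrix.smul_apply, smul_eq_mul, map_mul,
      substPow_mono, mul_one, smul_eq_mul, Matrix.map_apply]
  beta_reduce
  rw [h1, h.map_lam hj, h.map_lam ((X.add_cox_mem_exponents j).mpr hj), ← matrix_smul_mul,
    ← matrix_mul_smul, matrix_smul_diagonal, h.periodic j hj]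
  congr 3
  funext k
  rw [mono_mul_mono, one_mul]
  push_cast
  rw [add_comm]

theorem lam_add_mul_cox {j : ℕ} (hj : j ∈ X.exponents) (N : ℕ) :
    j + N * X.cox ∈ X.exponents ∧ X.LamJ (j + N * X.cox) = mono N 1 • X.LamJ j := by
  induction N with
  | zero => simpa [mono_zero_one] using hj
  | succ N ih =>
    rw [add_mul, one_mul, ← add_assoc, h.lam_add_cox ih.1, ih.2, smul_smul, mono_mul_mono, one_mul,
      X.add_cox_mem_exponents]
    refine ⟨ih.1, ?_⟩
    push_cast
    rw [add_comm]

theorem trace_lam_mul_lam {a b : ℕ} (ha : a ∈ X.smallExp) (hb : b ∈ X.smallExp) :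
    X.kappa • (X.LamJ a * X.LamJ b).trace = if a + b = X.cox then mono 1 X.cox else 0 := by
  apply substPow_injective X.cox X.cox_pos
  have h1 : ∀ M : X.LMat, substPow X.cox X.cox_pos M.trace =
      (M.map (substPow X.cox X.cox_pos)).trace := fun M => AddMonoidHom.map_trace (substPow X.cox X.cox_pos).toAddMonoidHom M
  have h2 : (∑ k, mono (a + b) (d a k * d b k)) = mono (a + b) (∑ k, d a k * d b k) :=
    (map_sum (AddMonoidHom.mk' (mono (a + b)) (mono_add _)) _ _).symm
  rw [substPow_smul, h1, Matrix.map_mul,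
    h.map_lam_mul_map_lam (X.mem_smallExp.mp ha).2 (X.mem_smallExp.mp hb).2, Matrix.trace_mul_comm,
    ← mul_assoc, Matrix.nonsing_inv_mul _ h.isUnit_P, one_mul, Matrix.trace_diagonal, h2, smul_mono,
    h.orthogonal a ha b hb]
  split_ifs with h3
  · rw [substPow_mono, ← h3]
    push_cast
    rw [mul_one]
  · rw [mono_zero_right, map_zero]

/-- Homogeneity of degree `j` for the principal gradation, which combines the Euler operator with
the diagonal matrix of the degrees `r`. It follows by differentiating `Λ_j P = P diag(d_j ζ ^ j)`,
the Euler derivative of `P` being known. -/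
theorem euler_map_lam {j : ℕ} (hj : j ∈ X.exponents) :
    ((X.LamJ j).map (substPow X.cox X.cox_pos)).map euler =
      (X.LamJ j).map (substPow X.cox X.cox_pos) * Matrix.diagonal (fun a => mono 0 (r a)) -
      Matrix.diagonal (fun a => mono 0 (r a)) * (X.LamJ j).map (substPow X.cox X.cox_pos) +
      mono 0 j • (X.LamJ j).map (substPow X.cox X.cox_pos) := by
  apply h.mul_P_cancel
  have h1 := congrArg (fun M : X.LMat => M.map euler) (h.lam_mul_P j hj)
  beta_reduce at h1
  have h2 : (Matrix.diagonal (fun k => mono j (d j k))).map euler =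
      mono 0 j • Matrix.diagonal (fun k => mono j (d j k)) := by
    rw [Matrix.diagonal_map isDer_euler.zero, matrix_smul_diagonal]
    congr 1
    funext k
    rw [euler_mono, mono_mul_mono, zero_add]
    push_cast
    rfl
  rw [isDer_euler.matrix_mul, isDer_euler.matrix_mul, h.euler_P, h2, matrix_mul_smul,
    ← h.lam_mul_P j hj, Matrix.neg_mul, mul_assoc (Matrix.diagonal _), ← h.lam_mul_P j hj,
    Matrix.mul_neg] at h1
  rw [add_mul, sub_mul, matrix_smul_mul, mul_assoc, mul_assoc]
  rw [← sub_eq_add_neg, sub_eq_iff_eq_add] at h1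
  rw [h1]
  abel

/-- Homogeneity read entry by entry. For `0 < j < h` it leaves no power of `z` above the first, and
no diagonal entries, since `h` does not divide `j`. -/
theorem lam_coeff {j : ℕ} (hj : j ∈ X.exponents) (a b : Fin X.size) {k : ℤ}
    (hk : (X.LamJ j a b).coeff k ≠ 0) : -(X.cox * k) = j + r b - r a := by
  have h1 := congrFun (congrFun (h.euler_map_lam hj) a) b
  rw [Matrix.add_apply, Matrix.sub_apply, Matrix.mul_diagonal, Matrix.diagonal_mul,
    Matrix.smul_apply, smul_eq_mul, mul_comm _ (mono 0 (r b : ℂ))] at h1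
  simp only [Matrix.map_apply] at h1
  have h2 := congrArg (fun f : Loop => f.coeff (X.cox * k)) h1
  simp only [HahnSeries.coeff_add, HahnSeries.coeff_sub, mono_mul_coeff, add_zero, euler_coeff,
    substPow_coeff_mul] at h2
  have h3 : (-(X.cox * k : ℤ) : ℂ) = j + r b - r a := by
    apply mul_right_cancel₀ hk
    rw [h2]
    ring
  exact_mod_cast h3

theorem lam_small_coeff {j : ℕ} (hj : j ∈ X.smallExp) (a b : Fin X.size) {k : ℤ} (hk : k < -1) :
    (X.LamJ j a b).coeff k = 0 := by
  by_contra hne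
  rw [mem_smallExp] at hj
  have h1 := h.lam_coeff hj.2 a b hne
  have h2 := h.r_nonneg a
  have h3 := h.r_le b
  nlinarith

theorem lam_small_diag {j : ℕ} (hj : j ∈ X.smallExp) (a : Fin X.size) : X.LamJ j a a = 0 := by
  ext k
  by_contra hne
  rw [mem_smallExp] at hj
  have h1 := h.lam_coeff hj.2 a a hne
  have h2 := X.pos_of_mem_exponents hj.2
  have h3 : (X.cox : ℤ) ∣ j := ⟨-k, by linarith⟩
  exact absurd (Nat.le_of_dvd h2 (by exact_mod_cast h3)) (by omega)

/-- `Λ_n` and `Λ_a` commute, so the commutator term of `euler_map_lam` has zero trace against `Λ_a`;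
the factor `h` comes from `z = ζ ^ h`. -/
theorem cox_smul_trace_euler_lam_mul {n a : ℕ} (hn : n ∈ X.exponents) (ha : a ∈ X.exponents) :
    mono 0 X.cox * ((X.LamJ n).map euler * X.LamJ a).trace =
      mono 0 n * (X.LamJ n * X.LamJ a).trace := by
  apply substPow_injective X.cox X.cox_pos
  have h1 : ∀ M : X.LMat, substPow X.cox X.cox_pos M.trace =
      (M.map (substPow X.cox X.cox_pos)).trace := fun M => AddMonoidHom.map_trace (substPow X.cox X.cox_pos).toAddMonoidHom M
  have h2 : ((X.LamJ n).map (substPow X.cox X.cox_pos)).map euler =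
      mono 0 X.cox • ((X.LamJ n).map euler).map (substPow X.cox X.cox_pos) := by
    ext1 a b
    simp only [Matrix.map_apply, Matrix.smul_apply, euler_substPow, smul_eq_mul]
    ext k
    rw [mono_mul_coeff, loop_smul_coeff, add_zero]
  have h3 := h.commute_lam hn ha
  have h4 : (X.LamJ n).map (substPow X.cox X.cox_pos) * (X.LamJ a).map (substPow X.cox X.cox_pos) =
      (X.LamJ a).map (substPow X.cox X.cox_pos) * (X.LamJ n).map (substPow X.cox X.cox_pos) := by
    rw [← Matrix.map_mul, h3.eq, Matrix.map_mul]
  rw [map_mul, map_mul, substPow_mono, substPow_mono, mul_zero, h1, h1, Matrix.map_mul,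
    Matrix.map_mul, ← matrix_trace_smul, ← matrix_smul_mul, ← h2,
    h.euler_map_lam hn, add_mul, sub_mul, Matrix.trace_add, Matrix.trace_sub, matrix_smul_mul,
    matrix_trace_smul, mul_assoc, Matrix.trace_mul_comm, mul_assoc, ← h4, mul_assoc,
    sub_self, zero_add]

theorem trace_euler_lam_mul {a b : ℕ} (hb : b ∈ X.smallExp) (ha : a ∈ X.smallExp) (N : ℕ) :
    X.kappa • ((X.LamJ (b + N * X.cox)).map euler * X.LamJ a).trace =
      if a + b = X.cox then mono (N + 1) ((b + N * X.cox : ℕ) : ℂ) else 0 := by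
  have hb' := h.lam_add_mul_cox (X.mem_smallExp.mp hb).2 N
  have h1 := h.cox_smul_trace_euler_lam_mul hb'.1 (X.mem_smallExp.mp ha).2
  have hs : ∀ (c : ℂ) (f : Loop), c • f = mono 0 c * f := fun c f => by
    ext k
    rw [mono_mul_coeff, loop_smul_coeff, add_zero]
  have h2 := h.trace_lam_mul_lam hb ha
  have hc : mono 0 (X.cox : ℂ) ≠ 0 := by
    rw [← mono_zero_right 0]
    intro h
    exact X.cox_pos.ne' (by exact_mod_cast mono_injective 0 h)
  apply mul_left_cancel₀ hc
  rw [hs, mul_left_comm, h1, hb'.2, matrix_smul_mul, matrix_trace_smul]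
  rw [hs] at h2
  calc _ = mono 0 ((b + N * X.cox : ℕ) : ℂ) * mono N 1 *
        (mono 0 X.kappa * (X.LamJ b * X.LamJ a).trace) := by ring
    _ = _ := by
      rw [h2, add_comm b a]
      split_ifs
      · rw [mono_mul_mono, mono_mul_mono, mono_mul_mono, zero_add, zero_add, mul_one, mul_comm]
      · rw [mul_zero, mul_zero]

/-- The reason for the choice of `D`: conjugated by `P` it is a generating function of the `Λ_a`, so
no `P` remains in `K`. -/
theorem P_mul_bigD_mul_inv : X.P * X.bigD * X.P⁻¹ =
    ∑ a ∈ X.smallExp, mono (-(a : ℤ)) 1 • (X.LamJ a).map (substPow X.cox X.cox_pos) := by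
  rw [bigD, Finset.mul_sum, Finset.sum_mul]
  refine Finset.sum_congr rfl fun a _ => ?_
  rw [Dj, matrix_mul_smul, matrix_smul_mul, ← mul_assoc, ← mul_assoc,
    Matrix.mul_nonsing_inv _ h.isUnit_P, one_mul, mul_assoc, Matrix.mul_nonsing_inv _ h.isUnit_P,
    mul_one]

end DiagData

end AffType

end DrinfeldSokolov

/-! ### Filtrations by the order in `z⁻¹` and by the degree in the times -/

namespace DrinfeldSokolov

/-- A filtration given by predicates. -/
def RingFil.ofMem {A : Type*} [Ring A] [Algebra ℂ A] (p : ℤ → A → Prop)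
    (add : ∀ {n a b}, p n a → p n b → p n (a + b)) (zero : ∀ {n}, p n 0)
    (smul : ∀ {n} (c : ℂ) {a : A}, p n a → p n (c • a))
    (anti : ∀ {m n} {a : A}, m ≤ n → p n a → p m a)
    (mul : ∀ {m n} {a b : A}, p m a → p n b → p (m + n) (a * b)) (one : p 0 1)
    (sep : ∀ a : A, (∀ n : ℕ, p n a) → a = 0) : RingFil A where
  F n :=
    { carrier := {a | p n a}
      add_mem' := add
      zero_mem' := zero
      smul_mem' := fun c _ ha => smul c ha }
  anti _ _ h _ ha := anti h ha
  mul_mem := mul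
  one_mem := one
  sep := sep

/-- A linear endomorphism of an algebra. -/
def algLinearMap {A : Type*} [Ring A] [Algebra ℂ A] (f : A → A) (add : ∀ a b, f (a + b) = f a + f b)
    (smul : ∀ (c : ℂ) a, f (c • a) = c • f a) : A →ₗ[ℂ] A where
  toFun := f
  map_add' := add
  map_smul' := smul

theorem algLinearMap_apply {A : Type*} [Ring A] [Algebra ℂ A] (f : A → A) (add smul) (a : A) :
    algLinearMap f add smul a = f a := rfl

theorem matrix_trace_map {n R S F : Type*} [Fintype n] [AddCommMonoid R] [AddCommMonoid S]
    [FunLike F R S] [AddMonoidHomClass F R S] (f : F) (M : Matrix n n R) :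
    (M.map f).trace = f M.trace := by
  simp [Matrix.trace]

/-- The entrywise filtration on matrices. -/
def RingFil.matrix {R : Type*} [CommRing R] [Algebra ℂ R] (φ : RingFil R) (n : Type*) [Fintype n]
    [DecidableEq n] : RingFil (Matrix n n R) where
  F k :=
    { carrier := {M | ∀ a b, M a b ∈ φ.F k}
      add_mem' := fun hM hN a b => Submodule.add_mem _ (hM a b) (hN a b)
      zero_mem' := fun _ _ => Submodule.zero_mem _
      smul_mem' := fun c _ hM a b => Submodule.smul_mem _ c (hM a b) }
  anti _ _ h _ hM a b := φ.anti h (hM a b)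
  mul_mem hM hN a b := by
    rw [Matrix.mul_apply]
    exact Submodule.sum_mem _ fun c _ => φ.mul_mem (hM a c) (hN c b)
  one_mem a b := by
    rw [Matrix.one_apply]
    split_ifs
    · exact φ.one_mem
    · exact Submodule.zero_mem _
  sep M hM := by
    ext1 a b
    exact φ.sep _ fun n => hM n a b

theorem RingFil.trace_mem {R : Type*} [CommRing R] [Algebra ℂ R] (φ : RingFil R) {n : Type*}
    [Fintype n] [DecidableEq n] {k : ℤ} {M : Matrix n n R} (hM : M ∈ (φ.matrix n).F k) :
    M.trace ∈ φ.F k :=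
  Submodule.sum_mem _ fun a _ => hM a a

theorem loop_coeff_mul_eq_zero {f g : Loop} {m n : ℤ} (hf : ∀ k < m, f.coeff k = 0)
    (hg : ∀ k < n, g.coeff k = 0) {k : ℤ} (hk : k < m + n) : (f * g).coeff k = 0 := by
  rw [loop_coeff_mul]
  refine Finset.sum_eq_zero fun p hp => ?_
  have h3 : p.1 + p.2 = k := (Finset.mem_antidiagonal.mp hp).2.2
  by_cases h : p.1 < m
  · rw [hf _ h, zero_mul]
  · rw [hg _ (by omega), mul_zero]

namespace AffType

variable (X : AffType)

/-- The filtration of `X.TLoop` by the order in the inverse loop variable. -/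
def zFil : RingFil X.TLoop :=
  RingFil.ofMem (fun n f => ∀ d, ∀ k < n, (MvPowerSeries.coeff d f).coeff k = 0)
    (fun hf hg d k hk => by rw [map_add, HahnSeries.coeff_add, hf d k hk, hg d k hk, add_zero])
    (fun d k _ => by rw [map_zero, HahnSeries.coeff_zero])
    (fun c f hf d k hk => by rw [coeff_smul_TLoop, loop_smul_coeff, hf d k hk, mul_zero])
    (fun h hf d k hk => hf d k (hk.trans_le h))
    (fun {m n f g} hf hg d k hk => by
      classical
      rw [MvPowerSeries.coeff_mul, HahnSeries.coeff_sum]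
      exact Finset.sum_eq_zero fun p _ => loop_coeff_mul_eq_zero (hf p.1) (hg p.2) hk)
    (fun d k hk => by
      classical
      rw [MvPowerSeries.coeff_one]
      split_ifs
      · rw [HahnSeries.coeff_one, if_neg hk.ne]
      · rfl)
    (fun f hf => by
      ext d k
      rw [hf (k + 1).toNat d k (by omega), map_zero, HahnSeries.coeff_zero])

/-- The filtration of `X.TLoop` by the total degree in the times. -/
def tFil : RingFil X.TLoop :=
  RingFil.ofMem (fun n f => ∀ d : X.Idx →₀ ℕ, (d.degree : ℤ) < n → MvPowerSeries.coeff d f = 0)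
    (fun hf hg d hd => by rw [map_add, hf d hd, hg d hd, add_zero])
    (fun d _ => map_zero _)
    (fun c f hf d hd => by rw [coeff_smul_TLoop, hf d hd, smul_zero])
    (fun h hf d hd => hf d (hd.trans_le h))
    (fun {m n f g} hf hg d hd => by
      classical
      rw [MvPowerSeries.coeff_mul]
      refine Finset.sum_eq_zero fun p hp => ?_
      rw [Finset.HasAntidiagonal.mem_antidiagonal] at hp
      have h1 : d.degree = p.1.degree + p.2.degree := by rw [← hp, map_add]
      by_cases h : (p.1.degree : ℤ) < m
      · rw [hf _ h, zero_mul]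
      · rw [hg p.2 (by rw [h1] at hd; push_cast at hd; linarith), mul_zero])
    (fun d hd => absurd hd (not_lt.mpr (Int.natCast_nonneg _)))
    (fun f hf => by
      ext1 d
      rw [hf (d.degree + 1) d (by push_cast; linarith), map_zero])

/-- The Euler operator on matrices. -/
def eulerM (M : X.TMat) : X.TMat := M.map X.eulerT

theorem eulerM_add (M N : X.TMat) : X.eulerM (M + N) = X.eulerM M + X.eulerM N :=
  X.isDer_eulerT.matrix_add M N

theorem eulerM_smul (c : ℂ) (M : X.TMat) : X.eulerM (c • M) = c • X.eulerM M := by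
  ext1 a b
  exact X.eulerT_smul c (M a b)

theorem eulerM_apply (M : X.TMat) : X.eulerM M = M.map X.eulerT := rfl

theorem eulerM_mul (M N : X.TMat) : X.eulerM (M * N) = X.eulerM M * N + M * X.eulerM N :=
  X.isDer_eulerT.matrix_mul M N

theorem eulerM_mem_zFil {n : ℤ} {M : X.TMat} (hM : M ∈ (X.zFil.matrix _).F n) :
    X.eulerM M ∈ (X.zFil.matrix _).F n := fun a b d k hk => by
  rw [eulerM_apply, Matrix.map_apply, coeff_eulerT, euler_coeff, hM a b d k hk, mul_zero]

theorem eulerM_mem_tFil {n : ℤ} {M : X.TMat} (hM : M ∈ (X.tFil.matrix _).F n) :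
    X.eulerM M ∈ (X.tFil.matrix _).F n := fun a b d hd => by
  rw [eulerM_apply, Matrix.map_apply, coeff_eulerT, hM a b d hd, isDer_euler.zero]

/-! ### The dressing operator -/

variable {X}

/-- The ring homomorphism underlying `TMatNeg.toTMat`. -/
def negHom (X : AffType) : MvPowerSeries X.Idx (PowerSeries ℂ) →+* X.TLoop :=
  MvPowerSeries.map (HahnSeries.ofPowerSeries ℤ ℂ)

theorem toTMat_pow (Y : X.TMatNeg) (n : ℕ) : Y.toTMat ^ n = (Y ^ n).map X.negHom :=
  (Matrix.map_pow Y X.negHom n).symm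

theorem coeff_negHom_natCast (f : MvPowerSeries X.Idx (PowerSeries ℂ)) (d : X.Idx →₀ ℕ) (k : ℕ) :
    (MvPowerSeries.coeff d (X.negHom f)).coeff (k : ℤ) =
      PowerSeries.coeff k (MvPowerSeries.coeff d f) := by
  rw [negHom, MvPowerSeries.coeff_map]
  exact HahnSeries.ofPowerSeries_apply_coeff _ _

theorem coeff_negHom_neg (f : MvPowerSeries X.Idx (PowerSeries ℂ)) (d : X.Idx →₀ ℕ) {k : ℤ}
    (hk : k < 0) : (MvPowerSeries.coeff d (X.negHom f)).coeff k = 0 := by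
  rw [negHom, MvPowerSeries.coeff_map, HahnSeries.ofPowerSeries_apply]
  apply HahnSeries.embDomain_of_notMem_range
  rintro ⟨j, rfl⟩
  simp at hk
  omega

theorem map_negHom_mem_zFil (M : X.TMatNeg) : M.map X.negHom ∈ (X.zFil.matrix _).F 0 :=
  fun a b d _ hk => coeff_negHom_neg (M a b) d hk

theorem coeff_expNeg (Y : X.TMatNeg) (a b : Fin X.size) (d : X.Idx →₀ ℕ) (k : ℕ) :
    PowerSeries.coeff k (MvPowerSeries.coeff d (X.expNeg Y a b)) =
      ∑ n ∈ Finset.range (k + 1), ((n.factorial : ℂ)⁻¹) *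
        PowerSeries.coeff k (MvPowerSeries.coeff d ((Y ^ n) a b)) := by
  rw [← PowerSeries.coeff_mk k (fun k => ∑ n ∈ Finset.range (k + 1), ((n.factorial : ℂ)⁻¹) *
        PowerSeries.coeff k (MvPowerSeries.coeff d ((Y ^ n) a b)))]
  rfl

variable {Y : X.TMatNeg} (hY : X.IsNegative Y)

section

include hY

theorem toTMat_mem_zFil : Y.toTMat ∈ (X.zFil.matrix _).F 1 := by
  intro a b d k hk
  rcases lt_or_ge k 0 with h | h
  · exact coeff_negHom_neg _ d h
  · obtain rfl : k = ((0 : ℕ) : ℤ) := by push_cast; omega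
    exact (coeff_negHom_natCast _ d 0).trans ((hY d 0).2 rfl a b)

/-- `Y` has order at least one in `z⁻¹`, so `Y ^ n` does not reach `z ^ (-k)` for `n > k`; the
truncated sums defining `expNeg` are therefore the exponential for `zFil`. -/
theorem isExp_theta : (X.zFil.matrix _).IsExp Y.toTMat (X.Theta Y) := by
  intro N a b d k hk
  have hs : ∀ s : Finset ℕ, (MvPowerSeries.coeff d ((∑ n ∈ s,
      ((n.factorial : ℂ)⁻¹) • Y.toTMat ^ n) a b)).coeff k =
      ∑ n ∈ s, ((n.factorial : ℂ)⁻¹) *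
        (MvPowerSeries.coeff d ((Y.toTMat ^ n) a b)).coeff k := by
    intro s
    rw [Matrix.sum_apply, map_sum, HahnSeries.coeff_sum]
    refine Finset.sum_congr rfl fun n _ => ?_
    rw [Matrix.smul_apply, coeff_smul_TLoop, loop_smul_coeff]
  rw [Matrix.sub_apply, map_sub, HahnSeries.coeff_sub, hs, sub_eq_zero]
  rcases lt_or_ge k 0 with h | h
  · rw [Finset.sum_eq_zero]
    · exact coeff_negHom_neg _ d h
    · intro n _
      rw [toTMat_pow, Matrix.map_apply, coeff_negHom_neg _ d h, mul_zero]
  · lift k to ℕ using h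
    have h1 : (MvPowerSeries.coeff d (X.Theta Y a b)).coeff (k : ℤ) =
        PowerSeries.coeff k (MvPowerSeries.coeff d (X.expNeg Y a b)) :=
      coeff_negHom_natCast _ d k
    rw [h1, coeff_expNeg]
    simp only [toTMat_pow, Matrix.map_apply, coeff_negHom_natCast]
    refine Finset.sum_subset (Finset.range_subset_range.mpr (by omega)) fun n _ hn => ?_
    rw [Finset.mem_range] at hn
    have h3 := RingFil.pow_mem _ (toTMat_mem_zFil hY) n a b d k (by omega)
    rw [toTMat_pow, Matrix.map_apply, coeff_negHom_natCast] at h3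
    rw [h3, mul_zero]

omit hY in
-- At `z⁻¹ = 0` the defining sum is cut off after its term `n = 0`, so the matrix is the identity
-- there.
theorem isUnit_det_expNeg : IsUnit (X.expNeg Y).det := by
  rw [MvPowerSeries.isUnit_iff_constantCoeff, RingHom.map_det, PowerSeries.isUnit_iff_constantCoeff,
    RingHom.map_det]
  have : (PowerSeries.constantCoeff.mapMatrix
      (MvPowerSeries.constantCoeff.mapMatrix (X.expNeg Y)) : X.CMat) = 1 := by
    ext1 a b
    simp only [RingHom.mapMatrix_apply, Matrix.map_apply]
    rw [← PowerSeries.coeff_zero_eq_constantCoeff_apply,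
      ← MvPowerSeries.coeff_zero_eq_constantCoeff_apply, coeff_expNeg, zero_add, Finset.sum_range_one, pow_zero, Matrix.one_apply, Matrix.one_apply]
    split_ifs <;> simp
  rw [this, Matrix.det_one]
  exact isUnit_one

omit hY in
theorem isUnit_det_theta : IsUnit (X.Theta Y).det :=
  isUnit_det_map X.negHom isUnit_det_expNeg

omit hY in
theorem theta_mem_zFil : X.Theta Y ∈ (X.zFil.matrix _).F 0 :=
  map_negHom_mem_zFil (X.expNeg Y)

omit hY in
-- The inverse can be taken over power series in `z⁻¹`, before passing to Laurent series.
theorem theta_inv_mem_zFil : (X.Theta Y)⁻¹ ∈ (X.zFil.matrix _).F 0 := by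
  have h : (X.Theta Y)⁻¹ = (X.expNeg Y)⁻¹.map X.negHom :=
    (map_inv_of_isUnit X.negHom isUnit_det_expNeg).symm
  rw [h]
  exact map_negHom_mem_zFil _

end

/-! ### The vacuum wave function -/

/-- `∑ t_j Λ_j`. -/
def timeMat (X : AffType) : X.TMat := Matrix.of fun a b => X.linear fun j => X.LamJ j.1 a b

theorem coeff_linear_single (c : X.Idx → Loop) (j : X.Idx) :
    MvPowerSeries.coeff (Finsupp.single j 1) (X.linear c) = c j := by
  have h : MvPowerSeries.coeff (Finsupp.single j 1) (X.linear c) =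
    ∑ i ∈ (Finsupp.single j 1).support,
      if (Finsupp.single j 1 : X.Idx →₀ ℕ) = Finsupp.single i 1 then c i else 0 := rfl
  rw [h, Finset.sum_eq_single j, if_pos rfl]
  · exact fun i _ hi => if_neg fun h1 => hi (Finsupp.single_left_injective one_ne_zero h1).symm
  · intro hj
    simp at hj

theorem coeff_linear_of_ne (c : X.Idx → Loop) (d : X.Idx →₀ ℕ)
    (hd : ∀ j, d ≠ Finsupp.single j 1) : MvPowerSeries.coeff d (X.linear c) = 0 := by
  have h : MvPowerSeries.coeff d (X.linear c) =
    ∑ i ∈ d.support, if d = Finsupp.single i 1 then c i else 0 := rfl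
  rw [h]
  exact Finset.sum_eq_zero fun i _ => if_neg (hd i)

theorem linear_ext {f : X.TLoop} {c : X.Idx → Loop}
    (h1 : ∀ j, MvPowerSeries.coeff (Finsupp.single j 1) f = c j)
    (h2 : ∀ d : X.Idx →₀ ℕ, (∀ j, d ≠ Finsupp.single j 1) → MvPowerSeries.coeff d f = 0) :
    f = X.linear c := by
  ext1 d
  by_cases hd : ∃ j, d = Finsupp.single j 1
  · obtain ⟨j, rfl⟩ := hd
    rw [h1, coeff_linear_single]
  · push Not at hd
    rw [h2 d hd, coeff_linear_of_ne c d hd]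

theorem timeMat_mem_tFil : X.timeMat ∈ (X.tFil.matrix _).F 1 := by
  intro a b d hd
  refine coeff_linear_of_ne _ d fun j hj => ?_
  rw [hj, Finsupp.degree_single] at hd
  simp at hd

theorem isExp_g : (X.tFil.matrix _).IsExp X.timeMat X.g := by
  intro N a b d hd
  have hs : MvPowerSeries.coeff d ((∑ n ∈ Finset.range N,
      ((n.factorial : ℂ)⁻¹) • X.timeMat ^ n) a b) =
      ∑ n ∈ Finset.range N, ((n.factorial : ℂ)⁻¹) •
        MvPowerSeries.coeff d ((X.timeMat ^ n) a b) := by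
    rw [Matrix.sum_apply, map_sum]
    refine Finset.sum_congr rfl fun n _ => ?_
    rw [Matrix.smul_apply, coeff_smul_TLoop]
  have h1 : MvPowerSeries.coeff d (X.g a b) = ∑ n ∈ Finset.range (d.degree + 1),
      ((n.factorial : ℂ)⁻¹) • MvPowerSeries.coeff d ((X.timeMat ^ n) a b) := rfl
  rw [Matrix.sub_apply, map_sub, hs, sub_eq_zero, h1]
  refine Finset.sum_subset (Finset.range_subset_range.mpr (by omega)) fun n _ hn => ?_
  rw [Finset.mem_range] at hn
  rw [RingFil.pow_mem _ timeMat_mem_tFil n a b d (by omega), smul_zero]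

theorem isUnit_det_g : IsUnit X.g.det := by
  rw [MvPowerSeries.isUnit_iff_constantCoeff, RingHom.map_det]
  have : (MvPowerSeries.constantCoeff.mapMatrix X.g : X.LMat) = 1 := by
    ext1 a b
    have h1 := isExp_g (X := X) 1 a b 0 (by simp)
    rw [Finset.sum_range_one, pow_zero, Matrix.sub_apply, map_sub, sub_eq_zero] at h1
    rw [RingHom.mapMatrix_apply, Matrix.map_apply, ← MvPowerSeries.coeff_zero_eq_constantCoeff_apply,
      h1, Matrix.smul_apply, coeff_smul_TLoop, Matrix.one_apply, Matrix.one_apply]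
    split_ifs <;> simp
  rw [this, Matrix.det_one]
  exact isUnit_one

/-- No monomial has negative total degree in the times, so step `0` of `tFil` is everything. -/
theorem const_mem_tFil (M : X.LMat) : X.const M ∈ (X.tFil.matrix _).F 0 :=
  fun _ _ _ hd => absurd hd (not_lt.mpr (Int.natCast_nonneg _))

theorem const_mul (M N : X.LMat) : X.const (M * N) = X.const M * X.const N :=
  Matrix.map_mul (f := (MvPowerSeries.C : Loop →+* X.TLoop))

theorem coeff_mul_const (M : X.TMat) (N : X.LMat) (d : X.Idx →₀ ℕ) :
    (M * X.const N).map (MvPowerSeries.coeff d) = M.map (MvPowerSeries.coeff d) * N := by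
  ext1 a b
  simp only [Matrix.map_apply, Matrix.mul_apply, map_sum, const, MvPowerSeries.coeff_mul_C]

theorem coeff_const_mul (M : X.TMat) (N : X.LMat) (d : X.Idx →₀ ℕ) :
    (X.const N * M).map (MvPowerSeries.coeff d) = N * M.map (MvPowerSeries.coeff d) := by
  ext1 a b
  simp only [Matrix.map_apply, Matrix.mul_apply, map_sum, const, MvPowerSeries.coeff_C_mul]

theorem map_coeff_timeMat_single (j : X.Idx) :
    X.timeMat.map (MvPowerSeries.coeff (Finsupp.single j 1)) = X.LamJ j.1 := by
  ext1 a b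
  exact coeff_linear_single _ j

theorem map_coeff_timeMat_of_ne {d : X.Idx →₀ ℕ} (hd : ∀ j, d ≠ Finsupp.single j 1) :
    X.timeMat.map (MvPowerSeries.coeff d) = 0 := by
  ext1 a b
  exact coeff_linear_of_ne _ d hd

theorem tMat_ext {M N : X.TMat}
    (h : ∀ d, M.map (MvPowerSeries.coeff d) = N.map (MvPowerSeries.coeff d)) : M = N := by
  ext1 a b
  ext1 d
  exact congrFun (congrFun (h d) a) b

theorem commute_timeMat_const {r : Fin X.size → ℤ} {e : ℕ → Fin X.size → ℂ} (h : X.DiagData r e)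
    {a : ℕ} (ha : a ∈ X.exponents) : Commute X.timeMat (X.const (X.LamJ a)) := by
  apply tMat_ext
  intro d
  rw [coeff_mul_const, coeff_const_mul]
  by_cases hd : ∃ j, d = Finsupp.single j 1
  · obtain ⟨j, rfl⟩ := hd
    rw [map_coeff_timeMat_single]
    exact (h.commute_lam j.2 ha).eq
  · push Not at hd
    rw [map_coeff_timeMat_of_ne hd, zero_mul, mul_zero]

theorem commute_g_const {r : Fin X.size → ℤ} {e : ℕ → Fin X.size → ℂ} (h : X.DiagData r e)
    {a : ℕ} (ha : a ∈ X.exponents) : Commute X.g (X.const (X.LamJ a)) :=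
  isExp_g.commute (const_mem_tFil _) (commute_timeMat_const h ha)

/-- `g` is an exponential whose exponent commutes with `g⁻¹ Λ_a`, so under the trace the derivative
of the exponential reduces to that of the exponent. -/
theorem trace_euler_g {r : Fin X.size → ℤ} {e : ℕ → Fin X.size → ℂ} (h : X.DiagData r e)
    {a : ℕ} (ha : a ∈ X.exponents) :
    (X.eulerM X.g * X.g⁻¹ * X.const (X.LamJ a)).trace =
      X.linear fun j => ((X.LamJ j.1).map euler * X.LamJ a).trace := by
  have hg := isUnit_det_g (X := X)
  have hginv : X.g⁻¹ ∈ (X.tFil.matrix _).F 0 := fun _ _ _ hd => absurd hd (not_lt.mpr (Int.natCast_nonneg _))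
  have hM := timeMat_mem_tFil (X := X)
  have hgM : Commute X.g X.timeMat := isExp_g.commute hM (Commute.refl _)
  have hga := commute_g_const h ha
  have hgi : Commute X.timeMat X.g⁻¹ := by
    have h1 : X.g⁻¹ * (X.g * X.timeMat) * X.g⁻¹ = X.g⁻¹ * (X.timeMat * X.g) * X.g⁻¹ := by
      rw [hgM.eq]
    rwa [← mul_assoc, Matrix.nonsing_inv_mul _ hg, one_mul, mul_assoc, mul_assoc,
      Matrix.mul_nonsing_inv _ hg, mul_one] at h1
  have hMC : Commute X.timeMat (X.g⁻¹ * X.const (X.LamJ a)) :=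
    hgi.mul_right (commute_timeMat_const h ha)
  have hC : X.g⁻¹ * X.const (X.LamJ a) ∈ (X.tFil.matrix _).F 0 :=
    RingFil.mul_mem' _ (by simp) hginv (const_mem_tFil _)
  have h0 : (X.eulerM X.g * X.g⁻¹ * X.const (X.LamJ a)).trace =
      (X.eulerM X.timeMat * X.const (X.LamJ a)).trace := by
    ext1 d
    -- Truncating at `d.degree + 1` pushes the remainder beyond the coefficient of `t ^ d`.
    obtain ⟨R, hR, hT⟩ := isExp_g.trace_derivation hM (algLinearMap X.eulerM X.eulerM_add X.eulerM_smul)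
      X.eulerM_mul X.eulerM_mem_tFil
      (Matrix.traceAddMonoidHom _ _) Matrix.trace_mul_comm hC hMC (d.degree + 1)
    simp only [Matrix.traceAddMonoidHom_apply, algLinearMap_apply] at hT
    rw [mul_assoc, hT, map_add, RingFil.trace_mem _ hR d (by push_cast; linarith), add_zero,
      mul_assoc, Matrix.trace_mul_comm, mul_assoc, mul_assoc, ← hga.eq, ← mul_assoc X.g⁻¹,
      Matrix.nonsing_inv_mul _ hg, one_mul]
  rw [h0]
  have h1 : ∀ d, MvPowerSeries.coeff d (X.eulerM X.timeMat * X.const (X.LamJ a)).trace =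
      ((X.timeMat.map (MvPowerSeries.coeff d)).map euler * X.LamJ a).trace := by
    intro d
    have := congrArg Matrix.trace (coeff_mul_const (X.eulerM X.timeMat) (X.LamJ a) d)
    rw [matrix_trace_map] at this
    exact this
  apply linear_ext
  · intro j
    rw [h1, map_coeff_timeMat_single]
  · intro d hd
    rw [h1, map_coeff_timeMat_of_ne hd, Matrix.map_zero _ isDer_euler.zero, zero_mul,
      Matrix.trace_zero]

end AffType

end DrinfeldSokolov

/-! ### Iterated brackets, the central coordinate and the first derivatives of `log τ` -/

namespace DrinfeldSokolov

/-- The iterated bracket `[⋯[[x, M], M], ⋯, M]`. -/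
def iterBracket {A : Type*} [Ring A] [Algebra ℂ A] (M : A) (n : ℕ) (x : A) : A := (negAd M ^ n) x

theorem iterBracket_mem {A : Type*} [Ring A] [Algebra ℂ A] {φ : RingFil A} {M : A}
    (hM : M ∈ φ.F 1) {c : ℤ} {x : A} (hx : x ∈ φ.F c) (n : ℕ) : iterBracket M n x ∈ φ.F (n + c) :=
  RingFil.negAd_pow_mem hM hx n

theorem RingFil.IsExp.derivation_iterBracket {A : Type*} [Ring A] [Algebra ℂ A] {φ : RingFil A}
    {M E : A} (h : φ.IsExp M E) (hM : M ∈ φ.F 1) (δ : A → A) (hadd : ∀ a b, δ (a + b) = δ a + δ b)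
    (hsmul : ∀ (c : ℂ) a, δ (c • a) = c • δ a) (hδ : ∀ a b, δ (a * b) = δ a * b + a * δ b)
    (hδF : ∀ {n : ℤ} {a : A}, a ∈ φ.F n → δ a ∈ φ.F n) (N : ℕ) :
    δ E - E * ∑ n ∈ Finset.range N, (((n + 1).factorial : ℂ)⁻¹) • iterBracket M n (δ M) ∈ φ.F N :=
  h.derivation hM (algLinearMap δ hadd hsmul) hδ hδF N

/-- Invariance of the trace form: the adjoint action of `M` on one factor moves to the other one
with the opposite sign. -/
theorem trace_mul_iterBracket {R n : Type*} [CommRing R] [Algebra ℂ R] [Fintype n] [DecidableEq n]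
    (M x C : Matrix n n R) (k : ℕ) (f : ℕ → Matrix n n R) (h0 : f 0 = C)
    (hf : ∀ k, f (k + 1) = M * f k - f k * M) :
    (x * f k).trace = (iterBracket M k x * C).trace := by
  induction k generalizing x with
  | zero => simp [h0, iterBracket]
  | succ k ih =>
    rw [hf, iterBracket, pow_succ, Module.End.mul_apply, ← iterBracket, ← ih, negAd_apply, mul_sub,
      sub_mul, Matrix.trace_sub, Matrix.trace_sub, ← mul_assoc, ← mul_assoc,
      Matrix.trace_mul_comm (x * f k) M, mul_assoc M]

theorem trace_smul_mul {R n : Type*} [CommRing R] [Algebra ℂ R] [Fintype n] [DecidableEq n] (c : ℂ)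
    (A B : Matrix n n R) : (c • A * B).trace = c • (A * B).trace := by
  rw [smul_mul_assoc, Matrix.trace_smul]

namespace AffType

variable {X : AffType} {Y : X.TMatNeg} {r : Fin X.size → ℤ} {e : ℕ → Fin X.size → ℂ}

/-! ### The central coordinate -/

variable (X) in
-- The Euler operator kills the coefficient of `z ^ 0`, which gains one order.
theorem eulerM_mem_zFil_one {M : X.TMat} (hM : M ∈ (X.zFil.matrix _).F 0) :
    X.eulerM M ∈ (X.zFil.matrix _).F 1 := fun a b d k hk => by
  rw [eulerM_apply, Matrix.map_apply, coeff_eulerT, euler_coeff]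
  rcases (Int.lt_add_one_iff.mp hk : k ≤ 0).lt_or_eq with h | rfl
  · rw [hM a b d k h, mul_zero]
  · simp

theorem coeff_const (M : X.LMat) (a b : Fin X.size) (d : X.Idx →₀ ℕ) [Decidable (d = 0)] :
    MvPowerSeries.coeff d (X.const M a b) = if d = 0 then M a b else 0 := by
  classical
  rw [const, Matrix.map_apply, MvPowerSeries.coeff_C]
  congr

theorem const_mem_zFil {M : X.LMat} {n : ℤ} (h : ∀ a b, ∀ k < n, (M a b).coeff k = 0) :
    X.const M ∈ (X.zFil.matrix _).F n := by
  classical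
  intro a b d k hk
  rw [coeff_const]
  split_ifs
  · exact h a b k hk
  · rfl

theorem const_lam_mem_zFil (h : X.DiagData r e) {j : ℕ} (hj : j ∈ X.exponents) :
    X.const (X.LamJ j) ∈ (X.zFil.matrix _).F (-(j + X.cox : ℕ)) := by
  refine const_mem_zFil fun a b k hk => ?_
  by_contra hne
  have h1 := h.lam_coeff hj a b hne
  have h2 := h.r_nonneg a
  have h3 := h.r_le b
  have h4 : (1 : ℤ) ≤ X.cox := by exact_mod_cast X.cox_pos
  push_cast at hk
  nlinarith

theorem const_lam_small_mem_zFil (h : X.DiagData r e) {j : ℕ} (hj : j ∈ X.smallExp) :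
    X.const (X.LamJ j) ∈ (X.zFil.matrix _).F (-1) :=
  const_mem_zFil fun a b _ hk => h.lam_small_coeff hj a b hk

/-- The central part of `(ad Y) ^ (n + 1) Λ_j` is the cocycle of `Y` and `(ad Y) ^ n Λ_j`.
Invariance moves the brackets onto the Euler derivative of `Y`, and the sum with weights `1 / (n +
1)!` is the series of `Θ⁻¹ (z ∂_z Θ)`. -/
theorem centralCoord_eq (h : X.DiagData r e) (hY : X.IsNegative Y) {j : ℕ} (hj : j ∈ X.exponents) :
    X.centralCoord Y j = X.kappa • X.loopCoeff 0
      ((X.Theta Y)⁻¹ * X.eulerM (X.Theta Y) * X.const (X.LamJ j)).trace := by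
  set M := Y.toTMat with hM
  set L := X.const (X.LamJ j) with hL
  set s : ℕ := j + X.cox with hs
  have hLs : L ∈ (X.zFil.matrix _).F (-(s : ℕ)) := const_lam_mem_zFil h hj
  have hMz : M ∈ (X.zFil.matrix _).F 1 := toTMat_mem_zFil hY
  set b : ℕ → X.TMat × X.TSer := fun n => (X.affBracket (M, 0))^[n] (L, 0) with hb
  have hb1 : ∀ n, (b (n + 1)).1 = M * (b n).1 - (b n).1 * M := by
    intro n
    simp only [hb, Function.iterate_succ_apply']
    rfl
  have hb2 : ∀ n, (b (n + 1)).2 = X.kappa • X.loopCoeff 0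
      (iterBracket M n (X.eulerM M) * L).trace := by
    intro n
    rw [← trace_mul_iterBracket M (X.eulerM M) L n (fun n => (b n).1) rfl hb1]
    simp only [hb, Function.iterate_succ_apply']
    ext1 d
    rfl
  have hmem : ∀ n : ℕ, (iterBracket M n (X.eulerM M) * L).trace ∈ X.zFil.F (n + 1 - s : ℤ) := fun n =>
    RingFil.trace_mem _ (RingFil.mul_mem' _ (by linarith)
      (iterBracket_mem hMz (X.eulerM_mem_zFil hMz) n) hLs)
  have hzero : ∀ {f : X.TLoop}, f ∈ X.zFil.F 1 → X.loopCoeff 0 f = 0 := by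
    intro f hf
    ext1 d
    exact hf d 0 one_pos
  -- `Λ_j` has order at least `-s` in `z⁻¹`, and each bracket with `Y` raises the order by one. The
  -- terms beyond `s + 1` do not reach `z ^ 0`, so the `finsum` has finite support and does not take
  -- its default value.
  have hsum : X.centralCoord Y j = ∑ n ∈ Finset.range (s + 1 + 1), ((n.factorial : ℂ)⁻¹) • (b n).2 := by
    refine finsum_eq_sum_of_support_subset _ fun n hn => ?_
    rw [Finset.mem_coe, Finset.mem_range]
    by_contra hlt
    refine hn ?_
    obtain ⟨k, rfl⟩ : ∃ k, n = k + 1 := ⟨n - 1, by omega⟩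
    change (((k + 1).factorial : ℂ)⁻¹) • (b (k + 1)).2 = 0
    rw [hb2, hzero (RingFil.mem_of_le _ (by omega) (hmem k)), smul_zero, smul_zero]
  have hder := (isExp_theta hY).derivation_iterBracket hMz X.eulerM X.eulerM_add X.eulerM_smul
    X.eulerM_mul X.eulerM_mem_zFil (s + 1)
  rw [← hM] at hder
  have h1 : ((X.Theta Y)⁻¹ * (X.eulerM (X.Theta Y) - X.Theta Y * ∑ n ∈ Finset.range (s + 1),
      (((n + 1).factorial : ℂ)⁻¹) • iterBracket M n (X.eulerM M)) * L).trace ∈ X.zFil.F 1 :=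
    RingFil.trace_mem _ (RingFil.mul_mem' _ (m := s + 1) (by linarith)
      (RingFil.mul_mem' _ (by simp) theta_inv_mem_zFil hder) hLs)
  have h2 := hzero h1
  rw [mul_sub, ← mul_assoc, Matrix.nonsing_inv_mul _ isUnit_det_theta, one_mul, sub_mul,
    Matrix.trace_sub] at h2
  have h3 : ∀ f g : X.TLoop, X.loopCoeff 0 (f - g) = X.loopCoeff 0 f - X.loopCoeff 0 g := by
    intro f g
    ext1 d
    rw [coeff_loopCoeff, map_sub, HahnSeries.coeff_sub]
    rfl
  rw [h3, sub_eq_zero] at h2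
  rw [h2, hsum, Finset.sum_range_succ']
  ext1 d
  have h4 : (b 0).2 = 0 := rfl
  have h5 : ∀ (c : ℂ) (f : X.TSer), MvPowerSeries.coeff d (c • f) = c * MvPowerSeries.coeff d f :=
    fun _ _ => rfl
  rw [h4, smul_zero, add_zero, map_sum, h5, coeff_loopCoeff, Finset.sum_mul, Matrix.trace_sum,
    map_sum, HahnSeries.coeff_sum, Finset.mul_sum]
  refine Finset.sum_congr rfl fun n _ => ?_
  rw [hb2, h5, h5, coeff_loopCoeff]
  rw [trace_smul_mul, coeff_smul_TLoop, loop_smul_coeff]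
  ring

/-! ### Superposition of the residue classes modulo the Coxeter number -/

theorem mem_exponents_iff_mod (n : ℕ) : n ∈ X.exponents ↔ n % X.cox ∈ X.smallExp := by
  rw [mem_smallExp]
  have h1 : ∀ N b, b + N * X.cox ∈ X.exponents ↔ b ∈ X.exponents := by
    intro N b
    induction N with
    | zero => simp
    | succ N ih => rw [add_mul, one_mul, ← add_assoc, add_cox_mem_exponents, ih]
  have h2 := Nat.mod_add_div n X.cox
  rw [mul_comm] at h2
  conv_lhs => rw [← h2, h1]
  exact ⟨fun h => ⟨Nat.mod_lt _ X.cox_pos, h⟩, fun h => h.2⟩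

/-- `∑ x ^ (-a) f_a (x ^ h)`, the sum being over the exponents `0 < a < h`. -/
def superpose (X : AffType) (f : ℕ → X.TLoop) : X.TLoop :=
  ∑ a ∈ X.smallExp, MvPowerSeries.C (mono (-(a : ℤ)) 1) * X.substT (f a)

open scoped Classical in
theorem loopCoeff_superpose (f : ℕ → X.TLoop) (n : ℤ) : X.loopCoeff n (X.superpose f) =
    if (n % X.cox).toNat ∈ X.smallExp then
      X.loopCoeff (n / X.cox) (f (n % X.cox).toNat) else 0 := by
  have hc : (0 : ℤ) < X.cox := by exact_mod_cast X.cox_pos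
  ext1 d
  have h1 : ∀ a ∈ X.smallExp, (MvPowerSeries.coeff d (MvPowerSeries.C (mono (-(a : ℤ)) 1) *
      X.substT (f a))).coeff n = if a = (n % X.cox).toNat then
        (MvPowerSeries.coeff d (f a)).coeff (n / X.cox) else 0 := by
    intro a ha
    have ha' := (X.mem_smallExp.mp ha).1
    rw [MvPowerSeries.coeff_C_mul, mono_mul_coeff, one_mul, coeff_substT]
    split_ifs with h
    · have h2 := Int.mul_ediv_add_emod n X.cox
      have h3 : (a : ℤ) = n % X.cox := by rw [h, Int.toNat_of_nonneg (Int.emod_nonneg n hc.ne')]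
      rw [show n + -(a : ℤ) = X.cox * (n / X.cox) by linarith, substPow_coeff_mul]
    · refine substPow_coeff_of_not_dvd _ _ _ fun ⟨k, hk⟩ => h ?_
      have : n = a + X.cox * k := by linarith
      rw [this, Int.add_mul_emod_self_left, Int.emod_eq_of_lt (by omega) (by omega)]
      simp
  rw [coeff_loopCoeff, superpose, map_sum, HahnSeries.coeff_sum, Finset.sum_congr rfl h1,
    Finset.sum_ite_eq']
  split_ifs <;> rfl

theorem superpose_congr {f g : ℕ → X.TLoop} (h : ∀ a ∈ X.smallExp, f a = g a) :
    X.superpose f = X.superpose g :=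
  Finset.sum_congr rfl fun a ha => by rw [h a ha]

/-! ### The first derivatives of the tau function -/

/-- The logarithmic derivative of the tau function, as a series in the loop variable. -/
def firstSeries (X : AffType) (Y : X.TMatNeg) : X.TLoop :=
  -(X.kappa • X.superpose fun a =>
    ((X.Theta Y)⁻¹ * X.eulerM (X.Theta Y) * X.const (X.LamJ a)).trace)

theorem const_smul_lam (c : Loop) (M : X.LMat) :
    X.const (c • M) = (MvPowerSeries.C c : X.TLoop) • X.const M := by
  ext1 a b
  rw [const, Matrix.map_apply, Matrix.smul_apply, Matrix.smul_apply, smul_eq_mul, map_mul]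
  rfl

/-- With `j = a + N h` one has `Λ_j = z ^ N Λ_a`, so the residue for `j` is the coefficient of `z ^
(-N)` in the series for `a`, which the superposition places at `ζ ^ (-j)`. -/
theorem tau_deriv_eq_loopCoeff (h : X.DiagData r e) (hY : X.IsNegative Y) {tau : X.TSer}
    (htau : X.IsTau Y tau) (j : X.Idx) :
    MvPowerSeries.pderiv ℂ j (X.logSer tau) = X.loopCoeff j.1 (X.firstSeries Y) := by
  classical
  have hsm : ∀ (c : ℂ) (f : X.TLoop) (n : ℤ), X.loopCoeff n (-(c • f)) = -(c • X.loopCoeff n f) := by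
    intro c f n
    ext1 d
    rw [coeff_loopCoeff, map_neg, coeff_smul_TLoop, map_neg, HahnSeries.coeff_neg, loop_smul_coeff]
    rfl
  rw [htau.2 j, centralCoord_eq h hY j.2, firstSeries, hsm, loopCoeff_superpose]
  have h0 : ((j.1 : ℤ) % (X.cox : ℤ)).toNat = j.1 % X.cox := by
    rw [← Int.natCast_mod, Int.toNat_natCast]
  have hs := (mem_exponents_iff_mod j.1).mp j.2
  have h1 := (h.lam_add_mul_cox (X.mem_smallExp.mp hs).2 (j.1 / X.cox)).2
  rw [mul_comm, Nat.mod_add_div] at h1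
  rw [h0, if_pos hs, h1, const_smul_lam, matrix_mul_smul, matrix_trace_smul]
  congr 2
  ext1 d
  rw [coeff_loopCoeff, MvPowerSeries.coeff_C_mul, mono_mul_coeff, one_mul, zero_add,
    coeff_loopCoeff]
  rfl

/-- `Θ⁻¹ (z ∂_z Θ)` starts at `z⁻¹`, while `Λ_a` with `a < h` contains at most the first power of
`z`, so no positive power of `ζ` appears. -/
theorem loopCoeff_firstSeries_of_notMem (h : X.DiagData r e) {n : ℤ}
    (hn : ¬ (0 ≤ n ∧ n.toNat ∈ X.exponents)) : X.loopCoeff n (X.firstSeries Y) = 0 := by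
  classical
  have hsm : ∀ (c : ℂ) (f : X.TLoop) (n : ℤ), X.loopCoeff n (-(c • f)) = -(c • X.loopCoeff n f) := by
    intro c f n
    ext1 d
    rw [coeff_loopCoeff, map_neg, coeff_smul_TLoop, map_neg, HahnSeries.coeff_neg, loop_smul_coeff]
    rfl
  rw [firstSeries, hsm, loopCoeff_superpose]
  split_ifs with hs
  · have hc : (0 : ℤ) < X.cox := by exact_mod_cast X.cox_pos
    rcases lt_or_ge n 0 with hlt | hge
    · have h1 : ((X.Theta Y)⁻¹ * X.eulerM (X.Theta Y) *
          X.const (X.LamJ (n % X.cox).toNat)).trace ∈ X.zFil.F 0 := by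
        exact RingFil.trace_mem _ (RingFil.mul_mem' _ (m := 1) (by norm_num)
          (RingFil.mul_mem' _ (by norm_num) theta_inv_mem_zFil
            (X.eulerM_mem_zFil_one theta_mem_zFil)) (const_lam_small_mem_zFil h hs))
      have h2 : X.loopCoeff (n / X.cox) ((X.Theta Y)⁻¹ * X.eulerM (X.Theta Y) *
          X.const (X.LamJ (n % X.cox).toNat)).trace = 0 := by
        ext1 d
        exact h1 d _ (Int.ediv_neg_of_neg_of_pos hlt hc)
      rw [h2, smul_zero, neg_zero]
    · exfalso
      refine hn ⟨hge, (mem_exponents_iff_mod _).mpr ?_⟩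
      lift n to ℕ using hge
      rwa [← Int.natCast_mod, Int.toNat_natCast] at hs
  · rw [smul_zero, neg_zero]

end AffType

end DrinfeldSokolov

/-! ### The logarithmic derivative of the wave function and the one-point formula -/

namespace DrinfeldSokolov

/-- The logarithmic derivative of `g T⁻¹`, traced against `L`, splits into separate contributions of
`g` and `T`, because conjugation by `g` fixes `L`. -/
theorem trace_dressing {R n : Type*} [CommRing R] [Fintype n] [DecidableEq n]
    {g T L : Matrix n n R} (g' T' : Matrix n n R) (hg : IsUnit g.det) (hT : IsUnit T.det)
    (hgL : Commute g L) :
    ((g' * T⁻¹ + g * -(T⁻¹ * T' * T⁻¹)) * (T * g⁻¹) * L).trace =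
      (g' * g⁻¹ * L).trace - (T⁻¹ * T' * L).trace := by
  rw [Matrix.mul_neg, ← sub_eq_add_neg, sub_mul, sub_mul, Matrix.trace_sub]
  congr 1
  · rw [mul_assoc g', Matrix.nonsing_inv_mul_cancel_left _ _ hT]
  · rw [mul_assoc g, mul_assoc (_ * _) T⁻¹, Matrix.nonsing_inv_mul_cancel_left _ _ hT,
      mul_assoc, mul_assoc, Matrix.trace_mul_comm, mul_assoc, mul_assoc g⁻¹, ← hgL.eq,
      Matrix.nonsing_inv_mul_cancel_left _ _ hg]

namespace AffType

variable {X : AffType} {Y : X.TMatNeg} {r : Fin X.size → ℤ} {e : ℕ → Fin X.size → ℂ}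

/-- The substitution `z = ζ ^ h` in matrices. -/
def substM (M : X.TMat) : X.TMat := M.map X.substT

theorem substM_mul (M N : X.TMat) : substM (M * N) = substM M * substM N := Matrix.map_mul

theorem substM_const (M : X.LMat) :
    substM (X.const M) = X.const (M.map (substPow X.cox X.cox_pos)) := by
  ext1 a b
  simp only [substM, const, Matrix.map_apply, substT, MvPowerSeries.map_C]

theorem trace_substM (M : X.TMat) : (substM M).trace = X.substT M.trace :=
  matrix_trace_map X.substT M

theorem smul_superpose (c : ℂ) (f : ℕ → X.TLoop) :
    c • X.superpose f = X.superpose fun a => c • f a := by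
  rw [smul_TLoop, superpose, superpose, Finset.mul_sum]
  refine Finset.sum_congr rfl fun a _ => ?_
  rw [substT_smul, smul_TLoop, mul_left_comm]

theorem superpose_sub (f g : ℕ → X.TLoop) :
    X.superpose (fun a => f a - g a) = X.superpose f - X.superpose g := by
  simp only [superpose, map_sub, mul_sub, Finset.sum_sub_distrib]

theorem trace_substM_mul_sum (A : X.TMat) (U : ℕ → X.TMat) :
    (substM A * ∑ a ∈ X.smallExp, (MvPowerSeries.C (mono (-(a : ℤ)) 1) : X.TLoop) •
      substM (U a)).trace = X.superpose fun a => (A * U a).trace := by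
  rw [Finset.mul_sum, Matrix.trace_sum]
  refine Finset.sum_congr rfl fun a _ => ?_
  rw [matrix_mul_smul, matrix_trace_smul, ← substM_mul, trace_substM]

theorem const_P_mul_bigD_mul_inv (h : X.DiagData r e) :
    X.const X.P * X.const X.bigD * X.const X.P⁻¹ =
      ∑ a ∈ X.smallExp, (MvPowerSeries.C (mono (-(a : ℤ)) 1) : X.TLoop) •
        substM (X.const (X.LamJ a)) := by
  rw [← const_mul, ← const_mul, h.P_mul_bigD_mul_inv]
  have hs : ∀ s : Finset ℕ, ∀ M : ℕ → X.LMat, X.const (∑ a ∈ s, M a) = ∑ a ∈ s, X.const (M a) :=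
    fun s M => map_sum (MvPowerSeries.C : Loop →+* X.TLoop).mapMatrix M s
  rw [hs]
  refine Finset.sum_congr rfl fun a _ => ?_
  rw [const_smul_lam, substM_const]

/-- If `j = b + N h` with `b < h`, orthogonality leaves only `a = h - b`, and the power of `ζ` is `h
(N + 1) - (h - b) = j`. -/
theorem superpose_trace_euler_lam (h : X.DiagData r e) {j : ℕ} (hj : j ∈ X.exponents) :
    ∑ a ∈ X.smallExp, mono (-(a : ℤ)) 1 * substPow X.cox X.cox_pos
      (X.kappa • ((X.LamJ j).map euler * X.LamJ a).trace) = mono j j := by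
  have hb := (mem_exponents_iff_mod j).mp hj
  set b := j % X.cox with hb'
  set N := j / X.cox with hN
  have hjN : j = b + N * X.cox := by rw [mul_comm, Nat.mod_add_div]
  have hb2 := (X.mem_smallExp.mp hb)
  have hc : X.cox - b ∈ X.smallExp := by
    have h1 := X.pos_of_mem_exponents hb2.2
    exact X.mem_smallExp.mpr ⟨by omega, X.cox_sub_mem_exponents hb2.1 hb2.2⟩
  have hcast : ((X.cox - b : ℕ) : ℤ) = X.cox - b := by
    have := hb2.1
    omega
  rw [hjN, Finset.sum_eq_single (X.cox - b)]
  · rw [h.trace_euler_lam_mul hb hc N, if_pos (Nat.sub_add_cancel hb2.1.le), substPow_mono,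
      mono_mul_mono, one_mul, hcast]
    refine mono_congr ?_ rfl
    push_cast
    ring
  · intro a ha hne
    rw [h.trace_euler_lam_mul hb ha N, if_neg (by omega), map_zero, mul_zero]
  · exact fun h => absurd hc h

theorem superpose_linear_trace (h : X.DiagData r e) :
    (X.kappa • X.superpose fun a => X.linear fun j => ((X.LamJ j.1).map euler * X.LamJ a).trace) =
      X.linear fun j => mono (j.1 : ℤ) (j.1 : ℂ) := by
  have h1 : ∀ d : X.Idx →₀ ℕ, MvPowerSeries.coeff d (X.kappa • X.superpose fun a =>
      X.linear fun j => ((X.LamJ j.1).map euler * X.LamJ a).trace) =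
      ∑ a ∈ X.smallExp, mono (-(a : ℤ)) 1 * substPow X.cox X.cox_pos (X.kappa •
        MvPowerSeries.coeff d (X.linear fun j => ((X.LamJ j.1).map euler * X.LamJ a).trace)) := by
    intro d
    rw [smul_superpose, superpose, map_sum]
    refine Finset.sum_congr rfl fun a _ => ?_
    rw [MvPowerSeries.coeff_C_mul, coeff_substT, coeff_smul_TLoop]
  apply linear_ext
  · intro j
    rw [h1]
    simp only [coeff_linear_single]
    exact superpose_trace_euler_lam h j.2
  · intro d hd
    rw [h1]
    refine Finset.sum_eq_zero fun a _ => ?_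
    rw [coeff_linear_of_ne _ d hd, smul_zero, map_zero, mul_zero]

/-- The Euler derivative of `P` is multiplication by a diagonal matrix, whereas `P D P⁻¹` has zero
diagonal by `lam_small_diag`. So the derivative of `P` does not contribute to part (i). -/
theorem trace_euler_P_inv (h : X.DiagData r e) :
    (X.P⁻¹.map euler * X.P * X.bigD).trace = 0 := by
  have h1 : X.P⁻¹.map euler = X.P⁻¹ * Matrix.diagonal (fun a => mono 0 (r a)) := by
    rw [isDer_euler.matrix_inv h.isUnit_P, h.euler_P, Matrix.mul_neg, Matrix.neg_mul, neg_neg, mul_assoc,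
      mul_assoc, Matrix.mul_nonsing_inv _ h.isUnit_P, mul_one]
  rw [h1, mul_assoc, mul_assoc, Matrix.trace_mul_comm, mul_assoc, h.P_mul_bigD_mul_inv,
    Finset.mul_sum, Matrix.trace_sum]
  refine Finset.sum_eq_zero fun a ha => Finset.sum_eq_zero fun i _ => ?_
  rw [Matrix.diag_apply, Matrix.diagonal_mul, Matrix.smul_apply, Matrix.map_apply,
    h.lam_small_diag ha, map_zero, smul_eq_mul, mul_zero, mul_zero]

theorem isUnit_det_wave : IsUnit (X.wave Y).det := by
  rw [wave, Matrix.det_mul]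
  exact isUnit_det_g.mul (Matrix.isUnit_nonsing_inv_det _ isUnit_det_theta)

theorem eulerM_substM (M : X.TMat) : X.eulerM (substM M) = (X.cox : ℂ) • substM (X.eulerM M) := by
  ext1 a b
  exact X.eulerT_substT (M a b)

theorem psi_inv (h : X.DiagData r e) :
    (X.Psi Y)⁻¹ = substM (X.wave Y)⁻¹ * X.const X.P := by
  apply Matrix.inv_eq_left_inv
  have h1 : X.Psi Y = X.const X.P⁻¹ * substM (X.wave Y) := rfl
  rw [h1, mul_assoc, ← mul_assoc (X.const X.P), ← const_mul, Matrix.mul_nonsing_inv _ h.isUnit_P]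
  have h2 : X.const (1 : X.LMat) = 1 := map_one (MvPowerSeries.C : Loop →+* X.TLoop).mapMatrix
  have h3 : substM (1 : X.TMat) = 1 := map_one X.substT.mapMatrix
  rw [h2, one_mul, ← substM_mul, Matrix.nonsing_inv_mul _ isUnit_det_wave, h3]

theorem trace_euler_wave (h : X.DiagData r e) {a : ℕ} (ha : a ∈ X.exponents) :
    (X.eulerM (X.wave Y) * (X.wave Y)⁻¹ * X.const (X.LamJ a)).trace =
      (X.linear fun j => ((X.LamJ j.1).map euler * X.LamJ a).trace) -
        ((X.Theta Y)⁻¹ * X.eulerM (X.Theta Y) * X.const (X.LamJ a)).trace := by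
  have hg := isUnit_det_g (X := X)
  have hT := isUnit_det_theta (Y := Y)
  have h1 : (X.wave Y)⁻¹ = X.Theta Y * X.g⁻¹ := by
    rw [wave, Matrix.mul_inv_rev, Matrix.nonsing_inv_nonsing_inv _ hT]
  have h2 : X.eulerM (X.Theta Y)⁻¹ = -((X.Theta Y)⁻¹ * X.eulerM (X.Theta Y) * (X.Theta Y)⁻¹) :=
    X.isDer_eulerT.matrix_inv hT
  rw [← trace_euler_g h ha, h1, wave, eulerM_mul, h2]
  exact trace_dressing _ _ hg hT (commute_g_const h ha)

theorem firstSeries_eq (h : X.DiagData r e) :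
    X.firstSeries Y = (X.kappa / (X.cox : ℂ)) •
          Matrix.trace ((X.Psi Y).map X.eulerT * (X.Psi Y)⁻¹ * X.const X.bigD)
        - X.linear fun j => mono (j.1 : ℤ) (j.1 : ℂ) := by
  have hc : (X.cox : ℂ) ≠ 0 := by exact_mod_cast X.cox_pos.ne'
  have h1 : (X.Psi Y).map X.eulerT = X.eulerM (X.const X.P⁻¹ * substM (X.wave Y)) := rfl
  have h2 : X.eulerM (X.const X.P⁻¹) = X.const (X.P⁻¹.map euler) := by
    classical
    ext1 a b
    ext1 d
    rw [eulerM_apply, Matrix.map_apply, coeff_eulerT, coeff_const, coeff_const]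
    split_ifs
    · rfl
    · exact isDer_euler.zero
  have h3 : (X.const (X.P⁻¹.map euler * X.P * X.bigD)).trace = 0 := by
    have := matrix_trace_map (MvPowerSeries.C : Loop →+* X.TLoop) (X.P⁻¹.map euler * X.P * X.bigD)
    rw [trace_euler_P_inv h, map_zero] at this
    exact this
  have h4 : Matrix.trace ((X.Psi Y).map X.eulerT * (X.Psi Y)⁻¹ * X.const X.bigD) =
      (X.cox : ℂ) • X.superpose fun a =>
        (X.eulerM (X.wave Y) * (X.wave Y)⁻¹ * X.const (X.LamJ a)).trace := by
    have h5 : X.const X.P⁻¹ * ((X.cox : ℂ) • substM (X.eulerM (X.wave Y))) =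
        (X.cox : ℂ) • (X.const X.P⁻¹ * substM (X.eulerM (X.wave Y))) := by
      ext1 a b
      simp only [Matrix.mul_apply, Matrix.smul_apply, smul_TLoop, Finset.mul_sum, mul_left_comm]
    have h6 : ∀ (c : ℂ) (A B : X.TMat), c • A * B = c • (A * B) := by
      intro c A B
      ext1 a b
      simp only [Matrix.mul_apply, Matrix.smul_apply, smul_TLoop, Finset.mul_sum, mul_assoc]
    have h7 : ∀ (c : ℂ) (A : X.TMat), (c • A).trace = c • A.trace := by
      intro c A
      simp only [Matrix.trace, Matrix.diag_apply, Matrix.smul_apply, smul_TLoop, Finset.mul_sum]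
    have hW : substM (X.wave Y) * substM (X.wave Y)⁻¹ = 1 := by
      rw [← substM_mul, Matrix.mul_nonsing_inv _ isUnit_det_wave]
      exact map_one X.substT.mapMatrix
    rw [h1, eulerM_mul, eulerM_substM, h2, h5, psi_inv h, add_mul, add_mul, Matrix.trace_add,
      mul_assoc (X.const _) (substM _), ← mul_assoc (substM (X.wave Y)), hW, one_mul, ← const_mul,
      ← const_mul, h3, zero_add, h6, h6, h7]
    congr 1
    rw [← trace_substM_mul_sum, ← const_P_mul_bigD_mul_inv h, substM_mul, mul_assoc (X.const _),
      mul_assoc (X.const _), Matrix.trace_mul_comm]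
    simp only [mul_assoc]
  rw [h4, ← superpose_linear_trace h, firstSeries, superpose_congr (fun a ha =>
    trace_euler_wave h (X.mem_smallExp.mp ha).2), superpose_sub]
  simp only [smul_TLoop]
  rw [← mul_assoc, ← map_mul, mono_mul_mono, div_mul_cancel₀ _ hc]
  simp only [add_zero]
  ring

/-! ### The generating series -/

open scoped Classical in
theorem coeff_genSeries (tau : X.TSer) (m : ℕ) (d : X.Idx →₀ ℕ) (v : Lex (Fin m → ℤ)) :
    (MvPowerSeries.coeff d (X.genSeries tau m)).coeff v =
      if hv : ∀ i, 0 ≤ ofLex v i ∧ (ofLex v i).toNat ∈ X.exponents then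
        MvPowerSeries.coeff d
          (X.iterPderiv (fun i => ⟨(ofLex v i).toNat, (hv i).2⟩) (X.logSer tau))
      else 0 := rfl

theorem iterPderiv_succ {m : ℕ} (j : Fin (m + 1) → X.Idx) (f : X.TSer) :
    X.iterPderiv j f = MvPowerSeries.pderiv ℂ (j 0) (X.iterPderiv (fun i => j i.succ) f) := by
  rw [iterPderiv, List.ofFn_succ, List.foldr_cons]
  rfl

theorem coeff_pderiv_multi {m : ℕ} (f : X.TMulti m) (i : X.Idx) (d : X.Idx →₀ ℕ)
    (v : Lex (Fin m → ℤ)) :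
    (MvPowerSeries.coeff d (MvPowerSeries.pderiv (MultiLoop m) i f)).coeff v =
      (MvPowerSeries.coeff (d + Finsupp.single i 1) f).coeff v * ((d i : ℂ) + 1) := by
  have h1 : ((d i : MultiLoop m) + 1) = HahnSeries.C ((d i : ℂ) + 1) := by
    rw [map_add, map_natCast, map_one]
  rw [MvPowerSeries.coeff_pderiv, h1, mul_comm, HahnSeries.C_mul_eq_smul, HahnSeries.coeff_smul,
    smul_eq_mul, mul_comm]

-- This is the inductive structure in `m`: fixing the exponent of `ζ₁` leaves a time derivative of
-- the series in one variable fewer.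
open scoped Classical in
theorem headT_genSeries (tau : X.TSer) (m : ℕ) (n : ℤ) :
    X.headT n (X.genSeries tau (m + 1)) =
      if hn : 0 ≤ n ∧ n.toNat ∈ X.exponents then
        MvPowerSeries.pderiv (MultiLoop m) ⟨n.toNat, hn.2⟩ (X.genSeries tau m) else 0 := by
  ext d v
  rw [coeff_headT, headCoeff_coeff, coeff_genSeries]
  by_cases hn : 0 ≤ n ∧ n.toNat ∈ X.exponents
  · rw [dif_pos hn, coeff_pderiv_multi, coeff_genSeries]
    by_cases hv : ∀ i, 0 ≤ ofLex v i ∧ (ofLex v i).toNat ∈ X.exponents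
    · have h1 : ∀ i, 0 ≤ ofLex (consExp n v) i ∧ (ofLex (consExp n v) i).toNat ∈ X.exponents :=
        Fin.cases hn hv
      rw [dif_pos hv, dif_pos h1, iterPderiv_succ, MvPowerSeries.coeff_pderiv]
      rfl
    · rw [dif_neg hv, zero_mul, dif_neg]
      exact fun h => hv fun i => h i.succ
  · rw [dif_neg hn, dif_neg, map_zero, HahnSeries.coeff_zero]
    exact fun h => hn (h 0)

theorem genSeries_one (h : X.DiagData r e) (hY : X.IsNegative Y) {tau : X.TSer}
    (htau : X.IsTau Y tau) : X.genSeries tau 1 = X.atVar 0 (X.firstSeries Y) := by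
  classical
  ext d v
  have hv : v = placeExp 0 (ofLex v 0) := by
    apply ofLex.injective
    funext i
    rw [Subsingleton.elim i 0]
    exact (Pi.single_eq_same (M := fun _ => ℤ) 0 _).symm
  rw [coeff_genSeries, coeff_atVar, hv, inVar_coeff_placeExp, ← hv, ← coeff_loopCoeff]
  by_cases hn : 0 ≤ ofLex v 0 ∧ (ofLex v 0).toNat ∈ X.exponents
  · have h1 : ∀ i, 0 ≤ ofLex v i ∧ (ofLex v i).toNat ∈ X.exponents := fun i => by
      rw [Subsingleton.elim i 0]
      exact hn
    have h2 := tau_deriv_eq_loopCoeff h hY htau ⟨_, hn.2⟩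
    rw [Int.toNat_of_nonneg hn.1] at h2
    rw [dif_pos h1, iterPderiv_succ, ← h2]
    rfl
  · rw [dif_neg fun h => hn (h 0), loopCoeff_firstSeries_of_notMem h hn, map_zero]

end AffType

end DrinfeldSokolov

namespace DrinfeldSokolov

/-! ### Conjugation by the dressing operator -/

section Dressing

variable {R n : Type*} [CommRing R] [Fintype n] [DecidableEq n]

theorem IsDer.dressing {D : R → R} (hD : IsDer D) {T L : Matrix n n R} (hT : IsUnit T.det) :
    (T * L * T⁻¹).map D = T.map D * T⁻¹ * (T * L * T⁻¹) - T * L * T⁻¹ * (T.map D * T⁻¹) +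
      T * L.map D * T⁻¹ := by
  rw [hD.matrix_mul, hD.matrix_mul, hD.matrix_inv hT, mul_assoc _ T⁻¹, mul_assoc T L T⁻¹,
    Matrix.nonsing_inv_mul_cancel_left _ _ hT, Matrix.mul_neg, add_mul]
  simp only [mul_assoc]
  abel

theorem trace_dressing_mul {T L M L' B : Matrix n n R} (hT : IsUnit T.det) (hLM : Commute L M) :
    ((B * (T * L * T⁻¹) - T * L * T⁻¹ * B + T * L' * T⁻¹) * (T * M * T⁻¹)).trace =
      (L' * M).trace := by
  have h1 : ∀ A C : Matrix n n R, T * A * T⁻¹ * (T * C * T⁻¹) = T * (A * C) * T⁻¹ := by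
    intro A C
    rw [mul_assoc T C, mul_assoc (T * A), Matrix.nonsing_inv_mul_cancel_left _ _ hT]
    simp only [mul_assoc]
  rw [add_mul, sub_mul, Matrix.trace_add, Matrix.trace_sub, mul_assoc B, h1, mul_assoc _ B,
    Matrix.trace_mul_comm (T * L * T⁻¹), mul_assoc B, h1, hLM.eq, sub_self, zero_add, h1,
    mul_assoc, Matrix.trace_mul_comm, mul_assoc, Matrix.nonsing_inv_mul _ hT, mul_one]

theorem commute_dressing {T L M : Matrix n n R} (hT : IsUnit T.det) (hLM : Commute L M) :
    Commute (T * L * T⁻¹) (T * M * T⁻¹) := by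
  have h1 : ∀ A C : Matrix n n R, T * A * T⁻¹ * (T * C * T⁻¹) = T * (A * C) * T⁻¹ := by
    intro A C
    rw [mul_assoc T C, mul_assoc (T * A), Matrix.nonsing_inv_mul_cancel_left _ _ hT]
    simp only [mul_assoc]
  rw [commute_iff_eq, h1, h1, hLM.eq]

theorem dressing_mul_vacuum {g T L : Matrix n n R} (hg : IsUnit g.det)
    (hT : IsUnit T.det) (hgL : Commute g L) : (g * T⁻¹)⁻¹ * L * (g * T⁻¹) = T * L * T⁻¹ := by
  rw [Matrix.mul_inv_rev, Matrix.nonsing_inv_nonsing_inv _ hT, mul_assoc, mul_assoc,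
    ← mul_assoc L, ← hgL.eq, mul_assoc g, Matrix.nonsing_inv_mul_cancel_left _ _ hg, ← mul_assoc]

end Dressing

namespace AffType

variable {X : AffType} {Y : X.TMatNeg} {r : Fin X.size → ℤ} {e : ℕ → Fin X.size → ℂ}

/-! ### The flows on `K` -/

/-- `Θ Λ_j Θ⁻¹`. -/
def dressed (Y : X.TMatNeg) (j : ℕ) : X.TMat := X.Theta Y * X.const (X.LamJ j) * (X.Theta Y)⁻¹

/-- `P` is absorbed by `D`, and `g` commutes with every `Λ_a`; only the dressing by `Θ` is left. -/
theorem K_eq_sum (h : X.DiagData r e) : X.K Y =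
    ∑ a ∈ X.smallExp, (MvPowerSeries.C (mono (-(a : ℤ)) 1) : X.TLoop) • substM (dressed Y a) := by
  have h1 : X.Psi Y = X.const X.P⁻¹ * substM (X.wave Y) := rfl
  rw [K, psi_inv h, h1, mul_assoc, mul_assoc (substM _), ← mul_assoc (X.const X.P),
    ← mul_assoc (X.const X.P * _), const_P_mul_bigD_mul_inv h, Finset.sum_mul, Finset.mul_sum]
  refine Finset.sum_congr rfl fun a ha => ?_
  rw [matrix_smul_mul, matrix_mul_smul, ← substM_mul, ← substM_mul, ← mul_assoc, wave,
    dressing_mul_vacuum isUnit_det_g isUnit_det_theta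
      (commute_g_const h (X.mem_smallExp.mp ha).2), dressed]

theorem K_apply (h : X.DiagData r e) (a b : Fin X.size) :
    X.K Y a b = X.superpose fun c => dressed Y c a b := by
  rw [K_eq_sum h, Matrix.sum_apply]
  rfl

/-- The derivation `∂ / ∂t_n` on matrices. -/
def pderivM (n : X.Idx) (M : X.TMat) : X.TMat := M.map (MvPowerSeries.pderiv Loop n)

theorem pderivM_const (n : X.Idx) (M : X.LMat) : pderivM n (X.const M) = 0 := by
  ext1 a b
  rw [pderivM, const, Matrix.map_apply, Matrix.map_apply]
  exact MvPowerSeries.pderiv_C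

theorem pderivM_theta (hsol : X.IsSolution Y) (n : X.Idx) :
    pderivM n (X.Theta Y) = (dressed Y n.1).map X.negT * X.Theta Y := hsol n

theorem pderivM_dressed (hsol : X.IsSolution Y) (n : X.Idx) (j : ℕ) :
    pderivM n (dressed Y j) = (dressed Y n.1).map X.negT * dressed Y j -
      dressed Y j * (dressed Y n.1).map X.negT := by
  have h1 := (isDer_pderiv n).dressing (L := X.const (X.LamJ j)) (isUnit_det_theta (Y := Y))
  have h2 : (X.const (X.LamJ j)).map (MvPowerSeries.pderiv Loop n) = 0 := pderivM_const n _
  have h3 : (X.Theta Y).map (MvPowerSeries.pderiv Loop n) =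
    (dressed Y n.1).map X.negT * X.Theta Y := pderivM_theta hsol n
  rw [h2, h3, mul_zero, zero_mul, add_zero, mul_assoc _ (X.Theta Y),
    Matrix.mul_nonsing_inv _ isUnit_det_theta, mul_one] at h1
  exact h1

theorem commute_dressed (h : X.DiagData r e) {i j : ℕ} (hi : i ∈ X.exponents)
    (hj : j ∈ X.exponents) : Commute (dressed Y i) (dressed Y j) := by
  refine commute_dressing isUnit_det_theta ?_
  rw [commute_iff_eq, ← const_mul, ← const_mul, (h.commute_lam hi hj).eq]

/-- The part consisting of the nonnegative powers of the loop variable. -/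
def posT (X : AffType) (f : X.TLoop) : X.TLoop := f - X.negT f

theorem coeff_posT (f : X.TLoop) (d : X.Idx →₀ ℕ) (k : ℤ) :
    (MvPowerSeries.coeff d (X.posT f)).coeff k =
      if 0 < k then 0 else (MvPowerSeries.coeff d f).coeff k := by
  rw [posT, map_sub, HahnSeries.coeff_sub, coeff_negT, negPart_coeff]
  split_ifs
  · exact sub_self _
  · exact sub_zero _

theorem coeff_coeff_constLoop (f : X.TSer) (d : X.Idx →₀ ℕ) (k : ℤ) :
    (MvPowerSeries.coeff d (X.constLoop f)).coeff k =
      if k = 0 then MvPowerSeries.coeff d f else 0 := by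
  rw [constLoop, MvPowerSeries.coeff_map, HahnSeries.C_apply, HahnSeries.coeff_single]
  congr

theorem coeff_C_mono_mul (j : ℤ) (c : ℂ) (f : X.TLoop) (d : X.Idx →₀ ℕ) (k : ℤ) :
    (MvPowerSeries.coeff d (MvPowerSeries.C (mono j c) * f)).coeff k =
      c * (MvPowerSeries.coeff d f).coeff (k + j) := by
  rw [MvPowerSeries.coeff_C_mul, mono_mul_coeff]

/-- Multiplication by `z` moves exactly the coefficient of `z⁻¹` into the part with nonnegative
powers. -/
theorem posT_mono_mul (f : X.TLoop) : X.posT (MvPowerSeries.C (mono 1 1) * f) =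
    MvPowerSeries.C (mono 1 1) * X.posT f + X.constLoop (X.loopCoeff 1 f) := by
  ext d k
  rw [map_add, HahnSeries.coeff_add, coeff_posT, coeff_C_mono_mul, coeff_C_mono_mul, coeff_posT,
    coeff_coeff_constLoop, coeff_loopCoeff, one_mul, one_mul]
  rcases lt_trichotomy k 0 with hk | rfl | hk
  · rw [if_neg (by omega), if_neg (by omega), if_neg (by omega), add_zero]
  · simp
  · rw [if_pos hk, if_pos (by omega), if_neg (by omega), add_zero]

theorem posT_eq_zero {f : X.TLoop} (hf : f ∈ X.zFil.F 1) : X.posT f = 0 := by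
  ext d k
  rw [coeff_posT, map_zero, HahnSeries.coeff_zero]
  split_ifs with hk
  · rfl
  · exact hf d k (by omega)

theorem posT_eq_constLoop {f : X.TLoop} (hf : f ∈ X.zFil.F 0) :
    X.posT f = X.constLoop (X.loopCoeff 0 f) := by
  ext d k
  rw [coeff_posT, coeff_coeff_constLoop, coeff_loopCoeff]
  rcases lt_trichotomy k 0 with hk | rfl | hk
  · rw [if_neg (by omega), if_neg hk.ne, hf d k hk]
  · simp
  · rw [if_pos hk, if_neg hk.ne']

theorem substT_constLoop (f : X.TSer) : X.substT (X.constLoop f) = X.constLoop f := by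
  ext1 d
  rw [coeff_substT, constLoop, MvPowerSeries.coeff_map]
  have : ∀ c : ℂ, (HahnSeries.C c : Loop) = mono 0 c := fun c => by simp [mono]
  rw [this, substPow_mono, mul_zero]

theorem eulerT_constLoop (f : X.TSer) : X.eulerT (X.constLoop f) = 0 := by
  ext d k
  rw [coeff_eulerT, euler_coeff, coeff_coeff_constLoop, map_zero, HahnSeries.coeff_zero]
  split_ifs with hk
  · rw [hk]; simp
  · rw [mul_zero]

theorem substT_C_mono (k : ℤ) (c : ℂ) :
    X.substT (MvPowerSeries.C (mono k c)) = MvPowerSeries.C (mono (X.cox * k) c) := by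
  rw [substT, MvPowerSeries.map_C, substPow_mono]

open scoped Classical in
/-- `Θ Λ_n Θ⁻¹`, where `Λ_n = z ^ N Λ_a` for `n = N h + a`, and `Λ_n = 0` if `n` is not congruent to
an exponent. -/
def dressedInt (Y : X.TMatNeg) (n : ℤ) : X.TMat :=
  if (n % X.cox).toNat ∈ X.smallExp then
    (MvPowerSeries.C (mono (n / X.cox) 1) : X.TLoop) • dressed Y (n % X.cox).toNat else 0

theorem dressedInt_natCast (h : X.DiagData r e) (n : X.Idx) :
    dressedInt Y n.1 = dressed Y n.1 := by
  have h0 : ((n.1 : ℤ) % (X.cox : ℤ)).toNat = n.1 % X.cox := by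
    rw [← Int.natCast_mod, Int.toNat_natCast]
  have hs := (mem_exponents_iff_mod n.1).mp n.2
  have h1 := (h.lam_add_mul_cox (X.mem_smallExp.mp hs).2 (n.1 / X.cox)).2
  rw [mul_comm, Nat.mod_add_div] at h1
  rw [dressedInt, h0, if_pos hs, dressed, dressed, h1, const_smul_lam, matrix_mul_smul,
    matrix_smul_mul]
  rfl

theorem dressedInt_add_cox (n : ℤ) : dressedInt Y (n + X.cox) =
    (MvPowerSeries.C (mono 1 1) : X.TLoop) • dressedInt Y n := by
  have hc : (X.cox : ℤ) ≠ 0 := by exact_mod_cast X.cox_pos.ne'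
  have h1 : (n + X.cox) / (X.cox : ℤ) = n / X.cox + 1 := by
    have := Int.add_mul_ediv_right n 1 hc
    rwa [one_mul] at this
  rw [dressedInt, dressedInt, Int.add_emod_right, h1]
  split_ifs
  · rw [smul_smul, ← map_mul, mono_mul_mono, one_mul, add_comm]
  · ext1 a b
    rw [Matrix.smul_apply, Matrix.zero_apply, smul_eq_mul, mul_zero]

theorem dressed_mem_zFil (h : X.DiagData r e) {a : ℕ} (ha : a ∈ X.smallExp) :
    dressed Y a ∈ (X.zFil.matrix _).F (-1) :=
  RingFil.mul_mem' _ (m := -1) (by norm_num)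
    (RingFil.mul_mem' _ (by norm_num) theta_mem_zFil (const_lam_small_mem_zFil h ha))
    theta_inv_mem_zFil

theorem dressedInt_mem_zFil (h : X.DiagData r e) (n : ℤ) :
    dressedInt Y n ∈ (X.zFil.matrix _).F (-1 - n / X.cox) := by
  rw [dressedInt]
  split_ifs with hs
  · intro a b d k hk
    rw [Matrix.smul_apply, smul_eq_mul, coeff_C_mono_mul, one_mul]
    exact dressed_mem_zFil h hs a b d _ (by linarith)
  · exact Submodule.zero_mem _

theorem dressedInt_mem_zFil_zero (h : X.DiagData r e) {n : ℤ}
    (hn : ¬ (0 ≤ n ∧ n.toNat ∈ X.exponents)) : dressedInt Y n ∈ (X.zFil.matrix _).F 0 := by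
  have hc : (0 : ℤ) < X.cox := by exact_mod_cast X.cox_pos
  rcases lt_or_ge n 0 with hlt | hge
  · have h1 : n / X.cox < 0 := Int.ediv_neg_of_neg_of_pos hlt hc
    exact RingFil.mem_of_le _ (by omega) (dressedInt_mem_zFil h n)
  · rw [dressedInt, if_neg]
    · exact Submodule.zero_mem _
    · intro hs
      refine hn ⟨hge, (mem_exponents_iff_mod _).mpr ?_⟩
      lift n to ℕ using hge
      rwa [← Int.natCast_mod, Int.toNat_natCast] at hs

/-- For `n = N h + a`, both sides are the coefficient of `z ^ (-N)` in `Θ Λ_a Θ⁻¹`; thus `K`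
generates the constant terms of all `dressedInt`. -/
theorem loopCoeff_K (h : X.DiagData r e) (n : ℤ) (a b : Fin X.size) :
    X.loopCoeff n (X.K Y a b) = X.loopCoeff 0 (dressedInt Y n a b) := by
  classical
  rw [K_apply h, loopCoeff_superpose, dressedInt]
  split_ifs
  · ext1 d
    rw [coeff_loopCoeff, coeff_loopCoeff, Matrix.smul_apply, smul_eq_mul, coeff_C_mono_mul, one_mul,
      zero_add]
  · rfl

/-- The generators of the flows on `K`. -/
def flowGen (Y : X.TMatNeg) (n : ℤ) : X.TMat :=
  Matrix.of fun a b => -X.substT (X.posT (dressedInt Y n a b))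

/-- The derivatives of the generators of the flows on `K`. -/
def flowGenEuler (Y : X.TMatNeg) (n : ℤ) : X.TMat :=
  Matrix.of fun a b => X.substT (X.eulerT (X.posT (dressedInt Y n a b)))

theorem exists_dressedInt_mem (h : X.DiagData r e) : ∃ N : ℤ, ∀ n < N, ∀ a b : Fin X.size,
    X.posT (dressedInt Y n a b) = 0 := by
  have hc : (0 : ℤ) < X.cox := by exact_mod_cast X.cox_pos
  refine ⟨-X.cox, fun n hn a b => posT_eq_zero ?_⟩
  have h1 : n / X.cox < -1 := by
    rw [Int.ediv_lt_iff_lt_mul hc]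
    linarith
  exact RingFil.mem_of_le _ (by omega) (dressedInt_mem_zFil h n a b)

theorem exists_flowGen_eq_zero (h : X.DiagData r e) (a b : Fin X.size) :
    ∃ N : ℤ, ∀ n < N, flowGen Y n a b = 0 := by
  obtain ⟨N, hN⟩ := exists_dressedInt_mem (Y := Y) h
  exact ⟨N, fun n hn => by rw [flowGen, Matrix.of_apply, hN n hn, map_zero, neg_zero]⟩

theorem exists_flowGenEuler_eq_zero (h : X.DiagData r e) (a b : Fin X.size) :
    ∃ N : ℤ, ∀ n < N, flowGenEuler Y n a b = 0 := by
  obtain ⟨N, hN⟩ := exists_dressedInt_mem (Y := Y) h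
  exact ⟨N, fun n hn => by
    rw [flowGenEuler, Matrix.of_apply, hN n hn, X.isDer_eulerT.zero, map_zero]⟩

theorem posT_dressedInt_add_cox (h : X.DiagData r e) (n : ℤ) (a b : Fin X.size) :
    X.posT (dressedInt Y (n + X.cox) a b) =
      MvPowerSeries.C (mono 1 1) * X.posT (dressedInt Y n a b) +
        X.constLoop (X.loopCoeff (n + X.cox) (X.K Y a b)) := by
  have h1 : X.loopCoeff (n + X.cox) (X.K Y a b) = X.loopCoeff 1 (dressedInt Y n a b) := by
    ext1 d
    rw [loopCoeff_K h, dressedInt_add_cox, Matrix.smul_apply, smul_eq_mul, coeff_loopCoeff,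
      coeff_C_mono_mul, one_mul, zero_add, coeff_loopCoeff]
  rw [h1, dressedInt_add_cox, Matrix.smul_apply, smul_eq_mul, posT_mono_mul]

/-- The recursion required by `headT_div_smul`: raising `n` by `h` multiplies by `z`, and the
coefficient of `z⁻¹` that enters the nonnegative part is a coefficient of `K`. -/
theorem flowGen_add_cox (h : X.DiagData r e) (n : ℤ) (a b : Fin X.size) :
    flowGen Y (n + X.cox) a b = mono X.cox 1 • flowGen Y n a b -
      X.constLoop (X.loopCoeff (n + X.cox) (X.K Y a b)) := by
  rw [flowGen, Matrix.of_apply, posT_dressedInt_add_cox h, map_add, map_mul, substT_C_mono,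
    substT_constLoop, mul_one, flowGen, Matrix.of_apply, MvPowerSeries.smul_eq_C_mul]
  ring

/-- The Euler derivative of the recursion for `flowGen`. The constant drops out, and the derivative
of the factor `z` produces the inhomogeneity required by `headT_div_sq_smul`. -/
theorem flowGenEuler_add_cox (h : X.DiagData r e) (n : ℤ) (a b : Fin X.size) :
    flowGenEuler Y (n + X.cox) a b = mono X.cox 1 • flowGenEuler Y n a b -
      mono X.cox 1 • flowGen Y n a b := by
  have h1 : X.eulerT (MvPowerSeries.C (mono 1 1)) = MvPowerSeries.C (mono 1 1) := by
    classical
    ext1 d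
    rw [coeff_eulerT, MvPowerSeries.coeff_C]
    split_ifs
    · rw [euler_mono]; simp
    · exact isDer_euler.zero
  rw [flowGenEuler, Matrix.of_apply, posT_dressedInt_add_cox h, X.isDer_eulerT.add,
    eulerT_constLoop, add_zero, X.isDer_eulerT.mul, h1, map_add, map_mul, map_mul, substT_C_mono,
    mul_one, flowGenEuler, flowGen, Matrix.of_apply, Matrix.of_apply, MvPowerSeries.smul_eq_C_mul,
    MvPowerSeries.smul_eq_C_mul]
  ring

/-- If `n` is negative or not an exponent, `dressedInt` contains no positive powers of `z`, so only
its constant term remains. This makes the coefficients of the star products vanish outside the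
positive exponents. -/
theorem flowGen_eq_constLoop (h : X.DiagData r e) {n : ℤ}
    (hn : ¬ (0 ≤ n ∧ n.toNat ∈ X.exponents)) (a b : Fin X.size) :
    ∃ f : X.TSer, flowGen Y n a b = X.constLoop f := by
  refine ⟨-X.loopCoeff 0 (dressedInt Y n a b), ?_⟩
  rw [flowGen, Matrix.of_apply, posT_eq_constLoop (dressedInt_mem_zFil_zero h hn a b),
    substT_constLoop, map_neg]

theorem flowGenEuler_eq_zero (h : X.DiagData r e) {n : ℤ}
    (hn : ¬ (0 ≤ n ∧ n.toNat ∈ X.exponents)) : flowGenEuler Y n = 0 := by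
  ext1 a b
  rw [flowGenEuler, Matrix.of_apply, posT_eq_constLoop (dressedInt_mem_zFil_zero h hn a b),
    eulerT_constLoop, map_zero]
  rfl

theorem dressed_negT_eq (h : X.DiagData r e) (n : X.Idx) :
    substM ((dressed Y n.1).map X.negT) = substM (dressed Y n.1) + flowGen Y n.1 := by
  ext1 a b
  rw [flowGen, dressedInt_natCast h, Matrix.add_apply, Matrix.of_apply, posT, map_sub]
  simp only [substM, Matrix.map_apply]
  ring

theorem dressed_eulerM_negT_eq (h : X.DiagData r e) (n : X.Idx) :
    substM (X.eulerM ((dressed Y n.1).map X.negT)) =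
      substM (X.eulerM (dressed Y n.1)) - flowGenEuler Y n.1 := by
  ext1 a b
  rw [flowGenEuler, dressedInt_natCast h, Matrix.sub_apply, Matrix.of_apply, posT,
    X.isDer_eulerT.sub, map_sub]
  simp only [substM, eulerM, Matrix.map_apply]
  ring

theorem pderiv_C_mul (n : X.Idx) (c : Loop) (f : X.TLoop) :
    MvPowerSeries.pderiv Loop n (MvPowerSeries.C c * f) =
      MvPowerSeries.C c * MvPowerSeries.pderiv Loop n f := by
  rw [(isDer_pderiv n).mul, MvPowerSeries.pderiv_C, zero_mul, zero_add]

theorem pderiv_superpose (n : X.Idx) (f : ℕ → X.TLoop) :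
    MvPowerSeries.pderiv Loop n (X.superpose f) =
      X.superpose fun a => MvPowerSeries.pderiv Loop n (f a) := by
  rw [superpose, (isDer_pderiv n).sum]
  refine Finset.sum_congr rfl fun a _ => ?_
  rw [pderiv_C_mul, pderiv_substT]

theorem superpose_apply_sum (U : ℕ → X.TMat) (a b : Fin X.size) :
    (∑ c ∈ X.smallExp, (MvPowerSeries.C (mono (-(c : ℤ)) 1) : X.TLoop) • substM (U c)) a b =
      X.superpose fun c => U c a b := by
  rw [Matrix.sum_apply]
  rfl

/-- The negative part of `Θ Λ_n Θ⁻¹` differs from minus its nonnegative part by `Θ Λ_n Θ⁻¹` itself,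
which commutes with `K`. -/
theorem pderivM_K (h : X.DiagData r e) (hsol : X.IsSolution Y) (n : X.Idx) :
    pderivM n (X.K Y) = flowGen Y n.1 * X.K Y - X.K Y * flowGen Y n.1 := by
  have h1 : pderivM n (X.K Y) = ∑ a ∈ X.smallExp,
      (MvPowerSeries.C (mono (-(a : ℤ)) 1) : X.TLoop) • substM (pderivM n (dressed Y a)) := by
    ext1 a b
    rw [superpose_apply_sum, pderivM, Matrix.map_apply, K_apply h, pderiv_superpose]
    rfl
  rw [h1, K_eq_sum h, Finset.mul_sum, Finset.sum_mul, ← Finset.sum_sub_distrib]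
  refine Finset.sum_congr rfl fun a ha => ?_
  have hs : ∀ A B : X.TMat, substM (A - B) = substM A - substM B :=
    fun A B => map_sub X.substT.mapMatrix A B
  have hc : substM (dressed Y n.1) * substM (dressed Y a) =
      substM (dressed Y a) * substM (dressed Y n.1) := by
    rw [← substM_mul, (commute_dressed h n.2 (X.mem_smallExp.mp ha).2).eq, substM_mul]
  have hsub : ∀ (c : X.TLoop) (A B : X.TMat), c • A - c • B = c • (A - B) :=
    fun c A B => (smul_sub c A B).symm
  rw [pderivM_dressed hsol, hs, substM_mul, substM_mul, dressed_negT_eq h, matrix_mul_smul,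
    matrix_smul_mul, hsub, add_mul, mul_add, hc, add_sub_add_left_eq_sub]

/-- Conjugation by `Θ` drops out of the trace because the `Λ_j` commute, and orthogonality leaves
one monomial. It is the source of the rational correction. -/
theorem smul_trace_substM_euler_mul_K (h : X.DiagData r e) (n : X.Idx) :
    X.kappa • (substM (X.eulerM (dressed Y n.1)) * X.K Y).trace =
      MvPowerSeries.C (mono n.1 n.1) := by
  have h1 : X.eulerM (X.const (X.LamJ n.1)) = X.const ((X.LamJ n.1).map euler) := by
    classical
    ext1 a b
    ext1 d
    rw [eulerM_apply, Matrix.map_apply, coeff_eulerT, coeff_const, coeff_const]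
    split_ifs
    · rfl
    · exact isDer_euler.zero
  have h2 : ∀ a ∈ X.exponents, (X.eulerM (dressed Y n.1) * dressed Y a).trace =
      MvPowerSeries.C ((X.LamJ n.1).map euler * X.LamJ a).trace := by
    intro a ha
    have h3 : X.eulerM (dressed Y n.1) = _ :=
      X.isDer_eulerT.dressing (L := X.const (X.LamJ n.1)) (isUnit_det_theta (Y := Y))
    have h4 : (X.const (X.LamJ n.1)).map X.eulerT = X.const ((X.LamJ n.1).map euler) := h1
    have h5 : Commute (X.const (X.LamJ n.1)) (X.const (X.LamJ a)) := by
      rw [commute_iff_eq, ← const_mul, ← const_mul, (h.commute_lam n.2 ha).eq]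
    rw [h3, h4, dressed, trace_dressing_mul isUnit_det_theta h5, ← const_mul]
    exact matrix_trace_map (MvPowerSeries.C : Loop →+* X.TLoop) _
  have h6 : ∀ (c : ℂ) (f : Loop), c • (MvPowerSeries.C f : X.TLoop) = MvPowerSeries.C (c • f) := by
    intro c f
    classical
    ext1 d
    rw [coeff_smul_TLoop, MvPowerSeries.coeff_C, MvPowerSeries.coeff_C]
    split_ifs
    · rfl
    · rw [smul_zero]
  rw [K_eq_sum h, trace_substM_mul_sum, smul_superpose, ← superpose_trace_euler_lam h n.2,
    map_sum]
  refine Finset.sum_congr rfl fun a ha => ?_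
  beta_reduce
  rw [h2 a (X.mem_smallExp.mp ha).2, h6, substT, MvPowerSeries.map_C, map_mul]

/-- With `∂Θ = B Θ`, the two terms in which `B` multiplies the Euler derivative of `Θ` cancel, and
only the Euler derivative of `B` is left. -/
theorem pderiv_trace_euler_theta (hsol : X.IsSolution Y) (n : X.Idx) (j : ℕ) :
    MvPowerSeries.pderiv Loop n
      ((X.Theta Y)⁻¹ * X.eulerM (X.Theta Y) * X.const (X.LamJ j)).trace =
      (X.eulerM ((dressed Y n.1).map X.negT) * dressed Y j).trace := by
  have hT := isUnit_det_theta (Y := Y)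
  have hD := isDer_pderiv (A := Loop) n
  have h2 : (X.const (X.LamJ j)).map (MvPowerSeries.pderiv Loop n) = 0 := pderivM_const n _
  have h3 : (X.Theta Y).map (MvPowerSeries.pderiv Loop n) =
    (dressed Y n.1).map X.negT * X.Theta Y := pderivM_theta hsol n
  have h4 : (X.eulerM (X.Theta Y)).map (MvPowerSeries.pderiv Loop n) =
      X.eulerM ((X.Theta Y).map (MvPowerSeries.pderiv Loop n)) := by
    ext1 a b
    exact (X.eulerT_pderiv (X.Theta Y a b) n).symm
  rw [← hD.trace, hD.matrix_mul, hD.matrix_mul, hD.matrix_inv hT, h2, h4, h3, eulerM_mul, mul_zero,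
    add_zero, ← mul_assoc _ _ (X.Theta Y), mul_assoc (_ * _) (X.Theta Y) (X.Theta Y)⁻¹,
    Matrix.mul_nonsing_inv _ hT, mul_one, mul_add, Matrix.neg_mul, mul_assoc (X.Theta Y)⁻¹ _
      (X.eulerM (X.Theta Y)), neg_add_cancel_comm_assoc, mul_assoc, mul_assoc,
    Matrix.trace_mul_comm, dressed.eq_1 Y j]
  simp only [mul_assoc]

theorem pderiv_firstSeries (h : X.DiagData r e) (hsol : X.IsSolution Y) (n : X.Idx) :
    MvPowerSeries.pderiv Loop n (X.firstSeries Y) =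
      X.kappa • (flowGenEuler Y n.1 * X.K Y).trace - MvPowerSeries.C (mono n.1 n.1) := by
  rw [firstSeries, (isDer_pderiv n).neg, smul_TLoop, pderiv_C_mul, pderiv_superpose,
    ← smul_TLoop]
  simp only [pderiv_trace_euler_theta hsol]
  rw [← trace_substM_mul_sum, ← K_eq_sum h, dressed_eulerM_negT_eq h, sub_mul, Matrix.trace_sub,
    ← smul_trace_substM_euler_mul_K h n]
  simp only [smul_TLoop]
  ring

end AffType

end DrinfeldSokolov

namespace DrinfeldSokolov

/-! ### The correction of the two-point series -/

section Correction

variable {m : ℕ}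

theorem zeta_succ (i : Fin m) : (zeta i.succ : MultiLoop (m + 1)) = tailEmb (zeta i) := inVar_succ _ _

theorem headCoeff_tailEmb (n : ℤ) (f : MultiLoop m) :
    headCoeff n (tailEmb f) = if n = 0 then f else 0 := by
  have h1 := headCoeff_inVar_zero (m := m) n 1
  rw [map_one, HahnSeries.coeff_one] at h1
  rw [← mul_one (tailEmb f), headCoeff_tailEmb_mul, h1]
  split_ifs <;> simp

theorem tailEmb_C (c : ℂ) : tailEmb (HahnSeries.C c : MultiLoop m) = HahnSeries.C c :=
  HahnSeries.embDomainRingHom_C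

end Correction

namespace AffType

variable {X : AffType} {Y : X.TMatNeg} {r : Fin X.size → ℤ} {e : ℕ → Fin X.size → ℂ}

open scoped Classical in
/-- `n x ^ n` if `n` is a positive exponent, and `0` otherwise. -/
def expMono (X : AffType) (n : ℤ) : Loop :=
  mono n (if 0 ≤ n ∧ n.toNat ∈ X.exponents then n else 0)

theorem mono_second_difference (h k : ℤ) (a b c : ℂ) :
    mono h 1 * (mono h 1 * mono k a - mono (k + h) b) -
      (mono h 1 * mono (k + h) b - mono (k + h + h) c) = mono (k + h + h) (a - 2 * b + c) := by
  have hs : ∀ c d : ℂ, mono (k + h + h) (c - d) = mono (k + h + h) c - mono (k + h + h) d := by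
    intro c d
    simp [mono]
  rw [mul_sub, mono_mul_mono, mono_mul_mono, mono_mul_mono, one_mul, one_mul, one_mul,
    add_comm h (k + h), show h + (h + k) = k + h + h by ring, show a - 2 * b + c = a - b - (b - c) by ring,
    hs, hs, hs]

theorem add_cox_mem {n : ℤ} (hn : 0 ≤ n) :
    (0 ≤ n + X.cox ∧ (n + X.cox).toNat ∈ X.exponents) ↔ (0 ≤ n ∧ n.toNat ∈ X.exponents) := by
  have h1 : (n + X.cox).toNat = n.toNat + X.cox := by omega
  rw [h1, add_cox_mem_exponents]
  constructor <;> intro h <;> exact ⟨by omega, h.2⟩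

open scoped Classical in
theorem sum_smallExp_ite (f : ℕ → Loop) (k : ℤ) :
    (∑ j ∈ X.smallExp, if k = j then f j else 0) = if k.toNat ∈ X.smallExp then f k.toNat else 0 := by
  have h1 : ∀ j ∈ X.smallExp, (if k = (j : ℤ) then f j else 0) = if k.toNat = j then f j else 0 := by
    intro j hj
    have := X.pos_of_mem_exponents (X.mem_smallExp.mp hj).2
    congr 1
    exact propext ⟨fun h => by omega, fun h => by omega⟩
  rw [Finset.sum_congr rfl h1, Finset.sum_ite_eq]

-- Along each residue class modulo `h` the coefficients of `expMono` are linear in `n`, so their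
-- second difference in steps of `h` vanishes except where the sequence starts. The first two
-- positions there give the two monomials of the numerator.
open scoped Classical in
theorem correction_recursion (n : ℤ) :
    (∑ j ∈ X.smallExp, ((if n + j = 0 then mono (2 * X.cox - j : ℤ) j else 0) +
      (if n + (2 * X.cox - j : ℕ) = 0 then mono j j else 0))) =
    mono X.cox 1 * (mono X.cox 1 * X.expMono n - X.expMono (n + X.cox)) -
      (mono X.cox 1 * X.expMono (n + X.cox) - X.expMono (n + X.cox + X.cox)) := by
  have hc := X.cox_pos
  have h1 : ∀ j ∈ X.smallExp, ((if n + j = 0 then mono (2 * X.cox - j : ℤ) j else 0) +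
      (if n + (2 * X.cox - j : ℕ) = 0 then mono j j else 0) : Loop) =
      (if -n = j then mono (2 * X.cox - j : ℤ) j else 0) +
      (if n + 2 * X.cox = j then mono j j else 0) := by
    intro j hj
    have := (X.mem_smallExp.mp hj).1
    congr 1
    · congr 1
      exact propext ⟨fun h => by omega, fun h => by omega⟩
    · congr 1
      exact propext ⟨fun h => by omega, fun h => by omega⟩
  rw [Finset.sum_congr rfl h1, Finset.sum_add_distrib,
    sum_smallExp_ite (fun j => mono (2 * X.cox - j : ℤ) j), sum_smallExp_ite (fun j => mono j j)]
  have h0 : 0 ∉ X.smallExp := fun h => X.zero_notMem_exponents (X.mem_smallExp.mp h).2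
  have hbig : ∀ k : ℤ, (X.cox : ℤ) ≤ k → k.toNat ∉ X.smallExp := by
    intro k hk h
    have := (X.mem_smallExp.mp h).1
    omega
  have hneg : ∀ k : ℤ, k ≤ 0 → k.toNat ∉ X.smallExp := by
    intro k hk h
    rw [Int.toNat_of_nonpos hk] at h
    exact h0 h
  have hsmall : ∀ k : ℤ, k < X.cox →
      ((0 ≤ k ∧ k.toNat ∈ X.exponents) ↔ k.toNat ∈ X.smallExp) := by
    intro k hk
    rw [mem_smallExp]
    constructor
    · exact fun h => ⟨by omega, h.2⟩
    · refine fun h => ⟨?_, h.2⟩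
      have := X.pos_of_mem_exponents h.2
      omega
  have hleft : ((if (-n).toNat ∈ X.smallExp then
        mono (2 * X.cox - (-n).toNat : ℤ) ((-n).toNat : ℂ) else 0) +
      if (n + 2 * X.cox).toNat ∈ X.smallExp then
        mono ((n + 2 * X.cox).toNat : ℤ) ((n + 2 * X.cox).toNat : ℂ) else 0) =
      mono (n + X.cox + X.cox) ((if (-n).toNat ∈ X.smallExp then ((-n : ℤ) : ℂ) else 0) +
        (if (n + 2 * X.cox).toNat ∈ X.smallExp then ((n + 2 * X.cox : ℤ) : ℂ) else 0)) := by
    have hpos : ∀ {k : ℤ}, k.toNat ∈ X.smallExp → ((k.toNat : ℕ) : ℤ) = k := by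
      intro k hk
      have := X.pos_of_mem_exponents (X.mem_smallExp.mp hk).2
      omega
    rw [mono_add]
    congr 1
    · split_ifs with hk
      · have h3 := hpos hk
        exact mono_congr (by rw [h3]; ring) (by rw [← Int.cast_natCast, h3])
      · rw [mono_zero_right]
    · split_ifs with hk
      · have h3 := hpos hk
        exact mono_congr (by rw [h3]; ring) (by rw [← Int.cast_natCast, h3])
      · rw [mono_zero_right]
  rw [hleft, expMono, expMono, expMono, mono_second_difference]
  congr 1
  have hout : ∀ k : ℤ, k < 0 → ¬ (0 ≤ k ∧ k.toNat ∈ X.exponents) := fun k hk h => by omega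
  rcases le_or_gt 0 n with h | h
  · rw [if_neg (hneg _ (by omega)), if_neg (hbig _ (by omega)),
      if_congr ((add_cox_mem (by omega)).trans (add_cox_mem h)) rfl rfl,
      if_congr (add_cox_mem h) rfl rfl]
    split_ifs
    · push_cast; ring
    · simp
  -- For `-h ≤ n < 0` the second difference is `-2 (n + h) + (n + 2 h) = -n`; the symmetry `a ↦ h -
  -- a` of the exponents matches the conditions on the two sides. Below `-h` only the value at `n +
  -- 2 h` can be nonzero.
  rcases le_or_gt (-(X.cox : ℤ)) n with h2 | h2
  · rw [if_neg (hbig (n + 2 * X.cox) (by omega)), if_neg (hout n h),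
      if_congr (add_cox_mem (X := X) (n := n + X.cox) (by omega)) rfl rfl]
    have hiff : (-n).toNat ∈ X.smallExp ↔ (0 ≤ n + X.cox ∧ (n + X.cox).toNat ∈ X.exponents) := by
      rw [hsmall _ (by omega), mem_smallExp, mem_smallExp]
      constructor
      · intro h3
        have h4 := X.cox_sub_mem_exponents h3.1 h3.2
        have h5 := X.pos_of_mem_exponents h3.2
        have h6 : (n + X.cox).toNat = X.cox - (-n).toNat := by omega
        rw [h6]
        exact ⟨by omega, h4⟩
      · intro h3
        have h4 := X.cox_sub_mem_exponents h3.1 h3.2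
        have h5 := X.pos_of_mem_exponents h3.2
        have h6 : (-n).toNat = X.cox - (n + X.cox).toNat := by omega
        rw [h6]
        exact ⟨by omega, h4⟩
    rw [if_congr hiff rfl rfl]
    split_ifs
    · push_cast; ring
    · simp
  · rw [if_neg (hbig (-n) (by omega)), if_neg (hout n h), if_neg (hout (n + X.cox) (by omega)),
      show n + X.cox + X.cox = n + 2 * X.cox by ring]
    by_cases h3 : n + 2 * X.cox < X.cox
    · rw [if_congr (hsmall _ h3) rfl rfl]
      simp
    · omega

variable (X) in
/-- The rational function that corrects the two-point series. -/
theorem headT_correction (n : ℤ) : X.headT (m := 1) n (MvPowerSeries.C (∑ j ∈ X.smallExp,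
      (j : MultiLoop 2) * (zeta 0 ^ j * zeta 1 ^ (2 * X.cox - j) +
        zeta 0 ^ (2 * X.cox - j) * zeta 1 ^ j) / (zeta 0 ^ X.cox - zeta 1 ^ X.cox) ^ 2)) =
    MvPowerSeries.C (inVar 0 (X.expMono n)) := by
  classical
  set f : MultiLoop 2 := ∑ j ∈ X.smallExp,
      (j : MultiLoop 2) * (zeta 0 ^ j * zeta 1 ^ (2 * X.cox - j) +
        zeta 0 ^ (2 * X.cox - j) * zeta 1 ^ j) / (zeta 0 ^ X.cox - zeta 1 ^ X.cox) ^ 2 with hf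
  have hz : (zeta 1 : MultiLoop 2) = tailEmb (zeta 0) := zeta_succ 0
  have hne : (zeta 1 ^ X.cox - zeta 0 ^ X.cox : MultiLoop 2) ≠ 0 :=
    sub_zeta_ne_zero X.cox_pos (by decide)
  have hC : ∀ (g : MultiLoop 2) (n : ℤ), X.headT (m := 1) n (MvPowerSeries.C g) =
      MvPowerSeries.C (headCoeff n g) := by
    intro g n
    ext1 d
    rw [coeff_headT, MvPowerSeries.coeff_C, MvPowerSeries.coeff_C]
    split_ifs
    · rfl
    · exact map_zero _
  have hmul : ∀ (g : MultiLoop 2) (n : ℤ),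
      zeta 0 ^ X.cox * headCoeff n g - headCoeff (n + X.cox) g =
        headCoeff n ((zeta 1 ^ X.cox - zeta 0 ^ X.cox) * g) := by
    intro g n
    rw [sub_mul, map_sub, headCoeff_zeta_pow_mul, hz, ← map_pow, headCoeff_tailEmb_mul]
  have hnum : (zeta 1 ^ X.cox - zeta 0 ^ X.cox) * ((zeta 1 ^ X.cox - zeta 0 ^ X.cox) * f) =
      ∑ j ∈ X.smallExp, (j : MultiLoop 2) * (zeta 0 ^ j * zeta 1 ^ (2 * X.cox - j) +
        zeta 0 ^ (2 * X.cox - j) * zeta 1 ^ j) := by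
    rw [← mul_assoc, hf, Finset.mul_sum]
    refine Finset.sum_congr rfl fun j _ => ?_
    have hne' : (zeta 0 ^ X.cox - zeta 1 ^ X.cox : MultiLoop 2) ≠ 0 := by
      rw [← neg_sub]
      exact neg_ne_zero.mpr hne
    field_simp
    ring
  have hhead : ∀ n : ℤ, headCoeff n ((zeta 1 ^ X.cox - zeta 0 ^ X.cox) *
      ((zeta 1 ^ X.cox - zeta 0 ^ X.cox) * f)) = inVar (0 : Fin 1)
        (mono X.cox 1 * (mono X.cox 1 * X.expMono n - X.expMono (n + X.cox)) -
      (mono X.cox 1 * X.expMono (n + X.cox) - X.expMono (n + X.cox + X.cox))) := by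
    intro n
    rw [hnum, ← correction_recursion, map_sum, map_sum]
    refine Finset.sum_congr rfl fun j hj => ?_
    have hj' := (X.mem_smallExp.mp hj).1
    have h1 : (j : MultiLoop 2) = tailEmb (inVar 0 (mono 0 (j : ℂ))) := by
      have : mono 0 (j : ℂ) = ((j : ℕ) : Loop) := by
        rw [← map_natCast (HahnSeries.C (Γ := ℤ) (R := ℂ)) j, mono, neg_zero]
        rfl
      rw [this, map_natCast, map_natCast]
    have h2 : ∀ s : ℕ, (zeta 1 ^ s : MultiLoop 2) = tailEmb (inVar 0 (mono s 1)) := by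
      intro s
      rw [hz, ← map_pow, zeta_pow]
    rw [h1, headCoeff_tailEmb_mul, map_add, headCoeff_zeta_pow_mul, headCoeff_zeta_pow_mul, h2, h2,
      headCoeff_tailEmb, headCoeff_tailEmb, map_add, mul_add]
    congr 1
    · split_ifs
      · rw [← map_mul, mono_mul_mono, zero_add, mul_one]
        congr 2
        omega
      · rw [mul_zero, map_zero]
    · split_ifs
      · rw [← map_mul, mono_mul_mono, zero_add, mul_one]
      · rw [mul_zero, map_zero]
  have hz0 : (zeta 0 ^ X.cox : MultiLoop 1) = inVar 0 (mono X.cox 1) := zeta_pow _ _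
  have hev : ∀ n : ℤ, n < -(2 * X.cox) → X.expMono n = 0 ∧ X.expMono (n + X.cox) = 0 := by
    intro n hn
    have h3 : ∀ k : ℤ, k < 0 → X.expMono k = 0 := fun k hk => by
      rw [expMono, if_neg (by omega), mono_zero_right]
    exact ⟨h3 _ (by omega), h3 _ (by omega)⟩
  -- The double pole is inverted one factor at a time, each time by uniqueness of the solution of
  -- the recursion.
  have hstep : ∀ n, headCoeff n ((zeta 1 ^ X.cox - zeta 0 ^ X.cox) * f) = inVar (0 : Fin 1)
      (mono X.cox 1 * X.expMono n - X.expMono (n + X.cox)) := by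
    intro n
    have h4 := X.headT_eq_of_recursion X.cox_pos (zeta 0 ^ X.cox : MultiLoop 1)
      (MvPowerSeries.C ((zeta 1 ^ X.cox - zeta 0 ^ X.cox) * f))
      (fun n => MvPowerSeries.C (inVar (0 : Fin 1)
        (mono X.cox 1 * X.expMono n - X.expMono (n + X.cox))))
      ⟨-(2 * X.cox), fun n hn => by
        rw [(hev n hn).1, (hev n hn).2, mul_zero, sub_zero, map_zero, map_zero]⟩
      (fun n => by
        rw [hC, hC, MvPowerSeries.smul_eq_C_mul, ← map_mul, ← map_sub, hmul, hhead,
          MvPowerSeries.smul_eq_C_mul, ← map_mul, ← map_sub, hz0, ← map_mul, ← map_sub]) n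
    rw [hC] at h4
    exact MvPowerSeries.C_injective h4
  exact X.headT_eq_of_recursion X.cox_pos (zeta 0 ^ X.cox : MultiLoop 1)
      (MvPowerSeries.C f) (fun n => MvPowerSeries.C (inVar (0 : Fin 1) (X.expMono n)))
      ⟨-(2 * X.cox), fun n hn => by rw [(hev n hn).1, map_zero, map_zero]⟩
      (fun n => by
        rw [hC, hC, MvPowerSeries.smul_eq_C_mul, ← map_mul, ← map_sub, hmul, hstep,
          MvPowerSeries.smul_eq_C_mul, ← map_mul, ← map_sub, hz0, ← map_mul, ← map_sub]) n

end AffType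

end DrinfeldSokolov

namespace DrinfeldSokolov

theorem map_starFactor {F F' : Type*} [Field F] [Field F'] (φ : F →+* F') {m : ℕ} (x : Fin m → F) :
    φ (starFactor x) = starFactor fun i => φ (x i) := by
  rw [starFactor, starFactor, map_div₀, map_prod, map_prod]
  simp only [map_sub]

theorem map_map_of_eq_bracket {R S n : Type*} [CommRing R] [CommRing S] [Fintype n] (φ : R →+* S)
    {D : R → R} {D' : S → S} (hD : ∀ f, D' (φ f) = φ (D f)) {A B : Matrix n n R}
    (hA : A.map D = B * A - A * B) :
    (A.map φ).map D' = B.map φ * A.map φ - A.map φ * B.map φ := by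
  rw [← Matrix.map_mul, ← Matrix.map_mul, ← Matrix.map_sub _ (map_sub φ), ← hA]
  ext1 a b
  exact hD _

theorem trace_mul_map {R S n : Type*} [CommRing R] [CommRing S] [Fintype n] (φ : R →+* S)
    (A B : Matrix n n R) : (A.map φ * B.map φ).trace = φ (A * B).trace := by
  rw [← Matrix.map_mul]
  exact (AddMonoidHom.map_trace φ _).symm

namespace AffType

variable {X : AffType} {Y : X.TMatNeg} {r : Fin X.size → ℤ} {e : ℕ → Fin X.size → ℂ} {m : ℕ}

/-! ### The sum over permutations -/

/-- The sum of the traces of the star products of the `K(ζ_{ρ(i)})` over all permutations `ρ`. -/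
def starSum (Y : X.TMatNeg) (m : ℕ) : X.TMulti m :=
  ∑ ρ : Equiv.Perm (Fin m), starFactor ((fun i => (zeta i : MultiLoop m) ^ X.cox) ∘ ρ) •
    cycTrace ((fun i => (X.K Y).map (X.atVar i)) ∘ ρ)

theorem trace_star (x : Fin m → MultiLoop m)
    (M : Fin m → Matrix (Fin X.size) (Fin X.size) (X.TMulti m)) :
    Matrix.trace (X.star x M) = starFactor (fun i => x i ^ X.cox) • cycTrace M := by
  rw [star, Matrix.trace_smul]
  rfl

theorem coeff_smul_TMulti (c : ℂ) (f : X.TMulti m) (d : X.Idx →₀ ℕ) :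
    MvPowerSeries.coeff d (c • f) = c • MvPowerSeries.coeff d f := rfl

theorem smul_TMulti (c : ℂ) (f : X.TMulti m) : c • f = (HahnSeries.C c : MultiLoop m) • f := by
  ext1 d
  rw [coeff_smul_TMulti, MvPowerSeries.coeff_smul, HahnSeries.C_mul_eq_smul]

theorem sum_smul_trace_star :
    (1 / (m : ℂ)) • ∑ rho : Equiv.Perm (Fin m), X.kappa • Matrix.trace
      (X.star (fun i => zeta (rho i)) (fun i => (X.K Y).map (X.atVar (rho i)))) =
    (HahnSeries.C (X.kappa / m) : MultiLoop m) • starSum Y m := by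
  rw [← smul_TMulti, starSum, ← Finset.smul_sum]
  ext1 d
  rw [coeff_smul_TMulti, coeff_smul_TMulti, coeff_smul_TMulti, smul_smul]
  congr 1
  · ring
  · congr 1
    exact Finset.sum_congr rfl fun ρ _ => trace_star _ _

theorem headT_smul_trace (n : ℤ) (c : MultiLoop (m + 1))
    (A : Matrix (Fin X.size) (Fin X.size) (X.TMulti (m + 1)))
    (Q G : Matrix (Fin X.size) (Fin X.size) (X.TMulti m))
    (hG : ∀ a b, X.headT n (c • A a b) = G a b) :
    X.headT n (c • (A * Q.map X.tailT).trace) = (G * Q).trace := by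
  rw [Matrix.trace, Matrix.trace, Finset.smul_sum, map_sum]
  refine Finset.sum_congr rfl fun a _ => ?_
  rw [Matrix.diag_apply, Matrix.diag_apply, Matrix.mul_apply, Matrix.mul_apply, Finset.smul_sum,
    map_sum]
  refine Finset.sum_congr rfl fun b _ => ?_
  rw [Matrix.map_apply, ← hG a b, mul_comm (X.headT n _), ← headT_tailT_mul,
    MvPowerSeries.smul_eq_C_mul, MvPowerSeries.smul_eq_C_mul]
  congr 1
  ring

theorem prod_ofFn_atVar_succ {k : ℕ} (K : X.TMat) (σ : Fin k → Fin m) :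
    (List.ofFn fun i => K.map (X.atVar (σ i).succ)).prod =
      (List.ofFn fun i => K.map (X.atVar (σ i))).prod.map X.tailT := by
  have h1 : ∀ i, K.map (X.atVar (σ i).succ) = X.tailT.mapMatrix (K.map (X.atVar (σ i))) := by
    intro i
    ext1 a b
    rw [RingHom.mapMatrix_apply, Matrix.map_apply, Matrix.map_apply, Matrix.map_apply, atVar_succ]
  rw [← RingHom.mapMatrix_apply, map_list_prod, List.map_ofFn]
  simp only [h1]
  rfl

theorem headT_div_smul_trace (h : X.DiagData r e) (n : ℤ) (i : Fin m)
    (Q : Matrix (Fin X.size) (Fin X.size) (X.TMulti m)) :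
    X.headT n ((zeta 0 ^ X.cox / (zeta i.succ ^ X.cox - zeta 0 ^ X.cox)) •
      ((X.K Y).map (X.atVar (0 : Fin (m + 1))) * Q.map X.tailT).trace) =
    ((flowGen Y n).map (X.atVar i) * Q).trace :=
  headT_smul_trace n _ _ _ _ fun a b => X.headT_div_smul i (X.K Y a b) (fun n => flowGen Y n a b)
    (exists_flowGen_eq_zero h a b) (fun n => flowGen_add_cox h n a b) n

/-- Cyclic invariance puts `ζ₁` first, and `starFactor_cons` leaves simple poles at its two
neighbours, whose expansions have the coefficients `flowGen`. -/
theorem headT_starSum (h : X.DiagData r e) (n : ℤ) (k : ℕ) :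
    X.headT n (starSum Y (k + 3)) = (k + 3) • ∑ π : Equiv.Perm (Fin (k + 2)),
      starFactor ((fun i => (zeta i : MultiLoop (k + 2)) ^ X.cox) ∘ π) •
        Matrix.trace (((flowGen Y n).map (X.atVar (π 0)) -
          (flowGen Y n).map (X.atVar (π (Fin.last _)))) *
          (List.ofFn ((fun i => (X.K Y).map (X.atVar i)) ∘ π)).prod) := by
  rw [starSum, sum_perm_star, map_nsmul, map_sum]
  congr 1
  refine Finset.sum_congr rfl fun π _ => ?_
  have hinj : ∀ {i j : Fin (k + 3)}, i ≠ j → (zeta i : MultiLoop (k + 3)) ^ X.cox ≠ zeta j ^ X.cox :=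
    fun hij h0 => hij (zeta_pow_injective X.cox_pos h0)
  rw [starFactor_cons _ _ (hinj (Fin.succ_ne_zero _)) (hinj (Fin.succ_ne_zero _))
    (hinj fun h0 => by
      have h1 := π.injective (Fin.succ_injective _ h0)
      simp [Fin.ext_iff] at h1)]
  have h1 : starFactor (fun i => (zeta (π i).succ : MultiLoop (k + 3)) ^ X.cox) =
      tailEmb (starFactor ((fun i => (zeta i : MultiLoop (k + 2)) ^ X.cox) ∘ π)) := by
    rw [map_starFactor]
    simp only [zeta_succ, Function.comp_apply, map_pow]
  rw [h1, mul_smul, headT_tailEmb_smul, sub_smul, map_sub, prod_ofFn_atVar_succ,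
    headT_div_smul_trace h, headT_div_smul_trace h, ← Matrix.trace_sub, ← sub_mul]
  rfl

theorem atVar_flowGen (h : X.DiagData r e) {n : ℤ} (hn : ¬ (0 ≤ n ∧ n.toNat ∈ X.exponents))
    (i j : Fin m) : (flowGen Y n).map (X.atVar i) = (flowGen Y n).map (X.atVar j) := by
  ext1 a b
  obtain ⟨f, hf⟩ := flowGen_eq_constLoop h hn a b
  rw [Matrix.map_apply, Matrix.map_apply, hf, atVar_constLoop, atVar_constLoop]

theorem map_atVar_pderiv (h : X.DiagData r e) (hsol : X.IsSolution Y) (n : X.Idx) (i : Fin m) :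
    ((X.K Y).map (X.atVar i)).map (MvPowerSeries.pderiv (MultiLoop m) n) =
      (flowGen Y n.1).map (X.atVar i) * (X.K Y).map (X.atVar i) -
        (X.K Y).map (X.atVar i) * (flowGen Y n.1).map (X.atVar i) := by
  exact map_map_of_eq_bracket (X.atVar i) (fun f => pderiv_map _ f n) (pderivM_K h hsol n)

/-- The difference of the generators at the two ends becomes the commutator of `flowGen` with `K`,
that is, the time derivative of one factor. The weights count the rotations of words of length `k +
2` and `k + 3`. -/
theorem headT_starSum_of_mem (h : X.DiagData r e) (hsol : X.IsSolution Y) (n : X.Idx) (k : ℕ) :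
    (k + 2) • X.headT n.1 (starSum Y (k + 3)) =
      (k + 3) • MvPowerSeries.pderiv (MultiLoop (k + 2)) n (starSum Y (k + 2)) := by
  rw [headT_starSum h, smul_comm]
  congr 1
  rw [sum_smul_trace_last (fun i => (zeta i : MultiLoop (k + 2)) ^ X.cox)
    (fun i => (X.K Y).map (X.atVar i)) (fun i => (flowGen Y n.1).map (X.atVar i)), starSum, map_sum]
  have h1 := sum_smul_derivation_cycTrace (isDer_pderiv (A := MultiLoop (k + 2)) n)
    (fun i => (zeta i : MultiLoop (k + 2)) ^ X.cox) (fun i => (X.K Y).map (X.atVar i))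
  simp only [map_atVar_pderiv h hsol] at h1
  rw [← h1]
  refine Finset.sum_congr rfl fun ρ _ => ?_
  exact (Derivation.map_smul _ _ _).symm

theorem headT_starSum_of_notMem (h : X.DiagData r e) {n : ℤ}
    (hn : ¬ (0 ≤ n ∧ n.toNat ∈ X.exponents)) (k : ℕ) :
    X.headT n (starSum Y (k + 3)) = 0 := by
  rw [headT_starSum h, Finset.sum_eq_zero, smul_zero]
  intro π _
  rw [atVar_flowGen h hn (π 0) (π (Fin.last _)), sub_self, zero_mul, Matrix.trace_zero, smul_zero]

theorem headT_starSum_two (h : X.DiagData r e) (n : ℤ) :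
    X.headT n (starSum Y 2) = 2 • -X.atVar (0 : Fin 1) (flowGenEuler Y n * X.K Y).trace := by
  rw [starSum, sum_perm_star, map_nsmul]
  refine congrArg (fun f : X.TMulti 1 => 2 • f) ?_
  rw [Fintype.sum_subsingleton _ (1 : Equiv.Perm (Fin 1))]
  have h1 : (Fin.cons ((zeta 0 : MultiLoop 2) ^ X.cox)
      (fun i : Fin 1 => zeta ((1 : Equiv.Perm (Fin 1)) i).succ ^ X.cox) : Fin 2 → MultiLoop 2) =
      Fin.cons (zeta 0 ^ X.cox) (fun _ => zeta (Fin.succ (0 : Fin 1)) ^ X.cox) := by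
    congr 1
    funext i
    rw [Equiv.Perm.one_apply, Subsingleton.elim i 0]
  rw [h1, starFactor_two, neg_smul, map_neg, prod_ofFn_atVar_succ]
  congr 1
  refine (headT_smul_trace n _ _ _ ((flowGenEuler Y n).map (X.atVar 0)) fun a b =>
    X.headT_div_sq_smul (0 : Fin 1) (X.K Y a b) (fun n => flowGen Y n a b)
      (fun n => flowGenEuler Y n a b) (exists_flowGen_eq_zero h a b)
      (exists_flowGenEuler_eq_zero h a b) (fun n => flowGen_add_cox h n a b)
      (fun n => flowGenEuler_add_cox h n a b) n).trans ?_
  simp only [List.ofFn_succ, List.ofFn_zero, List.prod_cons, List.prod_nil, mul_one]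
  exact trace_mul_map _ _ _

/-! ### The generating series -/

theorem headT_C_smul (n : ℤ) (c : ℂ) (f : X.TMulti (m + 1)) :
    X.headT n ((HahnSeries.C c : MultiLoop (m + 1)) • f) =
      (HahnSeries.C c : MultiLoop m) • X.headT n f := by
  rw [← tailEmb_C, headT_tailEmb_smul]

theorem C_smul_atVar (i : Fin m) (c : ℂ) (f : X.TLoop) :
    X.atVar i (c • f) = (HahnSeries.C c : MultiLoop m) • X.atVar i f := by
  rw [smul_TLoop, map_mul, MvPowerSeries.smul_eq_C_mul, atVar, MvPowerSeries.map_C, inVar_mono,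
    neg_zero, map_zero]
  rfl

/-- For a positive exponent `n` both sides have the coefficient `κ Tr (flowGenEuler K) - n ζ ^ n`,
the monomial coming from the correction; for all other `n` both coefficients vanish. -/
theorem genSeries_two (h : X.DiagData r e) (hY : X.IsNegative Y) (hsol : X.IsSolution Y)
    {tau : X.TSer} (htau : X.IsTau Y tau) : X.genSeries tau 2 =
      -((HahnSeries.C (X.kappa / 2) : MultiLoop 2) • starSum Y 2) -
        MvPowerSeries.C (∑ j ∈ X.smallExp,
          (j : MultiLoop 2) * (zeta 0 ^ j * zeta 1 ^ (2 * X.cox - j) +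
            zeta 0 ^ (2 * X.cox - j) * zeta 1 ^ j) / (zeta 0 ^ X.cox - zeta 1 ^ X.cox) ^ 2) := by
  classical
  refine X.headT_ext (m := 1) fun n => ?_
  have hmain : X.headT n (-((HahnSeries.C (X.kappa / 2) : MultiLoop 2) • starSum Y 2)) =
      X.atVar (0 : Fin 1) (X.kappa • (flowGenEuler Y n * X.K Y).trace) := by
    rw [map_neg, headT_C_smul, headT_starSum_two h, C_smul_atVar, two_nsmul, ← neg_add,
      smul_neg, neg_neg, ← two_smul (MultiLoop 1), smul_smul]
    congr 1
    rw [← map_ofNat (HahnSeries.C (Γ := Lex (Fin 1 → ℤ)) (R := ℂ)) 2, ← map_mul,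
      div_mul_cancel₀ _ two_ne_zero]
  rw [headT_genSeries, map_sub, hmain, headT_correction, genSeries_one h hY htau, expMono]
  split_ifs with hn
  · rw [atVar, pderiv_map, pderiv_firstSeries h hsol, map_sub, MvPowerSeries.map_C]
    simp only [Int.toNat_of_nonneg hn.1]
    congr 4
    exact_mod_cast (Int.toNat_of_nonneg hn.1)
  · rw [flowGenEuler_eq_zero h hn, zero_mul, Matrix.trace_zero, mono_zero_right, map_zero, map_zero,
      sub_zero, smul_TLoop, mul_zero, map_zero]

/-- The correction `c` does not depend on the times, so a time derivative kills it. It can therefore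
be present in the case of two points only. -/
theorem genSeries_succ (h : X.DiagData r e) (hsol : X.IsSolution Y) {tau : X.TSer} {k : ℕ}
    {c : MultiLoop (k + 2)}
    (hk : X.genSeries tau (k + 2) =
      -((HahnSeries.C (X.kappa / (k + 2 : ℕ)) : MultiLoop (k + 2)) • starSum Y (k + 2)) -
        MvPowerSeries.C c) :
    X.genSeries tau (k + 3) =
      -((HahnSeries.C (X.kappa / (k + 3 : ℕ)) : MultiLoop (k + 3)) • starSum Y (k + 3)) := by
  classical
  refine X.headT_ext (m := k + 2) fun n => ?_
  rw [headT_genSeries, map_neg, headT_C_smul]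
  split_ifs with hn
  · have h1 := headT_starSum_of_mem h hsol ⟨n.toNat, hn.2⟩ k
    rw [Int.toNat_of_nonneg hn.1] at h1
    rw [hk, map_sub, MvPowerSeries.pderiv_C, sub_zero, map_neg, Derivation.map_smul]
    congr 1
    have hC : ∀ (j : ℕ) (f : X.TMulti (k + 2)), j • f = (HahnSeries.C (j : ℂ) : MultiLoop (k + 2)) • f := by
      intro j f
      rw [map_natCast, Nat.cast_smul_eq_nsmul]
    rw [hC, hC] at h1
    have h3 : (HahnSeries.C (X.kappa / (k + 2 : ℕ)) : MultiLoop (k + 2)) =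
        HahnSeries.C (X.kappa / ((k + 2 : ℕ) * (k + 3 : ℕ))) * HahnSeries.C ((k + 3 : ℕ) : ℂ) := by
      rw [← map_mul]
      congr 1
      have : ((k + 3 : ℕ) : ℂ) ≠ 0 := Nat.cast_ne_zero.mpr (by omega)
      have : ((k + 2 : ℕ) : ℂ) ≠ 0 := Nat.cast_ne_zero.mpr (by omega)
      field_simp
    have h4 : (HahnSeries.C (X.kappa / (k + 3 : ℕ)) : MultiLoop (k + 2)) =
        HahnSeries.C (X.kappa / ((k + 2 : ℕ) * (k + 3 : ℕ))) * HahnSeries.C ((k + 2 : ℕ) : ℂ) := by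
      rw [← map_mul]
      congr 1
      have : ((k + 3 : ℕ) : ℂ) ≠ 0 := Nat.cast_ne_zero.mpr (by omega)
      have : ((k + 2 : ℕ) : ℂ) ≠ 0 := Nat.cast_ne_zero.mpr (by omega)
      field_simp
    rw [h3, h4, mul_smul, mul_smul, h1]
  · rw [headT_starSum_of_notMem h hn, smul_zero, neg_zero]

theorem genSeries_add_three (h : X.DiagData r e) (hY : X.IsNegative Y) (hsol : X.IsSolution Y)
    {tau : X.TSer} (htau : X.IsTau Y tau) (k : ℕ) :
    X.genSeries tau (k + 3) =
      -((HahnSeries.C (X.kappa / (k + 3 : ℕ)) : MultiLoop (k + 3)) • starSum Y (k + 3)) := by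
  induction k with
  | zero => exact genSeries_succ h hsol (genSeries_two h hY hsol htau)
  | succ k ih =>
    refine genSeries_succ h hsol (c := 0) ?_
    rw [map_zero, sub_zero]
    exact ih

end AffType

end DrinfeldSokolov

end

theorem mainTheorem7 (X : DrinfeldSokolov.AffType) (Y : X.TMatNeg) (hY : X.IsNegative Y)
    (hsol : X.IsSolution Y) (tau : X.TSer) (htau : X.IsTau Y tau) :
    (X.genSeries tau 1 = X.atVar 0
      ((X.kappa / (X.cox : ℂ)) •
          Matrix.trace ((X.Psi Y).map X.eulerT * (X.Psi Y)⁻¹ * X.const X.bigD)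
        - X.linear fun j => DrinfeldSokolov.mono (j.1 : ℤ) (j.1 : ℂ))) ∧
    ∀ (m : ℕ) (hm : 2 ≤ m),
      X.genSeries tau m =
        -((1 / (m : ℂ)) • ∑ rho : Equiv.Perm (Fin m),
            X.kappa • Matrix.trace
              (X.star (fun i => DrinfeldSokolov.zeta (rho i))
                (fun i => (X.K Y).map (X.atVar (rho i)))))
        - (if m = 2 then
            MvPowerSeries.C (∑ j ∈ X.smallExp,
              let x : DrinfeldSokolov.MultiLoop m := DrinfeldSokolov.zeta ⟨0, by omega⟩
              let y : DrinfeldSokolov.MultiLoop m := DrinfeldSokolov.zeta ⟨1, by omega⟩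
              (j : DrinfeldSokolov.MultiLoop m)
                * (x ^ j * y ^ (2 * X.cox - j) + x ^ (2 * X.cox - j) * y ^ j)
                / (x ^ X.cox - y ^ X.cox) ^ 2)
          else 0) := by
  obtain ⟨r, e, h⟩ := X.exists_diagData
  refine ⟨?_, fun m hm => ?_⟩
  · rw [DrinfeldSokolov.AffType.genSeries_one h hY htau, DrinfeldSokolov.AffType.firstSeries_eq h]
  rw [DrinfeldSokolov.AffType.sum_smul_trace_star]
  obtain ⟨k, rfl⟩ := Nat.exists_eq_add_of_le' hm
  cases k with
  | zero =>
    rw [if_pos rfl]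
    exact DrinfeldSokolov.AffType.genSeries_two h hY hsol htau
  | succ k =>
    rw [if_neg (by omega), sub_zero]
    exact DrinfeldSokolov.AffType.genSeries_add_three h hY hsol htau k
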